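/- **Proposition 6.7 (bi-orthogonality of the non-symmetric Askey-Wilson polynomials).** *Parameters.* Let $k_0,u_0,k_1,u_1$ and $q$ be non-zero complex numbers with $0<|q|<1$, let $q^{1/2}$ be a fixed square root of $q$, and put $$a=k_1u_1,\quad b=-k_1u_1^{-1},\quad c=q^{1/2}k_0u_0,\quad d=-q^{1/2}k_0u_0^{-1}.$$ Assume that $k_0^2,k_1^2,u_1^2\notin\pm q^{\mathbb Z}$, that $k_0^2k_1^2q^N\neq 1$ for all integers $N\ge 1$ (so that the numbers $\gamma_m$ below are pairwise different), and that $ef\notin q^{\mathbb Z}$ for all $e,f\in\{a,b,c,d\}$ ($e=f$ allowed). *Polynomials.* Let $\mathcal A=\mathbb C[x^{\pm1}]$, and write $x^{\mu+\lambda\delta}=q^{\lambda}x^{\mu}$ for $\mu\in\mathbb Z$ and $\lambda\in\frac12\mathbb Z$ (where $q^{n/2}=(q^{1/2})^n$). Let $a_0=\delta-2$ and $a_1=2$, and let $s_0,s_1$ act linearly on $\mathcal A$ by $s_0(x^m)=q^mx^{-m}$, $s_1(x^m)=x^{-m}$. Define linear operators on $\mathcal A$ by $$T_i=k_i+k_i^{-1}\frac{(1-k_iu_ix^{a_i/2})(1+k_iu_i^{-1}x^{a_i/2})}{1-x^{a_i}}(s_i-\mathrm{id})\quad(i=0,1),\qquad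 Y=T_1T_0 .$$ Put $\gamma_m=(k_0k_1)^{\epsilon(m)}q^m$ with $\epsilon(m)=1$ for $m\ge0$ and $\epsilon(m)=-1$ for $m<0$, and order the monomials by $1\prec x^{-1}\prec x\prec x^{-2}\prec x^{2}\prec\cdots$. The non-symmetric Askey-Wilson polynomials $P_m$ ($m\in\mathbb Z$) are the unique Laurent polynomials with $P_m=x^m+{}$lower order terms with respect to $\preceq$ and $Y(P_m)=\gamma_mP_m$. Let $P_n'$ ($n\in\mathbb Z$) be the polynomials defined in the same way with $k_0,u_0,k_1,u_1,q^{1/2}$ replaced by their inverses. *Bilinear form.* Let $R=\{\pm2+m\delta : m\in\mathbb Z\}$ and $R^+=\{2\}\cup\{\pm2+m\delta : m\ge1\}$. For $\alpha=\pm2+m\delta\in R$ let $(t_\alpha,t_{\alpha/2})=(k_0,u_0)$ if $m$ is odd and $(t_\alpha,t_{\alpha/2})=(k_1,u_1)$ if $m$ is even, and put $$\Delta(x)=\prod_{\alpha\in R^+}\frac{1-x^{\alpha}}{(1-t_\alpha t_{\alpha/2}x^{\alpha/2})(1+t_\alpha t_{\alpha/2}^{-1}x^{\alpha/2})}.$$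 Let $C$ be a rectifiable Jordan curve in $\mathbb C\setminus\{0\}$, oriented counterclockwise, such that $eq^k$ is in its interior and $e^{-1}q^{-k}$ is in its exterior for all $e\in\{a,b,c,d\}$ and all integers $k\ge0$, and put $$\langle f,g\rangle=\frac1{2\pi i}\int_{C}f(x)\,g(x^{-1})\,\Delta(x)\,\frac{dx}{x}\qquad(f,g\in\mathcal A).$$ *Claim.* The polynomials $\{P_m\}_{m\in\mathbb Z}$ and $\{P_n'\}_{n\in\mathbb Z}$ exist, are uniquely determined, and are two bases of $\mathcal A$. For every contour $C$ as above, the integrals converge and define a non-degenerate bilinear form $\langle\cdot,\cdot\rangle$ on $\mathcal A$, and the two bases form a bi-orthogonal system with respect to it, i.e. $$\langle P_m,P_n'\rangle=0\qquad\text{for all } m,n\in\mathbb Z \text{ with } m\neq n.$$ -/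

import Mathlib

open scoped LaurentPolynomial

noncomputable section

namespace AskeyWilson

/-! ### The affine root system

An affine function `μ + (n / 2) δ` on the real line, with integers `μ` and `n`, is encoded as the
pair `(μ, n)`; all affine functions that occur are of this form. -/

/-- The pair `(μ, n)` stands for the affine function `μ + (n / 2) δ`. -/
abbrev Aff : Type := ℤ × ℤ

/-- `⟨f, a^∨⟩ = 2 ⟨f, a⟩ / ⟨a, a⟩`, which only depends on the gradients. The integer division is
exact when the gradient of `a` is `2` or `-2`, that is, for all `a ∈ R`. -/
def pairing (f a : Aff) : ℤ := 2 * f.1 / a.1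

/-- The affine reflection `s_a(f) = f - ⟨f, a^∨⟩ a`. -/
def reflect (a f : Aff) : Aff := f - pairing f a • a

/-- The reduced affine root system `R = {± 2 + m δ : m ∈ ℤ}`. -/
def rootsR : Set Aff := {a | (a.1 = 2 ∨ a.1 = -2) ∧ Even a.2}

/-- The positive roots `R⁺ = {2} ∪ {± 2 + m δ : m ≥ 1}` with respect to the basis
`a₀ = δ - 2`, `a₁ = 2`. -/
def posRootsR : Set Aff := {a ∈ rootsR | 0 < a.2 ∨ (a.2 = 0 ∧ a.1 = 2)}

/-- The affine function `a / 2`; the divisions are exact for `a ∈ R`. -/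
def half (a : Aff) : Aff := (a.1 / 2, a.2 / 2)

/-- The simple root `a₀ = δ - 2`. -/
def simpleRoot₀ : Aff := (-2, 2)

/-- The simple root `a₁ = 2`. -/
def simpleRoot₁ : Aff := (2, 0)

/-! ### Parameters -/

/-- The four values `k₀ = t_{a₀}`, `u₀ = t_{a₀/2}`, `k₁ = t_{a₁}`, `u₁ = t_{a₁/2}` that determine
a multiplicity function, and a choice `r` of the square root `q^{1/2}` of the deformation
parameter. -/
structure Parameters where
  k₀ : ℂ
  u₀ : ℂ
  k₁ : ℂ
  u₁ : ℂ
  /-- the square root `q^{1/2}` -/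
  r : ℂ

namespace Parameters

/-- The deformation parameter. -/
def q (t : Parameters) : ℂ := t.r ^ 2

/-- The inverse parameters `(t⁻¹, q⁻¹)`. -/
def inv (t : Parameters) : Parameters := ⟨t.k₀⁻¹, t.u₀⁻¹, t.k₁⁻¹, t.u₁⁻¹, t.r⁻¹⟩

/-- The multiplicity function `a ↦ t_a` on the roots `± 1 + (n / 2) δ` and `± 2 + m δ`. It takes
the values `u₀` on `± 1 + (1/2 + ℤ) δ`, `u₁` on `± 1 + ℤ δ`, `k₀` on `± 2 + (1 + 2ℤ) δ` and `k₁`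
on `± 2 + 2ℤ δ`, and the value `1` on affine functions that are not roots. -/
def mult (t : Parameters) (a : Aff) : ℂ :=
  if a.1 = 1 ∨ a.1 = -1 then (if Even a.2 then t.u₁ else t.u₀)
  else if (a.1 = 2 ∨ a.1 = -2) ∧ Even a.2 then (if Even (a.2 / 2) then t.k₁ else t.k₀)
  else 1

/-- The Askey-Wilson parameters
`a = k₁ u₁`, `b = - k₁ / u₁`, `c = q^{1/2} k₀ u₀`, `d = - q^{1/2} k₀ / u₀`. -/
def abcd (t : Parameters) : Fin 4 → ℂ :=
  ![t.k₁ * t.u₁, -(t.k₁ * t.u₁⁻¹), t.r * t.k₀ * t.u₀, -(t.r * t.k₀ * t.u₀⁻¹)]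

/-- The numbers `γ_m = (k₀ k₁)^{ε(m)} q^m`, where `ε(m) = 1` for `m ≥ 0` and `ε(m) = -1` for
`m < 0`. -/
def gamma (t : Parameters) (m : ℤ) : ℂ :=
  (t.k₀ * t.k₁) ^ (if 0 ≤ m then (1 : ℤ) else -1) * t.q ^ m

end Parameters

/-! ### Difference-reflection operators on Laurent polynomials -/

/-- The monomial `x^f = q^{n/2} x^μ` for `f = μ + (n / 2) δ`. -/
def monomial (t : Parameters) (f : Aff) : ℂ[T;T⁻¹] :=
  LaurentPolynomial.C (t.r ^ f.2) * LaurentPolynomial.T f.1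

/-- The linear map on Laurent polynomials with the prescribed values `F m` on the monomials
`x^m`. -/
def onMonomials (F : ℤ → ℂ[T;T⁻¹]) : ℂ[T;T⁻¹] →ₗ[ℂ] ℂ[T;T⁻¹] :=
  Finsupp.linearCombination ℂ F ∘ₗ
    (AddMonoidAlgebra.coeffLinearEquiv (M := ℤ) (S := ℂ) ℂ).toLinearMap

/-- The action of the reflection `s_a` on Laurent polynomials, `s_a (x^m) = x^{s_a(m)}`. -/
def reflection (t : Parameters) (a : Aff) : ℂ[T;T⁻¹] →ₗ[ℂ] ℂ[T;T⁻¹] :=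
  onMonomials fun m => monomial t (reflect a (m, 0))

/-- The divided difference operator `D_a f = (f - s_a f) / (1 - x^a)`, given by its values on
monomials. That it is this quotient is shown in `one_sub_monomial_mul_dividedDifference`. -/
def dividedDifference (t : Parameters) (a : Aff) : ℂ[T;T⁻¹] →ₗ[ℂ] ℂ[T;T⁻¹] :=
  onMonomials fun m =>
    (∑ j ∈ Finset.range (-pairing (m, 0) a).toNat, monomial t ((m, 0) + (j : ℤ) • a)) -
      ∑ j ∈ Finset.range (pairing (m, 0) a).toNat, monomial t ((m, 0) - ((j : ℤ) + 1) • a)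

theorem onMonomials_T (F : ℤ → ℂ[T;T⁻¹]) (m : ℤ) :
    onMonomials F (LaurentPolynomial.T m) = F m := by
  change Finsupp.linearCombination ℂ F (Finsupp.single m 1) = F m
  rw [Finsupp.linearCombination_single, one_smul]

theorem monomial_add {t : Parameters} (hr : t.r ≠ 0) (f g : Aff) :
    monomial t (f + g) = monomial t f * monomial t g := by
  simp only [monomial, Prod.fst_add, Prod.snd_add, zpow_add₀ hr, map_mul, LaurentPolynomial.T_add]
  ring

theorem monomial_int (t : Parameters) (m : ℤ) :
    monomial t (m, 0) = LaurentPolynomial.T m := by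
  simp [monomial]

theorem one_sub_monomial_mul_dividedDifference {t : Parameters} (hr : t.r ≠ 0) (a : Aff)
    (f : ℂ[T;T⁻¹]) :
    (1 - monomial t a) * dividedDifference t a f = f - reflection t a f := by
  induction f using LaurentPolynomial.induction_on' with
  | add f g hf hg => rw [map_add, map_add, mul_add, hf, hg]; ring
  | C_mul_T m z =>
    rw [← LaurentPolynomial.smul_eq_C_mul, map_smul, map_smul, mul_smul_comm, ← smul_sub]
    congr 1
    rw [dividedDifference, reflection, onMonomials_T, onMonomials_T, ← monomial_int t m, reflect]
    generalize pairing (m, 0) a = p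
    generalize ((m, 0) : Aff) = g
    obtain ⟨n, rfl | rfl⟩ := p.eq_nat_or_neg
    · have h : ∀ n : ℕ, (1 - monomial t a) *
          ∑ j ∈ Finset.range n, monomial t (g - ((j : ℤ) + 1) • a) =
            monomial t (g - (n : ℤ) • a) - monomial t g := by
        intro n
        induction n with
        | zero => simp
        | succ n ih =>
          have e : g - (n : ℤ) • a = (g - ((n : ℤ) + 1) • a) + a := by
            rw [add_smul, one_smul]; abel
          rw [Finset.sum_range_succ, mul_add, ih, e, monomial_add hr _ a, Nat.cast_succ]
          ring
      have e₁ : (-(n : ℤ)).toNat = 0 := by omega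
      rw [e₁, Int.toNat_natCast, Finset.sum_range_zero, zero_sub, mul_neg, h, neg_sub]
    · have h : ∀ n : ℕ, (1 - monomial t a) *
          ∑ j ∈ Finset.range n, monomial t (g + (j : ℤ) • a) =
            monomial t g - monomial t (g + (n : ℤ) • a) := by
        intro n
        induction n with
        | zero => simp
        | succ n ih =>
          have e : g + ((n : ℤ) + 1) • a = (g + (n : ℤ) • a) + a := by
            rw [add_smul, one_smul]; abel
          rw [Finset.sum_range_succ, mul_add, ih, Nat.cast_succ, e, monomial_add hr _ a]
          ring
      have e₁ : (-(n : ℤ)).toNat = 0 := by omega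
      rw [e₁, neg_neg, Int.toNat_natCast, Finset.sum_range_zero, sub_zero, h, neg_smul,
        sub_neg_eq_add]

/-- The difference-reflection operator
`k + k⁻¹ (1 - k u x^{a/2}) (1 + k u⁻¹ x^{a/2}) / (1 - x^a) (s_a - id)` with `k = t_a` and
`u = t_{a/2}`. -/
def diffReflection (t : Parameters) (a : Aff) : ℂ[T;T⁻¹] →ₗ[ℂ] ℂ[T;T⁻¹] :=
  t.mult a • LinearMap.id -
    (t.mult a)⁻¹ • (LinearMap.mulLeft ℂ
      ((1 - (t.mult a * t.mult (half a)) • monomial t (half a)) *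
        (1 + (t.mult a * (t.mult (half a))⁻¹) • monomial t (half a))) ∘ₗ dividedDifference t a)

/-- The operator `T₀`. -/
def opT₀ (t : Parameters) : ℂ[T;T⁻¹] →ₗ[ℂ] ℂ[T;T⁻¹] := diffReflection t simpleRoot₀

/-- The operator `T₁`. -/
def opT₁ (t : Parameters) : ℂ[T;T⁻¹] →ₗ[ℂ] ℂ[T;T⁻¹] := diffReflection t simpleRoot₁

/-- The Cherednik-Dunkl operator `Y = T₁ T₀`. -/
def opY (t : Parameters) : ℂ[T;T⁻¹] →ₗ[ℂ] ℂ[T;T⁻¹] := opT₁ t ∘ₗ opT₀ t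

/-! ### Non-symmetric Askey-Wilson polynomials -/

/-- The strict total order `1 ≺ x⁻¹ ≺ x ≺ x⁻² ≺ x² ≺ ⋯` on monomials, as an order on exponents. -/
def Prec (m n : ℤ) : Prop := |m| < |n| ∨ (|m| = |n| ∧ m < n)

/-- `P m` is the monic non-symmetric Askey-Wilson polynomial of degree `m` for all `m`:
`P m = x^m +` lower order terms, and `Y (P m) = γ_m P m`. -/
def IsNonsymmetricAskeyWilson (t : Parameters) (P : ℤ → ℂ[T;T⁻¹]) : Prop :=
  ∀ m : ℤ, (P m).coeff m = 1 ∧ (∀ n : ℤ, n ≠ m → (P m).coeff n ≠ 0 → Prec n m) ∧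
    opY t (P m) = t.gamma m • P m

/-! ### Contours

The oriented closed curve `C` is given by a Lipschitz parametrisation on `[0, 1]`. Since a
rectifiable curve is Lipschitz in its (normalised) arc length parameter, the curves obtained are
exactly the rectifiable ones. -/

/-- A rectifiable Jordan curve. -/
structure IsRectifiableJordanCurve (c : ℝ → ℂ) : Prop where
  lipschitz : ∃ K, LipschitzOnWith K c (Set.Icc 0 1)
  closed : c 0 = c 1
  simple : Set.InjOn c (Set.Ico 0 1)

/-- The set of points on the curve. -/
def trace (c : ℝ → ℂ) : Set ℂ := c '' Set.Icc 0 1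

/-- The interior of the curve: the points in bounded components of the complement. -/
def inside (c : ℝ → ℂ) : Set ℂ :=
  {z | z ∉ trace c ∧ Bornology.IsBounded (connectedComponentIn (trace c)ᶜ z)}

/-- The exterior of the curve: the points in unbounded components of the complement. -/
def outside (c : ℝ → ℂ) : Set ℂ :=
  {z | z ∉ trace c ∧ ¬ Bornology.IsBounded (connectedComponentIn (trace c)ᶜ z)}

/-- The contour integral `∫_{x ∈ c} F(x) dx`. -/
def contourIntegral (c : ℝ → ℂ) (F : ℂ → ℂ) : ℂ := ∫ s in (0 : ℝ)..1, F (c s) * deriv c s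

/-- Integrability of `F` along the curve. -/
def ContourIntegrable (c : ℝ → ℂ) (F : ℂ → ℂ) : Prop :=
  IntervalIntegrable (fun s => F (c s) * deriv c s) MeasureTheory.volume 0 1

/-- Counterclockwise orientation: the curve winds once, in the positive sense, around every point
in its interior. -/
def IsCounterclockwise (c : ℝ → ℂ) : Prop :=
  ∀ z ∈ inside c, contourIntegral c (fun x => (x - z)⁻¹) = 2 * Real.pi * Complex.I

/-- The contours `C` over which the weight function is integrated: counterclockwise rectifiable
Jordan curves in `ℂ \ {0}` with `e q^k` in the interior and `e⁻¹ q⁻ᵏ` in the exterior for all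
`e ∈ {a, b, c, d}` and `k ≥ 0`. -/
structure IsContour (t : Parameters) (c : ℝ → ℂ) : Prop where
  jordan : IsRectifiableJordanCurve c
  counterclockwise : IsCounterclockwise c
  zero_notMem : (0 : ℂ) ∉ trace c
  mem_inside : ∀ (i : Fin 4) (k : ℕ), t.abcd i * t.q ^ k ∈ inside c
  mem_outside : ∀ (i : Fin 4) (k : ℕ), (t.abcd i * t.q ^ k)⁻¹ ∈ outside c

/-! ### The bilinear form -/

/-- The value `x^f = q^{n/2} x^μ` for `f = μ + (n / 2) δ` and a complex number `x`. -/
def monomialAt (t : Parameters) (x : ℂ) (f : Aff) : ℂ := t.r ^ f.2 * x ^ f.1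

/-- The factor `(1 - x^a) / ((1 - t_a t_{a/2} x^{a/2}) (1 + t_a t_{a/2}⁻¹ x^{a/2}))`. -/
def weightFactor (t : Parameters) (x : ℂ) (a : Aff) : ℂ :=
  (1 - monomialAt t x a) /
    ((1 - t.mult a * t.mult (half a) * monomialAt t x (half a)) *
      (1 + t.mult a * (t.mult (half a))⁻¹ * monomialAt t x (half a)))

/-- The weight function `Δ(x)`, a product over the positive roots in `R⁺`. -/
def weight (t : Parameters) (x : ℂ) : ℂ := ∏' a : posRootsR, weightFactor t x a

/-- The value of a Laurent polynomial at a complex number. -/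
def evalAt (f : ℂ[T;T⁻¹]) (x : ℂ) : ℂ := f.coeff.sum fun n z => z * x ^ n

/-- The function `f(x) g(x⁻¹) Δ(x) / x`. -/
def integrand (t : Parameters) (f g : ℂ[T;T⁻¹]) (x : ℂ) : ℂ :=
  evalAt f x * evalAt g x⁻¹ * weight t x / x

/-- `⟨f, g⟩ = (2 π i)⁻¹ ∫_{x ∈ c} f(x) g(x⁻¹) Δ(x) dx / x`. -/
def form (t : Parameters) (c : ℝ → ℂ) (f g : ℂ[T;T⁻¹]) : ℂ :=
  (2 * Real.pi * Complex.I)⁻¹ * contourIntegral c (integrand t f g)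

/-- The infinite product defining the weight function converges (unconditionally) for `|q| < 1`. -/
theorem multipliable_weightFactor {t : Parameters} (hr₀ : t.r ≠ 0) (hr : ‖t.r‖ < 1) {x : ℂ}
    (hx : x ≠ 0) : Multipliable fun a : posRootsR => weightFactor t x a := by
  set y : posRootsR → ℂ := fun a => monomialAt t x (half a) with hy
  have hgrad : ∀ a : posRootsR, (half a).1 = 1 ∨ (half a).1 = -1 := by
    rintro ⟨a, ⟨h | h, -⟩, -⟩ <;> simp [half, h]
  have hlev : ∀ a : posRootsR, (half a).2 = ((a.1.2 / 2).toNat : ℤ) := by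
    rintro ⟨a, -, h⟩
    simp only [half]
    omega
  -- summability of the monomials
  have hsum : Summable fun a : posRootsR => ‖t.r‖ ^ (a.1.2 / 2).toNat := by
    have h1 : Summable fun p : Bool × ℕ => (1 : ℝ) * ‖t.r‖ ^ p.2 :=
      Summable.mul_of_nonneg (f := fun _ : Bool => (1 : ℝ)) (Summable.of_finite)
        (summable_geometric_of_lt_one (norm_nonneg _) hr) (fun _ => zero_le_one)
        (fun n => pow_nonneg (norm_nonneg _) n)
    have hinj : Function.Injective
        fun a : posRootsR => ((decide (a.1.1 = 2), (a.1.2 / 2).toNat) : Bool × ℕ) := by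
      rintro ⟨⟨m, n⟩, ⟨h1, h2⟩, h3⟩ ⟨⟨m', n'⟩, ⟨h1', h2'⟩, h3'⟩ h
      simp only [Prod.mk.injEq, decide_eq_decide] at h
      obtain ⟨h4, h5⟩ := h
      obtain ⟨j, hj⟩ := h2
      obtain ⟨j', hj'⟩ := h2'
      simp only at h1 h1' h3 h3' hj hj'
      have e1 : m = m' := by omega
      have e2 : n = n' := by omega
      exact Subtype.ext (Prod.ext e1 e2)
    simpa [Function.comp_def] using h1.comp_injective hinj
  have hbound : ∀ a, ‖y a‖ ≤ (‖x‖ + ‖x‖⁻¹) * ‖t.r‖ ^ (a.1.2 / 2).toNat := by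
    intro a
    have hx1 : ‖x ^ (half a).1‖ ≤ ‖x‖ + ‖x‖⁻¹ := by
      have := norm_nonneg x
      have := inv_nonneg.mpr this
      rcases hgrad a with h | h <;> simp [h]
    simp only [hy, monomialAt]
    rw [norm_mul, hlev a, zpow_natCast, norm_pow, mul_comm]
    gcongr
  have hysum : Summable fun a => ‖y a‖ :=
    Summable.of_nonneg_of_le (fun a => norm_nonneg _) hbound (hsum.mul_left _)
  have hy0 : Filter.Tendsto y Filter.cofinite (nhds 0) :=
    tendsto_zero_iff_norm_tendsto_zero.mpr hysum.tendsto_cofinite_zero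
  -- bounds for the parameters, which take finitely many values
  have hmult : ∃ M : ℝ, 0 ≤ M ∧ ∀ a : Aff, ‖t.mult a‖ ≤ M ∧ ‖(t.mult a)⁻¹‖ ≤ M := by
    refine ⟨‖t.k₀‖ + ‖t.u₀‖ + ‖t.k₁‖ + ‖t.u₁‖ + ‖t.k₀⁻¹‖ + ‖t.u₀⁻¹‖ + ‖t.k₁⁻¹‖ + ‖t.u₁⁻¹‖ + 1,
      by positivity, fun a => ?_⟩
    have := norm_nonneg t.k₀
    have := norm_nonneg t.u₀
    have := norm_nonneg t.k₁
    have := norm_nonneg t.u₁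
    have := norm_nonneg t.k₀⁻¹
    have := norm_nonneg t.u₀⁻¹
    have := norm_nonneg t.k₁⁻¹
    have := norm_nonneg t.u₁⁻¹
    have : ‖(1 : ℂ)‖ = 1 := norm_one
    unfold Parameters.mult
    split_ifs <;> constructor <;> (try rw [inv_one]) <;> linarith
  obtain ⟨M, hM, hM'⟩ := hmult
  set A : posRootsR → ℂ := fun a => t.mult a * t.mult (half a) with hA
  set B : posRootsR → ℂ := fun a => t.mult a * (t.mult (half a))⁻¹ with hB
  have hAM : ∀ a, ‖A a‖ ≤ M * M := fun a => by
    rw [hA, norm_mul]; gcongr; exacts [(hM' _).1, (hM' _).1]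
  have hBM : ∀ a, ‖B a‖ ≤ M * M := fun a => by
    rw [hB, norm_mul]; gcongr; exacts [(hM' _).1, (hM' _).2]
  have hAy : Filter.Tendsto (fun a => A a * y a) Filter.cofinite (nhds 0) := by
    refine squeeze_zero_norm (a := fun a => M * M * ‖y a‖) (fun a => ?_) ?_
    · rw [norm_mul]; gcongr; exact hAM a
    · simpa using hysum.tendsto_cofinite_zero.const_mul (M * M)
  have hBy : Filter.Tendsto (fun a => B a * y a) Filter.cofinite (nhds 0) := by
    refine squeeze_zero_norm (a := fun a => M * M * ‖y a‖) (fun a => ?_) ?_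
    · rw [norm_mul]; gcongr; exact hBM a
    · simpa using hysum.tendsto_cofinite_zero.const_mul (M * M)
  have hden : Filter.Tendsto (fun a => ‖(1 - A a * y a) * (1 + B a * y a)‖) Filter.cofinite
      (nhds 1) := by
    simpa using (((tendsto_const_nhds (x := (1 : ℂ))).sub hAy).mul
      ((tendsto_const_nhds (x := (1 : ℂ))).add hBy)).norm
  have hfac : ∀ a : posRootsR, weightFactor t x a =
      (1 - y a ^ 2) / ((1 - A a * y a) * (1 + B a * y a)) := by
    intro a
    have h2 : monomialAt t x a = y a ^ 2 := by
      have e : (a : Aff) = half a + half a := by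
        have h1 := a.2.1.1
        obtain ⟨j, hj⟩ := a.2.1.2
        refine Prod.ext ?_ ?_ <;> simp only [half, Prod.fst_add, Prod.snd_add] <;> omega
      conv_lhs => rw [e]
      simp only [hy, monomialAt, Prod.fst_add, Prod.snd_add, zpow_add₀ hr₀, zpow_add₀ hx]
      ring
    rw [weightFactor, h2]
  have key : Summable fun a : posRootsR => weightFactor t x a - 1 := by
    refine Summable.of_norm_bounded_eventually
      (g := fun a => 2 * ((2 * (M * M) + 1 + (M * M) * (M * M)) * ‖y a‖))
      ((hysum.mul_left _).mul_left _) ?_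
    filter_upwards [hden.eventually (lt_mem_nhds (show (1 / 2 : ℝ) < 1 by norm_num)),
      (tendsto_zero_iff_norm_tendsto_zero.mp hy0).eventually
        (gt_mem_nhds (show (0 : ℝ) < 1 by norm_num))] with a h1 h2
    set d := (1 - A a * y a) * (1 + B a * y a) with hd
    have hd0 : d ≠ 0 := by
      intro h
      rw [h, norm_zero] at h1
      norm_num at h1
    have e : weightFactor t x a - 1 = (A a - B a - y a + A a * B a * y a) * y a / d := by
      rw [hfac a, ← hd, div_sub_one hd0, hd]
      ring
    rw [e, norm_div, norm_mul, div_le_iff₀ (by linarith)]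
    have h3 : ‖A a - B a - y a + A a * B a * y a‖ ≤ 2 * (M * M) + 1 + (M * M) * (M * M) := by
      have h4 : ‖A a * B a * y a‖ ≤ (M * M) * (M * M) * 1 := by
        rw [norm_mul, norm_mul]; gcongr; exacts [hAM a, hBM a]
      have h5 := norm_add_le (A a - B a - y a) (A a * B a * y a)
      have h6 := norm_sub_le (A a - B a) (y a)
      have h7 := norm_sub_le (A a) (B a)
      linarith [hAM a, hBM a]
    have h8 : 0 ≤ (2 * (M * M) + 1 + (M * M) * (M * M)) * ‖y a‖ := by positivity
    calc _ ≤ (2 * (M * M) + 1 + (M * M) * (M * M)) * ‖y a‖ := by gcongr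
      _ ≤ _ := by nlinarith
  simpa using multipliable_one_add_of_summable key.norm

end AskeyWilson

end

noncomputable section

namespace AskeyWilson

open MeasureTheory Set Filter Topology

/-! ### Contour integrals along Lipschitz curves -/

section Curve

variable {c : ℝ → ℂ} {K : NNReal}

/-! Write T_i, Y for the operators with parameters (t, q) and T_i', Y' for those with inverted
parameters. The core is the invariance ⟨T_i f, T_i' g⟩ = ⟨f, g⟩, hence ⟨Y f, Y' g⟩ = ⟨f, g⟩
(`IsContour.bilin_opY_opY`). Since Y' P_n' = γ_n⁻¹ P_n', the number ⟨P_m, P_n'⟩ equals γ_m γ_n⁻¹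
times itself, and it vanishes as soon as γ_m ≠ γ_n.

For the invariance put y = x^{a_i/2} and let φ_i(y) be the quadratic numerator in T_i. Then Δ = (1 -
y²)/φ_i(y) · V_i with V_i invariant under s_i, that is, under x ↦ 1/x or x ↦ q/x. By pure algebra
(`adjoint_aux`) the adjointness defect is an s_i-antisymmetric function times V_i, so it remains to
see that integration against V_i dx/x is invariant under the reflection, although the contour itself
is not. Truncations of V_i are rational. With u_p = x/(x - p), every u_p^m dx/x with m ≥ 1
integrates to the integral of dx/(x - p), and x ↦ κ/x turns u_p into 1 - u_{κ/p}. Invariance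
therefore reduces to an identity between winding numbers, which holds because 0 and exactly one of
p, κ/p lie inside (`PartialFraction.contourIntegral_div_eq`). Only primitives, winding numbers and
uniform limits are needed; no contour is deformed.

Existence and uniqueness of the polynomials hold because Y is triangular on the ordered monomials
with pairwise different diagonal entries γ_m (`opY_T`, `triangular_exists_basis`).

For non-degeneracy, the left radical is an ideal stable under T_0 and T_1. A proper non-zero ideal
of this kind has a common zero z, and evaluating T_i f at z carries z to its reflection unless φ_i
vanishes there. The chains q^n z and q^{-n} z must both stop, which forces a product of two of a, b,
c, d to be a power of q (`eq_bot_or_eq_top_of_stable`). The radical is not everything, because some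
moment of Δ is non-zero (`IsContour.exists_form_one_ne_zero`): multiplied by its denominators, a
truncation of Δ becomes a truncated theta function, whose constant term is a Gaussian binomial
coefficient bounded away from 0. The second half of non-degeneracy then follows from the
bi-orthogonal bases. -/

theorem isCompact_trace (hc : LipschitzOnWith K c (Icc 0 1)) : IsCompact (trace c) :=
  isCompact_Icc.image_of_continuousOn hc.continuousOn

theorem mem_trace {s : ℝ} (hs : s ∈ Icc (0 : ℝ) 1) : c s ∈ trace c := mem_image_of_mem c hs

theorem norm_deriv_curve_le (hc : LipschitzOnWith K c (Icc 0 1)) {s : ℝ} (hs : s ∈ Ioo (0 : ℝ) 1) :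
    ‖deriv c s‖ ≤ K :=
  norm_deriv_le_of_lipschitzOn (Icc_mem_nhds hs.1 hs.2) hc

theorem contourIntegrable_of_continuousOn (hc : LipschitzOnWith K c (Icc 0 1)) {F : ℂ → ℂ}
    (hF : ContinuousOn F (trace c)) : ContourIntegrable c F := by
  obtain ⟨M, hM⟩ := (isCompact_trace hc).exists_bound_of_continuousOn hF
  have hcont : ContinuousOn (fun s => F (c s)) (Icc 0 1) :=
    hF.comp hc.continuousOn fun s hs => mem_trace hs
  -- The Lipschitz condition says nothing about `c` outside [0, 1], so the derivative is controlled
  -- only on the open interval; the endpoints are dropped as a null set.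
  rw [ContourIntegrable, intervalIntegrable_iff_integrableOn_Ioo_of_le zero_le_one]
  refine Integrable.of_bound (C := M * K) ?_ ?_
  · exact ((hcont.mono Ioo_subset_Icc_self).aestronglyMeasurable measurableSet_Ioo).mul
      (stronglyMeasurable_deriv c).aestronglyMeasurable
  · filter_upwards [ae_restrict_mem measurableSet_Ioo] with s hs
    have h1 := hM _ (mem_trace (c := c) (Ioo_subset_Icc_self hs))
    rw [norm_mul]
    exact mul_le_mul h1 (norm_deriv_curve_le hc hs) (norm_nonneg _) ((norm_nonneg _).trans h1)

theorem norm_contourIntegral_le (hc : LipschitzOnWith K c (Icc 0 1)) {F : ℂ → ℂ} {M : ℝ}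
    (hM : ∀ x ∈ trace c, ‖F x‖ ≤ M) : ‖contourIntegral c F‖ ≤ M * K := by
  have h := intervalIntegral.norm_integral_le_of_norm_le_const_ae (a := 0) (b := 1) (C := M * K)
    (f := fun s => F (c s) * deriv c s) ?_
  · simpa [contourIntegral] using h
  · have hne : ∀ᵐ s : ℝ, s ≠ 1 := by simp [ae_iff]
    filter_upwards [hne] with s hs1 hs
    rw [uIoc_of_le zero_le_one] at hs
    have h1 := hM _ (mem_trace (c := c) ⟨hs.1.le, hs.2⟩)
    rw [norm_mul]
    exact mul_le_mul h1 (norm_deriv_curve_le hc ⟨hs.1, lt_of_le_of_ne hs.2 hs1⟩) (norm_nonneg _)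
      ((norm_nonneg _).trans h1)

theorem contourIntegral_congr {F G : ℂ → ℂ} (h : EqOn F G (trace c)) :
    contourIntegral c F = contourIntegral c G := by
  refine intervalIntegral.integral_congr fun s hs => ?_
  rw [uIcc_of_le zero_le_one] at hs
  simp only [h (mem_trace hs)]

theorem contourIntegral_add {F G : ℂ → ℂ} (hF : ContourIntegrable c F)
    (hG : ContourIntegrable c G) :
    contourIntegral c (fun x => F x + G x) = contourIntegral c F + contourIntegral c G := by
  simp only [contourIntegral, add_mul]
  exact intervalIntegral.integral_add hF hG

theorem contourIntegral_sub {F G : ℂ → ℂ} (hF : ContourIntegrable c F)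
    (hG : ContourIntegrable c G) :
    contourIntegral c (fun x => F x - G x) = contourIntegral c F - contourIntegral c G := by
  simp only [contourIntegral, sub_mul]
  exact intervalIntegral.integral_sub hF hG

theorem contourIntegral_const_mul (z : ℂ) (F : ℂ → ℂ) :
    contourIntegral c (fun x => z * F x) = z * contourIntegral c F := by
  simp only [contourIntegral, mul_assoc]
  exact intervalIntegral.integral_const_mul _ _

/-- The contour integral of a derivative vanishes. -/
theorem contourIntegral_deriv_eq_zero (hc : LipschitzOnWith K c (Icc 0 1)) (hcl : c 0 = c 1)
    {G G' : ℂ → ℂ} (hG : ∀ x ∈ trace c, HasStrictDerivAt G (G' x) x)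
    (hG' : ContinuousOn G' (trace c)) : contourIntegral c G' = 0 := by
  -- A strictly differentiable function is locally Lipschitz, so its composite with the curve is
  -- Lipschitz on the compact interval, hence absolutely continuous. This replaces differentiability
  -- of the curve, which holds only almost everywhere.
  have hlip : ∃ L, LipschitzOnWith L (fun s => G (c s)) (Icc 0 1) := by
    refine LocallyLipschitzOn.exists_lipschitzOnWith_of_compact isCompact_Icc fun s hs => ?_
    obtain ⟨L, U, hU, hL⟩ := (hG _ (mem_trace hs)).hasStrictFDerivAt.exists_lipschitzOnWith
    refine ⟨L * K, Icc 0 1 ∩ c ⁻¹' U,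
      inter_mem self_mem_nhdsWithin (hc.continuousOn s hs hU), ?_⟩
    exact hL.comp (hc.mono inter_subset_left) fun x hx => hx.2
  obtain ⟨L, hL⟩ := hlip
  have hint := contourIntegrable_of_continuousOn hc hG'
  have hdiff : ∀ᵐ s : ℝ, s ∈ Ioo (0 : ℝ) 1 → HasDerivAt (fun s => G (c s)) (G' (c s) * deriv c s) s := by
    filter_upwards [hc.ae_differentiableWithinAt_of_mem] with s hs hs'
    have h1 := (hs (Ioo_subset_Icc_self hs')).differentiableAt (Icc_mem_nhds hs'.1 hs'.2)
    exact (hG _ (mem_trace (Ioo_subset_Icc_self hs'))).hasDerivAt.comp s h1.hasDerivAt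
  have hne : ∀ᵐ s : ℝ, s ≠ 0 ∧ s ≠ 1 := by
    rw [eventually_and]; constructor <;> simp [ae_iff]
  -- The fundamental theorem for absolutely continuous functions is used for real-valued functions,
  -- so the integral is tested against real-linear functionals; real and imaginary part suffice.
  have key : ∀ φ : ℂ →L[ℝ] ℝ, φ (contourIntegral c G') = 0 := by
    intro φ
    have hφ : LipschitzOnWith (‖φ‖₊ * L) (fun s => φ (G (c s))) (uIcc 0 1) := by
      rw [uIcc_of_le zero_le_one]
      exact φ.lipschitz.comp_lipschitzOnWith hL
    have h1 := hφ.absolutelyContinuousOnInterval.integral_deriv_eq_sub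
    rw [hcl, sub_self] at h1
    rw [contourIntegral, ← φ.intervalIntegral_comp_comm hint]
    refine Eq.trans (intervalIntegral.integral_congr_ae ?_) h1
    filter_upwards [hdiff, hne] with s hs hs1 hs2
    rw [uIoc_of_le zero_le_one] at hs2
    exact ((φ.hasFDerivAt.comp_hasDerivAt s (hs ⟨hs2.1, lt_of_le_of_ne hs2.2 hs1.2⟩)).deriv).symm
  exact Complex.ext (key Complex.reCLM) (key Complex.imCLM)

theorem tendsto_contourIntegral (hc : LipschitzOnWith K c (Icc 0 1)) {F : ℕ → ℂ → ℂ} {G : ℂ → ℂ}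
    (hF : ∀ n, ContinuousOn (F n) (trace c)) (h : TendstoUniformlyOn F G atTop (trace c)) :
    Tendsto (fun n => contourIntegral c (F n)) atTop (𝓝 (contourIntegral c G)) := by
  have hG : ContinuousOn G (trace c) := h.continuousOn (Frequently.of_forall hF)
  rw [Metric.tendsto_atTop]
  intro ε hε
  obtain ⟨N, hN⟩ := eventually_atTop.1 (Metric.tendstoUniformlyOn_iff.1 h (ε / (K + 1)) (by positivity))
  refine ⟨N, fun n hn => ?_⟩
  rw [dist_eq_norm, ← contourIntegral_sub (contourIntegrable_of_continuousOn hc (hF n))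
    (contourIntegrable_of_continuousOn hc hG)]
  refine (norm_contourIntegral_le hc (M := ε / (K + 1)) fun x hx => ?_).trans_lt ?_
  · have := hN n hn x hx
    rw [dist_comm, dist_eq_norm] at this
    exact this.le
  · rw [div_mul_eq_mul_div, div_lt_iff₀ (by positivity)]
    nlinarith [K.2]

/-! ### Winding numbers -/

theorem continuousOn_inv_sub {z : ℂ} (hz : z ∉ trace c) :
    ContinuousOn (fun x => (x - z)⁻¹) (trace c) :=
  (continuousOn_id.sub continuousOn_const).inv₀ fun x hx h =>
    hz (by rwa [← sub_eq_zero.1 (show x - z = 0 from h)])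

theorem contourIntegral_inv_sub_sq (hc : LipschitzOnWith K c (Icc 0 1)) (hcl : c 0 = c 1)
    {z : ℂ} (hz : z ∉ trace c) : contourIntegral c (fun x => ((x - z)⁻¹) ^ 2) = 0 := by
  refine contourIntegral_deriv_eq_zero hc hcl (G := fun x => -(x - z)⁻¹) (fun x hx => ?_)
    ((continuousOn_inv_sub hz).pow 2)
  have hx : x - z ≠ 0 := fun h => hz (by rwa [← sub_eq_zero.1 h])
  have h1 : HasStrictDerivAt (fun x => x - z) 1 x := by
    simpa using (hasStrictDerivAt_id x).fun_sub (hasStrictDerivAt_const x z)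
  have h2 := HasStrictDerivAt.neg ((hasStrictDerivAt_inv hx).comp x h1)
  rw [mul_one, neg_neg, ← inv_pow] at h2
  exact h2

/-- Expand 1/(x-w) = 1/(x-z) + (w-z)/(x-z)² + (w-z)²/((x-z)²(x-w)). The middle term has a primitive
and integrates to 0; the last is O(|w-z|²) because `w` stays away from the curve. -/
theorem hasDerivAt_contourIntegral_inv_sub (hc : LipschitzOnWith K c (Icc 0 1)) (hcl : c 0 = c 1)
    {z : ℂ} (hz : z ∉ trace c) :
    HasDerivAt (fun w => contourIntegral c (fun x => (x - w)⁻¹)) 0 z := by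
  have hopen : (trace c)ᶜ ∈ 𝓝 z := (isCompact_trace hc).isClosed.isOpen_compl.mem_nhds hz
  obtain ⟨δ, hδ, hball⟩ := Metric.mem_nhds_iff.1 hopen
  have hdist : ∀ w ∈ Metric.ball z (δ / 2), ∀ x ∈ trace c, δ / 2 ≤ ‖x - w‖ := by
    intro w hw x hx
    by_contra! h
    refine hball (a := x) ?_ hx
    rw [Metric.mem_ball, dist_eq_norm] at hw ⊢
    calc ‖x - z‖ = ‖(x - w) + (w - z)‖ := by ring_nf
      _ ≤ _ := norm_add_le _ _
      _ < δ := by linarith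
  rw [hasDerivAt_iff_isLittleO]
  refine Asymptotics.IsBigO.trans_isLittleO (g := fun w => (w - z) ^ 2) ?_ ?_
  · refine Asymptotics.IsBigO.of_bound ((δ / 2)⁻¹ ^ 3 * K) ?_
    filter_upwards [Metric.ball_mem_nhds z (half_pos hδ)] with w hw
    have hwt : w ∉ trace c := fun h => by
      have := hdist w hw w h
      simp only [sub_self, norm_zero] at this
      linarith
    have hz2 : ∀ x ∈ trace c, x - z ≠ 0 := fun x hx h => hz (by rwa [← sub_eq_zero.1 h])
    have hw2 : ∀ x ∈ trace c, x - w ≠ 0 := fun x hx h => hwt (by rwa [← sub_eq_zero.1 h])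
    have e : contourIntegral c (fun x => (x - w)⁻¹) - contourIntegral c (fun x => (x - z)⁻¹) =
        (w - z) ^ 2 * contourIntegral c (fun x => ((x - z)⁻¹) ^ 2 * (x - w)⁻¹) := by
      have h1 : contourIntegral c (fun x => (x - w)⁻¹ - (x - z)⁻¹) =
          contourIntegral c (fun x => (w - z) ^ 2 * (((x - z)⁻¹) ^ 2 * (x - w)⁻¹) +
            (w - z) * ((x - z)⁻¹) ^ 2) := by
        refine contourIntegral_congr fun x hx => ?_
        have := hz2 x hx
        have := hw2 x hx
        field_simp
        ring
      rw [← contourIntegral_sub (contourIntegrable_of_continuousOn hc (continuousOn_inv_sub hwt))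
        (contourIntegrable_of_continuousOn hc (continuousOn_inv_sub hz)), h1,
        contourIntegral_add, contourIntegral_const_mul, contourIntegral_const_mul,
        contourIntegral_inv_sub_sq hc hcl hz, mul_zero, add_zero]
      · exact contourIntegrable_of_continuousOn hc (continuousOn_const.mul
          (((continuousOn_inv_sub hz).pow 2).mul (continuousOn_inv_sub hwt)))
      · exact contourIntegrable_of_continuousOn hc (continuousOn_const.mul
          ((continuousOn_inv_sub hz).pow 2))
    rw [smul_zero, sub_zero, e, norm_mul, mul_comm]
    refine mul_le_mul_of_nonneg_right (norm_contourIntegral_le hc fun x hx => ?_) (norm_nonneg _)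
    have h1 := hdist z (Metric.mem_ball_self (half_pos hδ)) x hx
    have h2 := hdist w hw x hx
    rw [norm_mul, norm_pow, norm_inv, norm_inv, pow_succ _ 2]
    gcongr
  · have := (Asymptotics.isLittleO_pow_sub_sub z (m := 2) one_lt_two)
    refine Asymptotics.IsLittleO.of_norm_left ?_
    simpa using this

theorem contourIntegral_inv_sub_const (hc : LipschitzOnWith K c (Icc 0 1)) (hcl : c 0 = c 1)
    {z w : ℂ} (hw : w ∈ connectedComponentIn (trace c)ᶜ z) (hz : z ∉ trace c) :
    contourIntegral c (fun x => (x - w)⁻¹) = contourIntegral c (fun x => (x - z)⁻¹) := by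
  have hopen := (isCompact_trace hc).isClosed.isOpen_compl.connectedComponentIn (x := z)
  have hsub := connectedComponentIn_subset (trace c)ᶜ z
  refine hopen.is_const_of_deriv_eq_zero isPreconnected_connectedComponentIn
    (f := fun w => contourIntegral c (fun x => (x - w)⁻¹)) ?_ ?_ hw (mem_connectedComponentIn hz)
  · exact fun y hy => (hasDerivAt_contourIntegral_inv_sub hc hcl
      (hsub hy)).differentiableAt.differentiableWithinAt
  · exact fun y hy => (hasDerivAt_contourIntegral_inv_sub hc hcl (hsub hy)).deriv

theorem contourIntegral_inv_sub_of_outside (hc : LipschitzOnWith K c (Icc 0 1)) (hcl : c 0 = c 1)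
    {z : ℂ} (hz : z ∈ outside c) : contourIntegral c (fun x => (x - z)⁻¹) = 0 := by
  obtain ⟨B, hB⟩ := (isCompact_trace hc).isBounded.exists_norm_le
  by_contra hne
  set ε := ‖contourIntegral c (fun x => (x - z)⁻¹)‖ with hε
  have hε0 : 0 < ε := norm_pos_iff.2 hne
  apply hz.2
  -- Beyond this radius the distance to the curve is at least (K+1)/ε, so the integral would have
  -- norm at most εK/(K+1) < ε. By constancy on the component it has norm ε, so the component would
  -- be bounded.
  refine isBounded_iff_forall_norm_le.2 ⟨B + (K + 1) / ε, fun w hw => ?_⟩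
  by_contra! hlt
  have hpos : 0 < (K + 1) / ε := by positivity
  have h1 : ∀ x ∈ trace c, ‖(x - w)⁻¹‖ ≤ ((K + 1) / ε)⁻¹ := by
    intro x hx
    rw [norm_inv]
    gcongr
    have := norm_sub_norm_le w x
    have := hB x hx
    rw [norm_sub_rev]
    linarith
  have h2 := norm_contourIntegral_le hc h1
  rw [contourIntegral_inv_sub_const hc hcl hw hz.1, ← hε, inv_div, div_mul_eq_mul_div,
    le_div_iff₀ (by positivity)] at h2
  nlinarith

end Curve

/-! ### Rational functions with prescribed poles -/

/-- The non-zero complex numbers outside a set of poles. -/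
def regularSet (S : Set ℂ) : Set ℂ := {x | x ≠ 0 ∧ x ∉ S}

/-- Functions that agree outside `S ∪ {0}` with a linear combination of the powers of `x` and the
powers of `x / (x - p)` for `p ∈ S`. -/
inductive PartialFraction (S : Set ℂ) : (ℂ → ℂ) → Prop
  | zpow (n : ℤ) : PartialFraction S fun x => x ^ n
  | pole (p : ℂ) (hp : p ∈ S) (m : ℕ) : PartialFraction S fun x => (x / (x - p)) ^ m
  | add {F G : ℂ → ℂ} (hF : PartialFraction S F) (hG : PartialFraction S G) :
      PartialFraction S fun x => F x + G x
  | const_mul (z : ℂ) {F : ℂ → ℂ} (hF : PartialFraction S F) : PartialFraction S fun x => z * F x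
  | congr {F G : ℂ → ℂ} (hF : PartialFraction S F) (h : EqOn F G (regularSet S)) :
      PartialFraction S G

theorem sub_ne_zero_of_regular {S : Set ℂ} {p x : ℂ} (hp : p ∈ S) (hx : x ∈ regularSet S) :
    x - p ≠ 0 := fun h => hx.2 (by rwa [sub_eq_zero.1 h])

namespace PartialFraction

variable {S : Set ℂ} {F G : ℂ → ℂ}

theorem one : PartialFraction S fun _ => 1 := (zpow 0).congr fun x _ => by simp

theorem sub (hF : PartialFraction S F) (hG : PartialFraction S G) :
    PartialFraction S fun x => F x - G x :=
  (hF.add (hG.const_mul (-1))).congr fun x _ => by ring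

/-- With u = x/(x-p), one has x u = x + p u, which lowers the power of u attached to x. -/
theorem id_mul (hF : PartialFraction S F) : PartialFraction S fun x => x * F x := by
  induction hF with
  | zpow n =>
    exact (zpow (n + 1)).congr fun x hx => by simp only [zpow_add_one₀ hx.1, mul_comm]
  | pole p hp m =>
    induction m with
    | zero => exact (zpow 1).congr fun x _ => by simp
    | succ m ih =>
      refine (ih.add ((pole p hp (m + 1)).const_mul p)).congr fun x hx => ?_
      have := sub_ne_zero_of_regular hp hx
      simp only [pow_succ]
      field_simp
      ring
  | add _ _ h1 h2 => exact (h1.add h2).congr fun x _ => by ring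
  | const_mul z _ h => exact (h.const_mul z).congr fun x _ => by ring
  | congr _ h ih => exact ih.congr fun x hx => by simp only [h hx]

/-- With u = x/(x-p), one has x⁻¹ u = p⁻¹ (u - 1); this is where p ≠ 0 enters. -/
theorem inv_mul (h0 : (0 : ℂ) ∉ S) (hF : PartialFraction S F) :
    PartialFraction S fun x => x⁻¹ * F x := by
  induction hF with
  | zpow n =>
    exact (zpow (n - 1)).congr fun x hx => by simp only [zpow_sub_one₀ hx.1, mul_comm]
  | pole p hp m =>
    cases m with
    | zero => exact (zpow (-1)).congr fun x _ => by simp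
    | succ m =>
      have hp0 : p ≠ 0 := fun h => h0 (h ▸ hp)
      refine (((pole p hp (m + 1)).sub (pole p hp m)).const_mul p⁻¹).congr fun x hx => ?_
      have := sub_ne_zero_of_regular hp hx
      have := hx.1
      simp only [pow_succ]
      field_simp
      ring
  | add _ _ h1 h2 => exact (h1.add h2).congr fun x _ => by ring
  | const_mul z _ h => exact (h.const_mul z).congr fun x _ => by ring
  | congr _ h ih => exact ih.congr fun x hx => by simp only [h hx]

theorem zpow_mul (h0 : (0 : ℂ) ∉ S) (n : ℤ) (hF : PartialFraction S F) :
    PartialFraction S fun x => x ^ n * F x := by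
  induction n with
  | zero => exact hF.congr fun x _ => by simp
  | succ n ih => exact ih.id_mul.congr fun x hx => by simp only [zpow_add_one₀ hx.1]; ring
  | pred n ih => exact (ih.inv_mul h0).congr fun x hx => by simp only [zpow_sub_one₀ hx.1]; ring

/-- For distinct poles, (p - r) u_p u_r = p u_p - r u_r, where u_p = x/(x-p). Induction on the
exponent of u_p separates the poles. -/
theorem pole_mul (h0 : (0 : ℂ) ∉ S) {r : ℂ} (hr : r ∈ S) (hF : PartialFraction S F) :
    PartialFraction S fun x => x / (x - r) * F x := by
  have hr1 : PartialFraction S fun x => x / (x - r) := (pole r hr 1).congr fun x _ => by simp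
  induction hF with
  | zpow n => exact (hr1.zpow_mul h0 n).congr fun x _ => by ring
  | pole p hp m =>
    by_cases hpr : p = r
    · exact (pole r hr (m + 1)).congr fun x _ => by simp only [hpr, pow_succ']
    · have hpr' : p - r ≠ 0 := sub_ne_zero.2 hpr
      induction m with
      | zero => exact hr1.congr fun x _ => by simp
      | succ m ih =>
        refine (((pole p hp (m + 1)).const_mul p).sub (ih.const_mul r)).const_mul (p - r)⁻¹
          |>.congr fun x hx => ?_
        have := sub_ne_zero_of_regular hp hx
        have := sub_ne_zero_of_regular hr hx
        simp only [pow_succ]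
        field_simp
        ring
  | add _ _ h1 h2 => exact (h1.add h2).congr fun x _ => by ring
  | const_mul z _ h => exact (h.const_mul z).congr fun x _ => by ring
  | congr _ h ih => exact ih.congr fun x hx => by simp only [h hx]

theorem mul (h0 : (0 : ℂ) ∉ S) (hF : PartialFraction S F) (hG : PartialFraction S G) :
    PartialFraction S fun x => F x * G x := by
  induction hF with
  | zpow n => exact hG.zpow_mul h0 n
  | pole p hp m =>
    induction m with
    | zero => exact hG.congr fun x _ => by simp
    | succ m ih => exact (ih.pole_mul h0 hp).congr fun x _ => by simp only [pow_succ]; ring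
  | add _ _ h1 h2 => exact (h1.add h2).congr fun x _ => by ring
  | const_mul z _ h => exact (h.const_mul z).congr fun x _ => by ring
  | congr _ h ih => exact ih.congr fun x hx => by simp only [h hx]

theorem prod (h0 : (0 : ℂ) ∉ S) {ι : Type*} (s : Finset ι) {f : ι → ℂ → ℂ}
    (hf : ∀ i ∈ s, PartialFraction S (f i)) : PartialFraction S fun x => ∏ i ∈ s, f i x := by
  induction s using Finset.cons_induction with
  | empty => simpa using one
  | cons i s hi ih =>
    simp only [Finset.prod_cons]
    exact (hf i (by simp)).mul h0 (ih fun j hj => hf j (by simp [hj]))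

theorem inv_one_sub_mul (h0 : (0 : ℂ) ∉ S) {α : ℂ} (hα : α⁻¹ ∈ S) :
    PartialFraction S fun x => (1 - α * x)⁻¹ := by
  have hα0 : α ≠ 0 := fun h => h0 (by rwa [h, inv_zero] at hα)
  refine (one.sub (pole _ hα 1)).congr fun x hx => ?_
  have h1 := sub_ne_zero_of_regular hα hx
  have h2 : 1 - α * x ≠ 0 := fun h => h1 (by field_simp; linear_combination -h)
  have h3 : x - α⁻¹ = -(1 - α * x) / α := by field_simp; ring
  simp only [pow_one, h3]
  generalize hd : 1 - α * x = d at h2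
  have hx' : x = (1 - d) / α := by rw [← hd]; field_simp; ring
  rw [hx']
  field_simp
  ring

theorem inv_one_sub_div {β : ℂ} (hβ : β ∈ S) :
    PartialFraction S fun x => (1 - β / x)⁻¹ := by
  refine (pole _ hβ 1).congr fun x hx => ?_
  have h1 := sub_ne_zero_of_regular hβ hx
  have := hx.1
  simp only [pow_one]
  field_simp

theorem continuousOn (hF : PartialFraction S F) : ContinuousOn F (regularSet S) := by
  induction hF with
  | zpow n => exact fun x hx => (continuousAt_zpow₀ x n (Or.inl hx.1)).continuousWithinAt
  | pole p hp m =>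
    exact (continuousOn_id.div (continuousOn_id.sub continuousOn_const) fun x hx =>
      sub_ne_zero_of_regular hp hx).pow m
  | add _ _ h1 h2 => exact h1.add h2
  | const_mul z _ h => exact continuousOn_const.mul h
  | congr _ h ih => exact ih.congr h.symm

end PartialFraction

/-! ### Contour integrals of rational functions -/

section Curve

variable {c : ℝ → ℂ} {K : NNReal}

theorem contourIntegral_zpow (hc : LipschitzOnWith K c (Icc 0 1)) (hcl : c 0 = c 1)
    (h0 : (0 : ℂ) ∉ trace c) (n : ℤ) :
    contourIntegral c (fun x => x ^ n / x) =
      if n = 0 then contourIntegral c (fun x => (x - 0)⁻¹) else 0 := by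
  have hx0 : ∀ x ∈ trace c, x ≠ 0 := fun x hx h => h0 (h ▸ hx)
  split_ifs with hn
  · subst hn
    exact contourIntegral_congr fun x _ => by simp
  · have hn' : (n : ℂ) ≠ 0 := Int.cast_ne_zero.2 hn
    refine contourIntegral_deriv_eq_zero hc hcl (G := fun x => (n : ℂ)⁻¹ * x ^ n)
      (fun x hx => ?_) ?_
    · have := (hasStrictDerivAt_zpow n x (Or.inl (hx0 x hx))).const_mul (n : ℂ)⁻¹
      rwa [inv_mul_cancel_left₀ hn', zpow_sub_one₀ (hx0 x hx), ← div_eq_mul_inv] at this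
    · exact ContinuousOn.div (fun x hx => (continuousAt_zpow₀ x n
        (Or.inl (hx0 x hx))).continuousWithinAt) continuousOn_id hx0

/-- A curve winds equally often around the points where `x / (x - p)` takes large values for the
functions `(x / (x - p)) ^ m`, `m ≥ 1`. -/
theorem contourIntegral_pole (hc : LipschitzOnWith K c (Icc 0 1)) (hcl : c 0 = c 1)
    (h0 : (0 : ℂ) ∉ trace c) {p : ℂ} (hp : p ∉ trace c) (m : ℕ) :
    contourIntegral c (fun x => (x / (x - p)) ^ (m + 1) / x) =
      contourIntegral c (fun x => (x - p)⁻¹) := by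
  have hx0 : ∀ x ∈ trace c, x ≠ 0 := fun x hx h => h0 (h ▸ hx)
  have hxp : ∀ x ∈ trace c, x - p ≠ 0 := fun x hx h => hp (by rwa [← sub_eq_zero.1 h])
  have hcont : ∀ n : ℕ, ContinuousOn (fun x => (x / (x - p)) ^ n / x) (trace c) := fun n =>
    ((continuousOn_id.div (continuousOn_id.sub continuousOn_const) hxp).pow n).div
      continuousOn_id hx0
  induction m with
  | zero =>
    refine contourIntegral_congr fun x hx => ?_
    have := hx0 x hx
    have := hxp x hx
    simp only [zero_add, pow_one]
    field_simp
  | succ m ih =>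
    rw [← ih, ← sub_eq_zero, ← contourIntegral_sub
      (contourIntegrable_of_continuousOn hc (hcont _))
      (contourIntegrable_of_continuousOn hc (hcont _))]
    have hm : ((m : ℂ) + 1) ≠ 0 := by exact_mod_cast Nat.succ_ne_zero m
    -- For u = x/(x-p) one has x u' = u - u², so consecutive powers of u divided by x differ by an
    -- exact derivative.
    refine contourIntegral_deriv_eq_zero hc hcl
      (G := fun x => -((m : ℂ) + 1)⁻¹ * (x / (x - p)) ^ (m + 1)) (fun x hx => ?_)
      ((hcont _).sub (hcont _))
    have h1 : HasStrictDerivAt (fun x => x - p) 1 x := by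
      simpa using (hasStrictDerivAt_id x).fun_sub (hasStrictDerivAt_const x p)
    have h2 := (((hasStrictDerivAt_id x).fun_div h1 (hxp x hx)).fun_pow (m + 1)).const_mul
      (-((m : ℂ) + 1)⁻¹)
    refine h2.congr_deriv ?_
    have := hx0 x hx
    have := hxp x hx
    have e : (1 * (x - p) - x * 1) / (x - p) ^ 2 = -(x / (x - p) * (x / (x - p) - 1) / x) := by
      field_simp
      ring
    simp only [id, Nat.cast_add, Nat.cast_one, Nat.add_sub_cancel, e]
    generalize x / (x - p) = u
    field_simp
    ring

/-- The function v = 1 - x/(x-p) satisfies x v' = v² - v, so all powers v^m with m ≥ 1 have the same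
integral against dx/x, and v/x = 1/x - 1/(x-p). -/
theorem contourIntegral_one_sub_pole (hc : LipschitzOnWith K c (Icc 0 1)) (hcl : c 0 = c 1)
    (h0 : (0 : ℂ) ∉ trace c) {p : ℂ} (hp : p ∉ trace c) (m : ℕ) :
    contourIntegral c (fun x => (1 - x / (x - p)) ^ (m + 1) / x) =
      contourIntegral c (fun x => (x - 0)⁻¹) - contourIntegral c (fun x => (x - p)⁻¹) := by
  have hx0 : ∀ x ∈ trace c, x ≠ 0 := fun x hx h => h0 (h ▸ hx)
  have hxp : ∀ x ∈ trace c, x - p ≠ 0 := fun x hx h => hp (by rwa [← sub_eq_zero.1 h])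
  have hcont : ∀ n : ℕ, ContinuousOn (fun x => (1 - x / (x - p)) ^ n / x) (trace c) := fun n =>
    ((continuousOn_const.sub
      (continuousOn_id.div (continuousOn_id.sub continuousOn_const) hxp)).pow n).div
      continuousOn_id hx0
  induction m with
  | zero =>
    rw [← contourIntegral_sub
      (contourIntegrable_of_continuousOn hc (continuousOn_inv_sub h0))
      (contourIntegrable_of_continuousOn hc (continuousOn_inv_sub hp))]
    refine contourIntegral_congr fun x hx => ?_
    have := hx0 x hx
    have := hxp x hx
    simp only [zero_add, pow_one, sub_zero]
    field_simp
  | succ m ih =>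
    rw [← ih, ← sub_eq_zero, ← contourIntegral_sub
      (contourIntegrable_of_continuousOn hc (hcont _))
      (contourIntegrable_of_continuousOn hc (hcont _))]
    have hm : ((m : ℂ) + 1) ≠ 0 := by exact_mod_cast Nat.succ_ne_zero m
    refine contourIntegral_deriv_eq_zero hc hcl
      (G := fun x => ((m : ℂ) + 1)⁻¹ * (1 - x / (x - p)) ^ (m + 1)) (fun x hx => ?_)
      ((hcont _).sub (hcont _))
    have h1 : HasStrictDerivAt (fun x => x - p) 1 x := by
      simpa using (hasStrictDerivAt_id x).fun_sub (hasStrictDerivAt_const x p)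
    have h2 := (((hasStrictDerivAt_const x (1 : ℂ)).fun_sub
      ((hasStrictDerivAt_id x).fun_div h1 (hxp x hx))).fun_pow (m + 1)).const_mul
      (((m : ℂ) + 1)⁻¹)
    refine h2.congr_deriv ?_
    have := hx0 x hx
    have := hxp x hx
    have e : 0 - (1 * (x - p) - x * 1) / (x - p) ^ 2 =
        (1 - x / (x - p)) * (1 - x / (x - p) - 1) / x := by
      field_simp
      ring
    simp only [id, Nat.cast_add, Nat.cast_one, Nat.add_sub_cancel, e]
    generalize 1 - x / (x - p) = u
    field_simp
    ring

/-- Invariance of contour integrals under `x ↦ κ / x` for rational functions whose poles are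
exchanged by this map, if one of `p` and `κ / p` is in the interior for every pole `p`. -/
theorem PartialFraction.contourIntegral_div_eq (hc : LipschitzOnWith K c (Icc 0 1))
    (hcl : c 0 = c 1) (h0 : (0 : ℂ) ∉ trace c) {S : Set ℂ} (hS0 : (0 : ℂ) ∉ S)
    (hS : ∀ p ∈ S, p ∉ trace c) {κ : ℂ} (hκ : κ ≠ 0) (hκS : ∀ p ∈ S, κ / p ∈ S)
    (hW : ∀ p ∈ S, contourIntegral c (fun x => (x - p)⁻¹) +
      contourIntegral c (fun x => (x - κ / p)⁻¹) = contourIntegral c (fun x => (x - 0)⁻¹))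
    {F : ℂ → ℂ} (hF : PartialFraction S F) :
    contourIntegral c (fun x => F x / x) = contourIntegral c (fun x => F (κ / x) / x) := by
  have hx0 : ∀ x ∈ trace c, x ≠ 0 := fun x hx h => h0 (h ▸ hx)
  have hreg : trace c ⊆ regularSet S := fun x hx => ⟨hx0 x hx, fun h => hS x h hx⟩
  have hreg' : MapsTo (fun x => κ / x) (trace c) (regularSet S) := fun x hx =>
    ⟨div_ne_zero hκ (hx0 x hx), fun h => hS _ (hκS _ h) (by
      rwa [div_div_cancel₀ hκ])⟩
  have hint : ∀ {F}, PartialFraction S F → ContourIntegrable c fun x => F x / x := fun hF =>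
    contourIntegrable_of_continuousOn hc ((hF.continuousOn.mono hreg).div continuousOn_id hx0)
  have hint' : ∀ {F}, PartialFraction S F → ContourIntegrable c fun x => F (κ / x) / x :=
    fun hF => contourIntegrable_of_continuousOn hc ((hF.continuousOn.comp
      (continuousOn_const.div continuousOn_id hx0) hreg').div continuousOn_id hx0)
  induction hF with
  | zpow n =>
    have e : contourIntegral c (fun x => (κ / x) ^ n / x) =
        κ ^ n * contourIntegral c (fun x => x ^ (-n) / x) := by
      rw [← contourIntegral_const_mul]
      exact contourIntegral_congr fun x _ => by
        simp only [div_zpow, zpow_neg]; ring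
    rw [e, contourIntegral_zpow hc hcl h0, contourIntegral_zpow hc hcl h0]
    by_cases hn : n = 0 <;> simp [hn]
  | pole p hp m =>
    cases m with
    | zero => exact contourIntegral_congr fun x _ => by simp
    | succ m =>
      have hκp : κ / p ∈ S := hκS p hp
      -- All positive powers of x/(x-p) integrate like 1/(x-p). By `hW` this is the value attached
      -- to 0 minus the one attached to κ/p, which is the integral of a power of 1 - x/(x-κ/p), the
      -- reflected function.
      rw [contourIntegral_pole hc hcl h0 (hS p hp), eq_sub_of_add_eq (hW p hp),
        ← contourIntegral_one_sub_pole hc hcl h0 (hS _ hκp) m]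
      refine contourIntegral_congr fun x hx => ?_
      have h1 := hx0 x hx
      have h2 := sub_ne_zero_of_regular hp (hreg' hx)
      have h3 := sub_ne_zero_of_regular hκp (hreg hx)
      have hp0 : p ≠ 0 := fun h => hS0 (h ▸ hp)
      have e : 1 - x / (x - κ / p) = κ / x / (κ / x - p) := by
        rw [one_sub_div h3, div_eq_div_iff h3 h2]
        field_simp
        ring
      simp only [e]
  | @add F G hF hG h1 h2 =>
    simp only [add_div]
    rw [contourIntegral_add (hint hF) (hint hG), contourIntegral_add (hint' hF) (hint' hG), h1, h2]
  | const_mul z _ h =>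
    simp only [mul_div_assoc]
    rw [contourIntegral_const_mul, contourIntegral_const_mul, h]
  | @congr F G _ h ih =>
    have e1 : contourIntegral c (fun x => G x / x) = contourIntegral c (fun x => F x / x) :=
      contourIntegral_congr fun x hx => by simp only [h (hreg hx)]
    have e2 : contourIntegral c (fun x => G (κ / x) / x) =
        contourIntegral c (fun x => F (κ / x) / x) :=
      contourIntegral_congr fun x hx => by
        have := h (hreg' hx)
        simp only at this ⊢
        rw [this]
    rw [e1, e2, ih]

end Curve

/-! ### Uniform limits of products -/

theorem tendstoUniformlyOn_mul_of_bounded {α : Type*} {s : Set α} {f g : ℕ → α → ℂ} {F G : α → ℂ}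
    {A B : ℝ} (hf : TendstoUniformlyOn f F atTop s) (hg : TendstoUniformlyOn g G atTop s)
    (hF : ∀ x ∈ s, ‖F x‖ ≤ A) (hG : ∀ x ∈ s, ‖G x‖ ≤ B) :
    TendstoUniformlyOn (fun n x => f n x * g n x) (fun x => F x * G x) atTop s := by
  rcases s.eq_empty_or_nonempty with rfl | ⟨x₀, hx₀⟩
  · exact tendstoUniformlyOn_empty
  have hA : 0 ≤ A := (norm_nonneg _).trans (hF x₀ hx₀)
  have hB : 0 ≤ B := (norm_nonneg _).trans (hG x₀ hx₀)
  rw [Metric.tendstoUniformlyOn_iff] at *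
  intro ε hε
  -- The error of the product is at most (A + B) δ + δ². The bound δ ≤ 1 makes this linear in δ, and
  -- the spare unit in A + B + 2 makes the final inequality strict.
  set δ := min 1 (ε / (A + B + 2)) with hδ
  have hδ0 : 0 < δ := by positivity
  have hδ1 : δ ≤ 1 := min_le_left _ _
  have hδ2 : δ * (A + B + 2) ≤ ε := (le_div_iff₀ (by positivity)).1 (min_le_right _ _)
  filter_upwards [hf δ hδ0, hg δ hδ0] with n h1 h2 x hx
  have h3 := h1 x hx
  have h4 := h2 x hx
  have h5 := hF x hx
  have h6 := hG x hx
  rw [dist_eq_norm] at *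
  have e : F x * G x - f n x * g n x = F x * (G x - g n x) + (F x - f n x) * G x -
      (F x - f n x) * (G x - g n x) := by ring
  rw [e]
  calc _ ≤ ‖F x‖ * ‖G x - g n x‖ + ‖F x - f n x‖ * ‖G x‖ + ‖F x - f n x‖ * ‖G x - g n x‖ := by
        refine (norm_sub_le _ _).trans (add_le_add ((norm_add_le _ _).trans ?_) ?_) <;>
        simp only [norm_mul, le_refl]
    _ ≤ A * δ + δ * B + δ * 1 := by
        gcongr
        exact h4.le.trans hδ1
    _ < ε := by nlinarith

/-! ### The weight function as a product of two infinite products -/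

/-- The coefficients `a, c q^{-1/2}, a, c q^{-1/2}, …`. -/
def coeffA (t : Parameters) (m : ℕ) : ℂ := if Even m then t.k₁ * t.u₁ else t.k₀ * t.u₀

/-- The coefficients `b, d q^{-1/2}, b, d q^{-1/2}, …`. -/
def coeffB (t : Parameters) (m : ℕ) : ℂ := if Even m then -(t.k₁ * t.u₁⁻¹) else -(t.k₀ * t.u₀⁻¹)

/-- The denominator of the factor of the weight function that belongs to the root `2 + m δ`. -/
def halfDen (t : Parameters) (m : ℕ) (x : ℂ) : ℂ :=
  (1 - coeffA t m * t.r ^ m * x) * (1 - coeffB t m * t.r ^ m * x)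

/-- The factor of the weight function that belongs to the root `2 + m δ`. -/
def halfFactor (t : Parameters) (m : ℕ) (x : ℂ) : ℂ := (1 - (t.r ^ m * x) ^ 2) / halfDen t m x

/-- The product of the factors of the weight function for the roots `2 + m δ` with `n ≤ m`. -/
def halfProd (t : Parameters) (n : ℕ) (x : ℂ) : ℂ := ∏' m : ℕ, halfFactor t (m + n) x

theorem exists_coeff_bound (t : Parameters) :
    ∃ M : ℝ, 0 ≤ M ∧ ∀ m, ‖coeffA t m‖ ≤ M ∧ ‖coeffB t m‖ ≤ M := by
  refine ⟨‖t.k₁ * t.u₁‖ + ‖t.k₀ * t.u₀‖ + ‖t.k₁ * t.u₁⁻¹‖ + ‖t.k₀ * t.u₀⁻¹‖, by positivity,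
    fun m => ?_⟩
  have := norm_nonneg (t.k₁ * t.u₁)
  have := norm_nonneg (t.k₀ * t.u₀)
  have := norm_nonneg (t.k₁ * t.u₁⁻¹)
  have := norm_nonneg (t.k₀ * t.u₀⁻¹)
  unfold coeffA coeffB
  split_ifs <;> simp only [norm_neg] <;> constructor <;> linarith

theorem continuousOn_halfFactor (t : Parameters) (m : ℕ) {K : Set ℂ}
    (h : ∀ x ∈ K, halfDen t m x ≠ 0) : ContinuousOn (halfFactor t m) K := by
  refine ContinuousOn.div (by fun_prop) ?_ h
  unfold halfDen
  fun_prop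

/-- With y = q^{m/2} x, the factor minus 1 is y times a bounded expression over the denominator.
Once (M+1)|y| ≤ 1/4, each linear factor of the denominator has norm at least 3/4, so their product
has norm at least 1/2. The bound is uniform on discs, since only late factors are concerned and
these have no poles there. -/
theorem eventually_halfFactor_sub_one_le {t : Parameters} (hr : ‖t.r‖ < 1) (B : ℝ) (hB : 0 ≤ B) :
    ∃ C : ℝ, ∀ᶠ m : ℕ in atTop, ∀ x : ℂ, ‖x‖ ≤ B →
      ‖halfFactor t m x - 1‖ ≤ C * ‖t.r‖ ^ m := by
  obtain ⟨M, hM, hM'⟩ := exists_coeff_bound t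
  refine ⟨2 * (1 + M) ^ 2 * B, ?_⟩
  have hlim : Tendsto (fun m : ℕ => ‖t.r‖ ^ m * B) atTop (𝓝 0) := by
    simpa using (tendsto_pow_atTop_nhds_zero_of_lt_one (norm_nonneg _) hr).mul_const B
  filter_upwards [hlim.eventually (gt_mem_nhds (show (0 : ℝ) < 1 / (4 * (M + 1)) by positivity))]
    with m hm x hx
  obtain ⟨h1, h2⟩ := hM' m
  set y := t.r ^ m * x with hy
  have hyB : ‖y‖ ≤ ‖t.r‖ ^ m * B := by rw [hy, norm_mul, norm_pow]; gcongr
  have hy1 : (M + 1) * ‖y‖ ≤ 1 / 4 := by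
    have := (hyB.trans hm.le)
    rw [le_div_iff₀ (by positivity)] at this
    linarith
  have hyn := norm_nonneg y
  have hy2 : ‖y‖ ≤ 1 := by nlinarith
  have hden : ∀ z : ℂ, ‖z‖ ≤ M → 3 / 4 ≤ ‖1 - z * y‖ := by
    intro z hz
    have h3 := norm_sub_norm_le 1 (z * y)
    rw [norm_one, norm_mul] at h3
    nlinarith
  have e0 : halfDen t m x = (1 - coeffA t m * y) * (1 - coeffB t m * y) := by
    rw [halfDen, hy]; ring
  have hd : 1 / 2 ≤ ‖halfDen t m x‖ := by
    rw [e0, norm_mul]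
    nlinarith [hden _ h1, hden _ h2]
  have hd0 : halfDen t m x ≠ 0 := fun h => by rw [h, norm_zero] at hd; norm_num at hd
  have e : halfFactor t m x - 1 =
      (coeffA t m + coeffB t m - y - coeffA t m * coeffB t m * y) * y / halfDen t m x := by
    rw [halfFactor, div_sub_one hd0, ← hy, e0]
    ring
  rw [e, norm_div, norm_mul, div_le_iff₀ (by linarith)]
  have h4 : ‖coeffA t m + coeffB t m - y - coeffA t m * coeffB t m * y‖ ≤ (1 + M) ^ 2 := by
    have h5 : ‖coeffA t m * coeffB t m * y‖ ≤ M * M * 1 := by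
      rw [norm_mul, norm_mul]; gcongr
    have h6 := norm_sub_le (coeffA t m + coeffB t m - y) (coeffA t m * coeffB t m * y)
    have h7 := norm_sub_le (coeffA t m + coeffB t m) y
    have h8 := norm_add_le (coeffA t m) (coeffB t m)
    nlinarith
  have h9 : 0 ≤ (1 + M) ^ 2 * (‖t.r‖ ^ m * B) := by positivity
  calc _ ≤ (1 + M) ^ 2 * (‖t.r‖ ^ m * B) := by gcongr
    _ ≤ _ := by nlinarith

theorem hasProdUniformlyOn_halfFactor {t : Parameters} (hr : ‖t.r‖ < 1) (n : ℕ) {K : Set ℂ}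
    (hK : IsCompact K) (h : ∀ m, ContinuousOn (halfFactor t (m + n)) K) :
    HasProdUniformlyOn (fun m => halfFactor t (m + n)) (halfProd t n) K := by
  obtain ⟨B, hB⟩ := hK.isBounded.exists_norm_le
  obtain ⟨C, hC⟩ := eventually_halfFactor_sub_one_le hr (max B 0) (le_max_right _ _)
  have hs : Summable fun m : ℕ => C * ‖t.r‖ ^ (m + n) :=
    ((summable_nat_add_iff n).2 (summable_geometric_of_lt_one (norm_nonneg _) hr)).mul_left C
  have key := hs.hasProdUniformlyOn_nat_one_add
    (f := fun m x => halfFactor t (m + n) x - 1) hK ?_ fun m => (h m).sub continuousOn_const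
  · simp only [add_sub_cancel] at key
    exact key
  · filter_upwards [(tendsto_add_atTop_nat n).eventually hC] with m hm x hx
    exact hm x ((hB x hx).trans (le_max_left _ _))

/-- On a singleton continuity is automatic, so poles need not be excluded: a factor with vanishing
denominator has value 0 by the convention for division. -/
theorem multipliable_halfFactor {t : Parameters} (hr : ‖t.r‖ < 1) (n : ℕ) (x : ℂ) :
    Multipliable fun m => halfFactor t (m + n) x :=
  (hasProdUniformlyOn_halfFactor hr n isCompact_singleton
    fun _ => continuousOn_singleton _ x).multipliableUniformlyOn.multipliable (mem_singleton x)

theorem halfProd_eq_mul {t : Parameters} (hr : ‖t.r‖ < 1) (n : ℕ) (x : ℂ) :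
    halfProd t n x = halfFactor t n x * halfProd t (n + 1) x := by
  rw [halfProd, tprod_eq_zero_mul', zero_add, halfProd]
  · congr 1
    refine tprod_congr fun m => ?_
    rw [add_assoc, add_comm 1 n]
  · have := multipliable_halfFactor hr (n + 1) x
    convert this using 3
    ring

theorem coeffA_add_two (t : Parameters) (m : ℕ) : coeffA t (m + 2) = coeffA t m := by
  simp [coeffA, Nat.even_add]

theorem coeffB_add_two (t : Parameters) (m : ℕ) : coeffB t (m + 2) = coeffB t m := by
  simp [coeffB, Nat.even_add]

/-- The coefficients have period two and q is the square of `t.r`, so a shift of the index by two is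
the dilation by q. This is the source of the symmetry x ↦ q/x in `weight_eq_mul₀`. -/
theorem halfFactor_add_two (t : Parameters) (m : ℕ) (x : ℂ) :
    halfFactor t (m + 2) x = halfFactor t m (t.q * x) := by
  simp only [halfFactor, halfDen, coeffA_add_two, coeffB_add_two, pow_add, Parameters.q]
  ring_nf

theorem halfProd_two (t : Parameters) (x : ℂ) : halfProd t 2 x = halfProd t 0 (t.q * x) :=
  tprod_congr fun m => by rw [halfFactor_add_two, add_zero]

theorem coeffs_eq_mult (t : Parameters) (m : ℕ) {s s' : ℤ} (hs : s = 1 ∨ s = -1)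
    (hs' : s' = 2 * s) :
    t.mult (s', 2 * m) * t.mult (s, m) = coeffA t m ∧
      t.mult (s', 2 * m) * (t.mult (s, m))⁻¹ = -coeffB t m := by
  have h1 : s' ≠ 1 ∧ s' ≠ -1 := by omega
  have h2 : s' = 2 ∨ s' = -2 := by omega
  have h3 : (2 * m : ℤ) / 2 = m := by omega
  simp only [Parameters.mult, hs, h1, h2, if_true, if_false, or_self, coeffA, coeffB, h3,
    even_two_mul, and_self, Int.even_coe_nat]
  split_ifs <;> simp

theorem weightFactor_eq_halfFactor (t : Parameters) (m : ℕ) {s : ℤ} (hs : s = 1 ∨ s = -1)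
    (x : ℂ) :
    weightFactor t x (2 * s, 2 * m) = halfFactor t m (x ^ s) := by
  obtain ⟨h1, h2⟩ := coeffs_eq_mult t m hs rfl
  have e1 : half (2 * s, 2 * (m : ℤ)) = (s, (m : ℤ)) := by
    simp [half]
  rw [weightFactor, e1, h1, h2, halfFactor, halfDen]
  have e2 : monomialAt t x (s, (m : ℤ)) = t.r ^ m * x ^ s := by simp [monomialAt]
  have e3 : monomialAt t x (2 * s, 2 * (m : ℤ)) = (t.r ^ m * x ^ s) ^ 2 := by
    simp only [monomialAt]
    rw [mul_comm 2 s, mul_comm 2 (m : ℤ), zpow_mul, zpow_mul, zpow_natCast]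
    norm_cast
    ring
  rw [e2, e3]
  ring_nf

/-- The positive roots `2 + m δ` with `m ≥ 0` and `-2 + m δ` with `m ≥ 1`. -/
def posRoot : ℕ ⊕ ℕ → posRootsR
  | Sum.inl m => ⟨(2 * 1, 2 * (m : ℤ)), ⟨⟨Or.inl rfl, even_two_mul _⟩, by
      simp only [mul_one, and_true]; omega⟩⟩
  | Sum.inr m => ⟨(2 * -1, 2 * ((m + 1 : ℕ) : ℤ)), ⟨⟨Or.inr rfl, even_two_mul _⟩, by
      left; push_cast; omega⟩⟩

theorem posRoot_bijective : Function.Bijective posRoot := by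
  constructor
  · rintro (m | m) (n | n) h <;>
    have h1 := congrArg (fun a : posRootsR => a.1.1) h <;>
    have h2 := congrArg (fun a : posRootsR => a.1.2) h <;>
    simp only [posRoot] at h1 h2 <;>
    first | (exfalso; omega) | (congr 1; omega)
  · rintro ⟨⟨s, n⟩, ⟨h1, ⟨j, hj⟩⟩, h3⟩
    simp only at h1 hj h3
    rcases h1 with rfl | rfl
    · refine ⟨Sum.inl j.toNat, Subtype.ext (Prod.ext rfl ?_)⟩
      simp only [posRoot]
      omega
    · refine ⟨Sum.inr (j - 1).toNat, Subtype.ext (Prod.ext rfl ?_)⟩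
      simp only [posRoot]
      omega

theorem weight_eq_mul {t : Parameters} (hr : ‖t.r‖ < 1) (x : ℂ) :
    weight t x = halfProd t 0 x * halfProd t 1 x⁻¹ := by
  rw [weight, ← (Equiv.ofBijective posRoot posRoot_bijective).tprod_eq]
  simp only [Equiv.ofBijective_apply]
  have e1 : ∀ m : ℕ, weightFactor t x (posRoot (Sum.inl m)) = halfFactor t (m + 0) x := by
    intro m
    simpa [posRoot] using weightFactor_eq_halfFactor t m (s := 1) (Or.inl rfl) x
  have e2 : ∀ m : ℕ, weightFactor t x (posRoot (Sum.inr m)) = halfFactor t (m + 1) x⁻¹ := by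
    intro m
    simpa [posRoot] using weightFactor_eq_halfFactor t (m + 1) (s := -1) (Or.inr rfl) x
  rw [Multipliable.tprod_sum]
  · simp only [e1, e2, halfProd]
  · simpa only [Function.comp_def, e1] using multipliable_halfFactor hr 0 x
  · simpa only [Function.comp_def, e2] using multipliable_halfFactor hr 1 x⁻¹

/-- The part of the weight function that is invariant under `x ↦ x⁻¹`. -/
theorem weight_eq_mul₁ {t : Parameters} (hr : ‖t.r‖ < 1) (x : ℂ) :
    weight t x = halfFactor t 0 x * (halfProd t 1 x * halfProd t 1 (1 / x)) := by
  rw [weight_eq_mul hr x, halfProd_eq_mul hr 0, one_div, mul_assoc]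

/-- The part of the weight function that is invariant under `x ↦ q / x`. -/
theorem weight_eq_mul₀ {t : Parameters} (hr : ‖t.r‖ < 1) (x : ℂ) :
    weight t x = halfFactor t 1 x⁻¹ * (halfProd t 0 x * halfProd t 0 (t.q / x)) := by
  rw [weight_eq_mul hr x, halfProd_eq_mul hr 1, halfProd_two, div_eq_mul_inv]
  ring

/-! ### Evaluation of Laurent polynomials -/

theorem evalAt_add (f g : ℂ[T;T⁻¹]) (x : ℂ) : evalAt (f + g) x = evalAt f x + evalAt g x :=
  Finsupp.sum_add_index' (by simp) (by intros; ring)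

theorem evalAt_smul (z : ℂ) (f : ℂ[T;T⁻¹]) (x : ℂ) : evalAt (z • f) x = z * evalAt f x := by
  rw [evalAt, AddMonoidAlgebra.coeff_smul, Finsupp.sum_smul_index (by simp), evalAt, Finsupp.sum,
    Finsupp.sum, Finset.mul_sum]
  exact Finset.sum_congr rfl fun _ _ => by ring

theorem evalAt_T (n : ℤ) (x : ℂ) : evalAt (LaurentPolynomial.T n) x = x ^ n := by
  change (Finsupp.single n (1 : ℂ)).sum _ = _
  rw [Finsupp.sum_single_index] <;> simp

/-- Evaluation at a non-zero complex number, as an algebra homomorphism. -/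
def evalHom (x : ℂ) (hx : x ≠ 0) : ℂ[T;T⁻¹] →+* ℂ :=
  LaurentPolynomial.eval₂ (RingHom.id ℂ) (Units.mk0 x hx)

theorem evalHom_apply {x : ℂ} (hx : x ≠ 0) (f : ℂ[T;T⁻¹]) : evalHom x hx f = evalAt f x := by
  induction f using LaurentPolynomial.induction_on' with
  | add f g hf hg => rw [map_add, hf, hg, evalAt_add]
  | C_mul_T n z =>
    rw [← LaurentPolynomial.smul_eq_C_mul, evalAt_smul, evalAt_T, LaurentPolynomial.smul_eq_C_mul,
      evalHom, map_mul, LaurentPolynomial.eval₂_C, LaurentPolynomial.eval₂_T]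
    simp

theorem evalAt_mul {x : ℂ} (hx : x ≠ 0) (f g : ℂ[T;T⁻¹]) :
    evalAt (f * g) x = evalAt f x * evalAt g x := by
  simp only [← evalHom_apply hx, map_mul]

theorem evalAt_sub {x : ℂ} (hx : x ≠ 0) (f g : ℂ[T;T⁻¹]) :
    evalAt (f - g) x = evalAt f x - evalAt g x := by
  simp only [← evalHom_apply hx, map_sub]

theorem evalAt_one {x : ℂ} (hx : x ≠ 0) : evalAt 1 x = 1 := by
  simp only [← evalHom_apply hx, map_one]

theorem evalAt_prod {x : ℂ} (hx : x ≠ 0) {ι : Type*} (s : Finset ι) (f : ι → ℂ[T;T⁻¹]) :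
    evalAt (∏ i ∈ s, f i) x = ∏ i ∈ s, evalAt (f i) x := by
  simp only [← evalHom_apply hx, map_prod]

theorem evalAt_monomial (t : Parameters) (f : Aff) (x : ℂ) :
    evalAt (monomial t f) x = monomialAt t x f := by
  rw [monomial, ← LaurentPolynomial.smul_eq_C_mul, evalAt_smul, evalAt_T, monomialAt]

theorem PartialFraction.evalAt_const_mul (S : Set ℂ) (f : ℂ[T;T⁻¹]) (z : ℂ) :
    PartialFraction S fun x => evalAt f (z * x) := by
  induction f using LaurentPolynomial.induction_on' with
  | add f g hf hg => exact (hf.add hg).congr fun x _ => by rw [evalAt_add]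
  | C_mul_T n w =>
    refine ((zpow n).const_mul (w * z ^ n)).congr fun x _ => ?_
    rw [← LaurentPolynomial.smul_eq_C_mul, evalAt_smul, evalAt_T, mul_zpow, ← mul_assoc]

theorem PartialFraction.evalAt (S : Set ℂ) (f : ℂ[T;T⁻¹]) : PartialFraction S (evalAt f) :=
  (PartialFraction.evalAt_const_mul S f 1).congr fun x _ => by simp only [one_mul]

theorem evalAt_inv (f : ℂ[T;T⁻¹]) (x : ℂ) :
    evalAt f x⁻¹ = evalAt (LaurentPolynomial.invert f) x := by
  induction f using LaurentPolynomial.induction_on' with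
  | add f g hf hg => rw [map_add, evalAt_add, evalAt_add, hf, hg]
  | C_mul_T n w =>
    rw [map_mul, LaurentPolynomial.invert_C, LaurentPolynomial.invert_T,
      ← LaurentPolynomial.smul_eq_C_mul, ← LaurentPolynomial.smul_eq_C_mul, evalAt_smul,
      evalAt_smul, evalAt_T, evalAt_T, inv_zpow']

theorem continuousOn_evalAt (f : ℂ[T;T⁻¹]) {K : Set ℂ} (hK : (0 : ℂ) ∉ K) :
    ContinuousOn (evalAt f) K :=
  (PartialFraction.evalAt ∅ f).continuousOn.mono fun _ hx => ⟨fun h => hK (h ▸ hx), notMem_empty _⟩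

/-! ### The poles of the weight function -/

/-- The standing assumptions on the parameters. -/
structure Parameters.Admissible (t : Parameters) : Prop where
  k₀_ne : t.k₀ ≠ 0
  u₀_ne : t.u₀ ≠ 0
  k₁_ne : t.k₁ ≠ 0
  u₁_ne : t.u₁ ≠ 0
  q_pos : 0 < ‖t.q‖
  q_lt_one : ‖t.q‖ < 1

namespace Parameters.Admissible

variable {t : Parameters} (ht : t.Admissible)
include ht

theorem q_ne : t.q ≠ 0 := norm_pos_iff.1 ht.q_pos

theorem r_ne : t.r ≠ 0 := fun h => ht.q_ne (by simp [Parameters.q, h])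

theorem r_lt_one : ‖t.r‖ < 1 := by
  have h := ht.q_lt_one
  rw [Parameters.q, norm_pow] at h
  exact (pow_lt_one_iff_of_nonneg (norm_nonneg _) two_ne_zero).1 h

theorem abcd_ne (i : Fin 4) : t.abcd i ≠ 0 := by
  have := ht.k₀_ne
  have := ht.u₀_ne
  have := ht.k₁_ne
  have := ht.u₁_ne
  have := ht.r_ne
  fin_cases i <;> simp [Parameters.abcd, *]

end Parameters.Admissible

theorem exists_coeffA_eq (t : Parameters) (m : ℕ) :
    ∃ i k, coeffA t m * t.r ^ m = t.abcd i * t.q ^ k := by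
  obtain ⟨k, rfl | rfl⟩ := m.even_or_odd'
  · exact ⟨0, k, by simp [coeffA, Parameters.abcd, Parameters.q, pow_mul]⟩
  · refine ⟨2, k, ?_⟩
    have : ¬ Even (2 * k + 1) := by simp
    simp only [coeffA, this, if_false, Parameters.abcd, Parameters.q, pow_succ, pow_mul,
      Matrix.cons_val]
    ring

theorem exists_coeffB_eq (t : Parameters) (m : ℕ) :
    ∃ i k, coeffB t m * t.r ^ m = t.abcd i * t.q ^ k := by
  obtain ⟨k, rfl | rfl⟩ := m.even_or_odd'
  · exact ⟨1, k, by simp [coeffB, Parameters.abcd, Parameters.q, pow_mul]⟩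
  · refine ⟨3, k, ?_⟩
    have : ¬ Even (2 * k + 1) := by simp
    simp only [coeffB, this, if_false, Parameters.abcd, Parameters.q, pow_succ, pow_mul,
      Matrix.cons_val]
    ring

/-- The points `e q^{k + j}` and `e⁻¹ q^{-k}` with `e ∈ {a, b, c, d}` and `k ≥ 0`. -/
def poles (t : Parameters) (j : ℕ) : Set ℂ :=
  {p | ∃ i k, p = t.abcd i * t.q ^ (k + j) ∨ p = (t.abcd i * t.q ^ k)⁻¹}

theorem zero_notMem_poles {t : Parameters} (ht : t.Admissible) (j : ℕ) : (0 : ℂ) ∉ poles t j := by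
  rintro ⟨i, k, h | h⟩
  · exact mul_ne_zero (ht.abcd_ne i) (pow_ne_zero _ ht.q_ne) h.symm
  · exact inv_ne_zero (mul_ne_zero (ht.abcd_ne i) (pow_ne_zero _ ht.q_ne)) h.symm

theorem div_mem_poles {t : Parameters} (ht : t.Admissible) (j : ℕ) {p : ℂ} (hp : p ∈ poles t j) :
    t.q ^ j / p ∈ poles t j := by
  have hq := ht.q_ne
  obtain ⟨i, k, rfl | rfl⟩ := hp
  · have := ht.abcd_ne i
    exact ⟨i, k, Or.inr (by rw [pow_add]; field_simp)⟩
  · exact ⟨i, k, Or.inl (by rw [div_inv_eq_mul, pow_add]; ring)⟩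

/-- All poles are of the form e⁻¹ q⁻ᵏ, and these belong to `poles t j` for every `j`; the points e
q^{k+j} are needed only for the reflected factors. -/
theorem partialFraction_halfFactor {t : Parameters} (ht : t.Admissible) (j m : ℕ) :
    PartialFraction (poles t j) (halfFactor t m) := by
  have h0 := zero_notMem_poles ht j
  obtain ⟨i, k, h1⟩ := exists_coeffA_eq t m
  obtain ⟨i', k', h2⟩ := exists_coeffB_eq t m
  refine ((PartialFraction.one.sub ((PartialFraction.zpow 2).const_mul (t.r ^ (2 * m)))).mul h0
    ((PartialFraction.inv_one_sub_mul (α := coeffA t m * t.r ^ m) h0 ?_).mul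
    h0 (PartialFraction.inv_one_sub_mul (α := coeffB t m * t.r ^ m) h0 ?_))).congr fun x _ => ?_
  · exact ⟨i, k, Or.inr (by rw [h1])⟩
  · exact ⟨i', k', Or.inr (by rw [h2])⟩
  simp only [halfFactor, halfDen, div_eq_mul_inv, mul_inv]
  norm_cast
  ring

theorem partialFraction_halfFactor_div {t : Parameters} (ht : t.Admissible) (j m : ℕ) :
    PartialFraction (poles t j) fun x => halfFactor t m (t.q ^ j / x) := by
  have h0 := zero_notMem_poles ht j
  obtain ⟨i, k, h1⟩ := exists_coeffA_eq t m
  obtain ⟨i', k', h2⟩ := exists_coeffB_eq t m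
  refine ((PartialFraction.one.sub ((PartialFraction.zpow (-2)).const_mul
    ((t.r ^ m * t.q ^ j) ^ 2))).mul h0
    ((PartialFraction.inv_one_sub_div (β := coeffA t m * t.r ^ m * t.q ^ j) ?_).mul
    h0 (PartialFraction.inv_one_sub_div (β := coeffB t m * t.r ^ m * t.q ^ j) ?_))).congr
    fun x _ => ?_
  · exact ⟨i, k, Or.inl (by rw [h1, pow_add, mul_assoc])⟩
  · exact ⟨i', k', Or.inl (by rw [h2, pow_add, mul_assoc])⟩
  simp only [halfFactor, halfDen, div_eq_mul_inv, mul_inv, zpow_neg]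
  norm_cast
  ring

/-! ### Invariance of the contour integrals -/

/-- The points a q^k lie inside and converge to 0. The component of 0 is open, so it contains one of
them and is the bounded component of that point. -/
theorem zero_mem_inside {t : Parameters} (ht : t.Admissible) {c : ℝ → ℂ} (hc : IsContour t c) :
    (0 : ℂ) ∈ inside c := by
  obtain ⟨K, hK⟩ := hc.jordan.lipschitz
  refine ⟨hc.zero_notMem, ?_⟩
  have hopen := (isCompact_trace hK).isClosed.isOpen_compl.connectedComponentIn (x := (0 : ℂ))
  have hlim : Tendsto (fun k : ℕ => t.abcd 0 * t.q ^ k) atTop (𝓝 0) := by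
    simpa using (tendsto_pow_atTop_nhds_zero_of_norm_lt_one ht.q_lt_one).const_mul (t.abcd 0)
  obtain ⟨k, hk⟩ := (hlim.eventually (hopen.mem_nhds
    (mem_connectedComponentIn hc.zero_notMem))).exists
  rw [connectedComponentIn_eq hk]
  exact (hc.mem_inside 0 k).2

variable {t : Parameters} {c : ℝ → ℂ}

theorem IsContour.regular (hc : IsContour t c) (j : ℕ) :
    ∀ p ∈ poles t j, p ∉ trace c := by
  rintro p ⟨i, k, rfl | rfl⟩
  · exact (hc.mem_inside i (k + j)).1
  · exact (hc.mem_outside i k).1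

theorem IsContour.trace_subset (hc : IsContour t c) (j : ℕ) :
    trace c ⊆ regularSet (poles t j) := fun _ hx =>
  ⟨fun h => hc.zero_notMem (h ▸ hx), fun h => hc.regular j _ h hx⟩

theorem IsContour.mapsTo_div (ht : t.Admissible) (hc : IsContour t c) (j : ℕ) :
    MapsTo (fun x => t.q ^ j / x) (trace c) (regularSet (poles t j)) := fun x hx => by
  have hq : t.q ^ j ≠ 0 := pow_ne_zero _ ht.q_ne
  refine ⟨div_ne_zero hq (hc.trace_subset j hx).1, fun h => ?_⟩
  have := div_mem_poles ht j h
  rw [div_div_cancel₀ hq] at this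
  exact hc.regular j _ this hx

theorem tendstoUniformlyOn_halfProd (ht : t.Admissible) (n j : ℕ) {K : Set ℂ} (hK : IsCompact K)
    (hKS : K ⊆ regularSet (poles t j)) :
    TendstoUniformlyOn (fun M x => ∏ m ∈ Finset.range M, halfFactor t (m + n) x) (halfProd t n)
      atTop K := by
  have h := (hasProdUniformlyOn_iff_tendstoUniformlyOn.1 (hasProdUniformlyOn_halfFactor
    ht.r_lt_one n hK fun m => (partialFraction_halfFactor ht j (m + n)).continuousOn.mono hKS))
  exact fun u hu => tendsto_finset_range.eventually (h u hu)

theorem continuousOn_halfProd (ht : t.Admissible) (n j : ℕ) {K : Set ℂ} (hK : IsCompact K)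
    (hKS : K ⊆ regularSet (poles t j)) : ContinuousOn (halfProd t n) K :=
  (tendstoUniformlyOn_halfProd ht n j hK hKS).continuousOn <| Frequently.of_forall fun _ =>
    continuousOn_finsetProd _ fun m _ =>
      (partialFraction_halfFactor ht j (m + n)).continuousOn.mono hKS

theorem IsContour.continuousOn_halfProd_div (ht : t.Admissible) (hc : IsContour t c) (n j : ℕ) :
    ContinuousOn (fun x => halfProd t n (t.q ^ j / x)) (trace c) := by
  obtain ⟨K, hK⟩ := hc.jordan.lipschitz
  have hdiv : ContinuousOn (fun x => t.q ^ j / x) (trace c) :=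
    continuousOn_const.div continuousOn_id fun x hx => (hc.trace_subset j hx).1
  exact (continuousOn_halfProd ht n j ((isCompact_trace hK).image_of_continuousOn hdiv)
    (mapsTo_iff_image_subset.1 (hc.mapsTo_div ht j))).comp hdiv (mapsTo_image _ _)

theorem IsContour.tendstoUniformlyOn_symmetricProd (ht : t.Admissible) (hc : IsContour t c)
    (n j : ℕ) :
    TendstoUniformlyOn (fun M x => (∏ m ∈ Finset.range M, halfFactor t (m + n) x) *
        ∏ m ∈ Finset.range M, halfFactor t (m + n) (t.q ^ j / x))
      (fun x => halfProd t n x * halfProd t n (t.q ^ j / x)) atTop (trace c) := by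
  obtain ⟨K, hK⟩ := hc.jordan.lipschitz
  have hcpt := isCompact_trace hK
  have hsub := hc.trace_subset j
  have hdiv : ContinuousOn (fun x => t.q ^ j / x) (trace c) :=
    continuousOn_const.div continuousOn_id fun x hx => (hsub hx).1
  have h1 := tendstoUniformlyOn_halfProd ht n j hcpt hsub
  have h2 := ((tendstoUniformlyOn_halfProd ht n j (hcpt.image_of_continuousOn hdiv)
    (mapsTo_iff_image_subset.1 (hc.mapsTo_div ht j))).comp fun x => t.q ^ j / x).mono
    (subset_preimage_image _ _)
  obtain ⟨A, hA⟩ := hcpt.exists_bound_of_continuousOn (continuousOn_halfProd ht n j hcpt hsub)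
  obtain ⟨B, hB⟩ := hcpt.exists_bound_of_continuousOn (hc.continuousOn_halfProd_div ht n j)
  exact tendstoUniformlyOn_mul_of_bounded h1 h2 hA hB

theorem TendstoUniformlyOn.mul_left_of_continuousOn {K : Set ℂ} (hK : IsCompact K)
    {f : ℕ → ℂ → ℂ} {F g : ℂ → ℂ} (hf : TendstoUniformlyOn f F atTop K)
    (hfc : ∀ n, ContinuousOn (f n) K) (hg : ContinuousOn g K) :
    TendstoUniformlyOn (fun n x => g x * f n x) (fun x => g x * F x) atTop K := by
  obtain ⟨A, hA⟩ := hK.exists_bound_of_continuousOn hg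
  obtain ⟨B, hB⟩ := hK.exists_bound_of_continuousOn (hf.continuousOn (Frequently.of_forall hfc))
  refine tendstoUniformlyOn_mul_of_bounded (f := fun _ => g) ?_ hf hA hB
  exact fun u hu => Eventually.of_forall fun n x _ => refl_mem_uniformity hu

theorem partialFraction_symmetricProd (ht : t.Admissible) (n j M : ℕ) :
    PartialFraction (poles t j) fun x => (∏ m ∈ Finset.range M, halfFactor t (m + n) x) *
      ∏ m ∈ Finset.range M, halfFactor t (m + n) (t.q ^ j / x) :=
  (PartialFraction.prod (zero_notMem_poles ht j) _ fun m _ =>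
    partialFraction_halfFactor ht j (m + n)).mul (zero_notMem_poles ht j)
    (PartialFraction.prod (zero_notMem_poles ht j) _ fun m _ =>
      partialFraction_halfFactor_div ht j (m + n))

/-- The map p ↦ q^j/p exchanges e q^{k+j}, which lies inside, with e⁻¹ q⁻ᵏ, which lies outside. The
two integrals are 2πi and 0, and 0 lies inside as well. -/
theorem IsContour.winding_add (ht : t.Admissible) (hc : IsContour t c) {j : ℕ} {p : ℂ}
    (hp : p ∈ poles t j) : contourIntegral c (fun x => (x - p)⁻¹) +
      contourIntegral c (fun x => (x - t.q ^ j / p)⁻¹) = contourIntegral c (fun x => (x - 0)⁻¹) := by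
  obtain ⟨K, hK⟩ := hc.jordan.lipschitz
  have hq := pow_ne_zero j ht.q_ne
  have key : ∀ i k, contourIntegral c (fun x => (x - t.abcd i * t.q ^ (k + j))⁻¹) +
      contourIntegral c (fun x => (x - (t.abcd i * t.q ^ k)⁻¹)⁻¹) =
      contourIntegral c (fun x => (x - 0)⁻¹) := fun i k => by
    rw [hc.counterclockwise _ (hc.mem_inside i (k + j)),
      contourIntegral_inv_sub_of_outside hK hc.jordan.closed (hc.mem_outside i k),
      hc.counterclockwise _ (zero_mem_inside ht hc), add_zero]
  obtain ⟨i, k, rfl | rfl⟩ := hp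
  · have e : t.q ^ j / (t.abcd i * t.q ^ (k + j)) = (t.abcd i * t.q ^ k)⁻¹ := by
      have := ht.abcd_ne i
      have := ht.q_ne
      rw [pow_add]
      field_simp
    rw [e, key]
  · have e : t.q ^ j / (t.abcd i * t.q ^ k)⁻¹ = t.abcd i * t.q ^ (k + j) := by
      rw [div_inv_eq_mul, pow_add]; ring
    rw [e, add_comm, key]

/-- Invariance under `x ↦ q^j / x` of the integral over `x` against the symmetric parts of the
weight function. -/
theorem IsContour.contourIntegral_symmetricProd (ht : t.Admissible) (hc : IsContour t c) (n j : ℕ)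
    {l : ℂ → ℂ} (hl : PartialFraction (poles t j) l) :
    contourIntegral c (fun x => l x * (halfProd t n x * halfProd t n (t.q ^ j / x)) / x) =
      contourIntegral c (fun x => l (t.q ^ j / x) *
        (halfProd t n x * halfProd t n (t.q ^ j / x)) / x) := by
  obtain ⟨K, hK⟩ := hc.jordan.lipschitz
  have hsub := hc.trace_subset j
  have hq := pow_ne_zero j ht.q_ne
  have hmaps := hc.mapsTo_div ht j
  have hx0 : ∀ x ∈ trace c, x ≠ 0 := fun x hx => (hsub hx).1
  have hdiv : ContinuousOn (fun x => t.q ^ j / x) (trace c) :=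
    continuousOn_const.div continuousOn_id hx0
  set f : ℕ → ℂ → ℂ := fun M x => (∏ m ∈ Finset.range M, halfFactor t (m + n) x) *
    ∏ m ∈ Finset.range M, halfFactor t (m + n) (t.q ^ j / x) with hf
  have hfc : ∀ M, ContinuousOn (f M) (trace c) := fun M =>
    (partialFraction_symmetricProd ht n j M).continuousOn.mono hsub
  have hlim := hc.tendstoUniformlyOn_symmetricProd ht n j
  have hg1 : ContinuousOn (fun x => l x / x) (trace c) :=
    (hl.continuousOn.mono hsub).div continuousOn_id hx0
  have hg2 : ContinuousOn (fun x => l (t.q ^ j / x) / x) (trace c) :=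
    (hl.continuousOn.comp hdiv hmaps).div continuousOn_id hx0
  have L1 : Tendsto (fun M => contourIntegral c fun x => l x / x * f M x) atTop _ :=
    tendsto_contourIntegral hK (fun M => hg1.mul (hfc M))
    (TendstoUniformlyOn.mul_left_of_continuousOn (isCompact_trace hK) hlim hfc hg1)
  have L2 : Tendsto (fun M => contourIntegral c fun x => l (t.q ^ j / x) / x * f M x) atTop _ :=
    tendsto_contourIntegral hK (fun M => hg2.mul (hfc M))
    (TendstoUniformlyOn.mul_left_of_continuousOn (isCompact_trace hK) hlim hfc hg2)
  -- Truncations are rational with poles in `poles t j`, so the invariance for partial fractions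
  -- applies. The reflection only swaps the two products in the truncation, hence it acts on `l`
  -- alone.
  have e : ∀ M, contourIntegral c (fun x => l x / x * f M x) =
      contourIntegral c (fun x => l (t.q ^ j / x) / x * f M x) := by
    intro M
    have := (hl.mul (zero_notMem_poles ht j)
      (partialFraction_symmetricProd ht n j M)).contourIntegral_div_eq hK hc.jordan.closed
      hc.zero_notMem (zero_notMem_poles ht j) (hc.regular j) hq (fun p => div_mem_poles ht j)
      (fun p => hc.winding_add ht)
    refine Eq.trans (contourIntegral_congr fun x hx => ?_) (this.trans
      (contourIntegral_congr fun x hx => ?_))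
    · simp only [hf]; ring
    · simp only [hf, div_div_cancel₀ hq]; ring
  have := tendsto_nhds_unique L1 (by simpa only [e] using L2)
  refine Eq.trans (contourIntegral_congr fun x hx => ?_) (this.trans
    (contourIntegral_congr fun x hx => ?_)) <;> ring

theorem halfDen_ne_zero {t : Parameters} {j m : ℕ} {x : ℂ}
    (hx : x ∈ regularSet (poles t j)) : halfDen t m x ≠ 0 := by
  obtain ⟨i, k, h1⟩ := exists_coeffA_eq t m
  obtain ⟨i', k', h2⟩ := exists_coeffB_eq t m
  have key : ∀ i k, 1 - t.abcd i * t.q ^ k * x ≠ 0 := fun i k h =>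
    hx.2 ⟨i, k, Or.inr (eq_inv_of_mul_eq_one_right (sub_eq_zero.1 h).symm)⟩
  rw [halfDen, h1, h2]
  exact mul_ne_zero (key _ _) (key _ _)

theorem IsContour.continuousOn_weight (ht : t.Admissible) (hc : IsContour t c) :
    ContinuousOn (weight t) (trace c) := by
  obtain ⟨K, hK⟩ := hc.jordan.lipschitz
  have hsub := hc.trace_subset 0
  have h := (((partialFraction_halfFactor ht 0 0).continuousOn.mono hsub).mul
    ((continuousOn_halfProd ht 1 0 (isCompact_trace hK) hsub).mul
    (hc.continuousOn_halfProd_div ht 1 0)))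
  refine h.congr fun x _ => (weight_eq_mul₁ ht.r_lt_one x).trans ?_
  change _ = halfFactor t 0 x * (halfProd t 1 x * halfProd t 1 (t.q ^ 0 / x))
  rw [pow_zero]

theorem IsContour.continuousOn_integrand (ht : t.Admissible) (hc : IsContour t c)
    (f g : ℂ[T;T⁻¹]) : ContinuousOn (integrand t f g) (trace c) := by
  have e : integrand t f g = fun x =>
      evalAt f x * evalAt (LaurentPolynomial.invert g) x * weight t x / x := by
    funext x
    rw [integrand, evalAt_inv]
  rw [e]
  exact (((continuousOn_evalAt f hc.zero_notMem).mul (continuousOn_evalAt _ hc.zero_notMem)).mul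
    (hc.continuousOn_weight ht)).div continuousOn_id fun x hx => (hc.trace_subset 0 hx).1

theorem IsContour.contourIntegrable_integrand (ht : t.Admissible) (hc : IsContour t c)
    (f g : ℂ[T;T⁻¹]) : ContourIntegrable c (integrand t f g) := by
  obtain ⟨K, hK⟩ := hc.jordan.lipschitz
  exact contourIntegrable_of_continuousOn hK (hc.continuousOn_integrand ht f g)

/-- The bilinear form. -/
def IsContour.bilin (ht : t.Admissible) (hc : IsContour t c) : ℂ[T;T⁻¹] →ₗ[ℂ] ℂ[T;T⁻¹] →ₗ[ℂ] ℂ :=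
  LinearMap.mk₂ ℂ (form t c)
    (fun f f' g => by
      rw [form, form, form, ← mul_add, ← contourIntegral_add
        (hc.contourIntegrable_integrand ht _ _) (hc.contourIntegrable_integrand ht _ _)]
      congr 2
      funext x
      simp only [integrand, evalAt_add]
      ring)
    (fun z f g => by
      rw [form, form, smul_eq_mul, mul_left_comm, ← contourIntegral_const_mul z]
      congr 2
      funext x
      simp only [integrand, evalAt_smul]
      ring)
    (fun f g g' => by
      rw [form, form, form, ← mul_add, ← contourIntegral_add
        (hc.contourIntegrable_integrand ht _ _) (hc.contourIntegrable_integrand ht _ _)]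
      congr 2
      funext x
      simp only [integrand, evalAt_add]
      ring)
    (fun z f g => by
      rw [form, form, smul_eq_mul, mul_left_comm, ← contourIntegral_const_mul z]
      congr 2
      funext x
      simp only [integrand, evalAt_smul]
      ring)

theorem IsContour.bilin_apply (ht : t.Admissible) (hc : IsContour t c) (f g : ℂ[T;T⁻¹]) :
    hc.bilin ht f g = form t c f g := rfl

/-! ### The difference-reflection operators in terms of values -/

theorem eq_zero_of_infinite_zeros {f : ℂ[T;T⁻¹]} {S : Set ℂ} (hS : S.Infinite)
    (h : ∀ x ∈ S, x ≠ 0 ∧ evalAt f x = 0) : f = 0 := by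
  obtain ⟨n, p, hp⟩ := LaurentPolynomial.exists_T_pow f
  have hp0 : p = 0 := by
    refine Polynomial.eq_zero_of_infinite_isRoot p (hS.mono fun x hx => ?_)
    obtain ⟨hx0, hx⟩ := h x hx
    have h1 := evalAt_mul hx0 f (LaurentPolynomial.T n)
    rw [hx, zero_mul, ← hp, ← evalHom_apply hx0, evalHom, LaurentPolynomial.eval₂_toLaurent] at h1
    simpa [Polynomial.eval₂_eq_eval_map] using h1
  rw [hp0, map_zero] at hp
  exact (LaurentPolynomial.isUnit_T (R := ℂ) n).mul_left_eq_zero.1 hp.symm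

theorem eq_of_evalAt_eq {f g : ℂ[T;T⁻¹]} (s : Finset ℂ)
    (h : ∀ x : ℂ, x ≠ 0 → x ∉ s → evalAt f x = evalAt g x) : f = g := by
  refine sub_eq_zero.1 (eq_zero_of_infinite_zeros
    (Set.Finite.infinite_compl (insert 0 s).finite_toSet) fun x hx => ?_)
  simp only [Finset.coe_insert, mem_compl_iff, mem_insert_iff, not_or] at hx
  exact ⟨hx.1, by rw [evalAt_sub hx.1, h x hx.1 (by simpa using hx.2), sub_self]⟩

theorem monomialAt_eq (t : Parameters) (x : ℂ) (m n : ℤ) :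
    monomialAt t x (m, n) = t.r ^ n * x ^ m := rfl

theorem evalAt_reflection₁ (t : Parameters) (f : ℂ[T;T⁻¹]) (x : ℂ) :
    evalAt (reflection t simpleRoot₁ f) x = evalAt f x⁻¹ := by
  induction f using LaurentPolynomial.induction_on' with
  | add f g hf hg => rw [map_add, evalAt_add, evalAt_add, hf, hg]
  | C_mul_T n w =>
    have e : reflect simpleRoot₁ (n, 0) = (-n, 0) := by
      simp only [reflect, pairing, simpleRoot₁, Prod.smul_mk, smul_eq_mul, Prod.mk_sub_mk,
        Prod.mk.injEq]
      omega
    rw [← LaurentPolynomial.smul_eq_C_mul, map_smul, evalAt_smul, evalAt_smul, evalAt_T,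
      reflection, onMonomials_T, e, evalAt_monomial, monomialAt_eq, inv_zpow']
    simp

theorem evalAt_reflection₀ (t : Parameters) (f : ℂ[T;T⁻¹]) (x : ℂ) :
    evalAt (reflection t simpleRoot₀ f) x = evalAt f (t.q / x) := by
  induction f using LaurentPolynomial.induction_on' with
  | add f g hf hg => rw [map_add, evalAt_add, evalAt_add, hf, hg]
  | C_mul_T n w =>
    have e : reflect simpleRoot₀ (n, 0) = (-n, 2 * n) := by
      simp only [reflect, pairing, simpleRoot₀, Prod.smul_mk, smul_eq_mul, Prod.mk_sub_mk,
        Prod.mk.injEq]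
      omega
    rw [← LaurentPolynomial.smul_eq_C_mul, map_smul, evalAt_smul, evalAt_smul, evalAt_T,
      reflection, onMonomials_T, e, evalAt_monomial, monomialAt_eq, div_zpow, Parameters.q,
      ← zpow_natCast, ← zpow_mul, zpow_neg]
    rfl

theorem evalAt_dividedDifference₁ {t : Parameters} (hr : t.r ≠ 0) (f : ℂ[T;T⁻¹]) {x : ℂ}
    (hx : x ≠ 0) : (1 - x ^ 2) * evalAt (dividedDifference t simpleRoot₁ f) x =
      evalAt f x - evalAt f x⁻¹ := by
  have h := congrArg (fun g => evalAt g x) (one_sub_monomial_mul_dividedDifference hr simpleRoot₁ f)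
  simp only [evalAt_mul hx, evalAt_sub hx, evalAt_one hx, evalAt_monomial,
    evalAt_reflection₁] at h
  rw [← h]
  simp [simpleRoot₁, monomialAt]

theorem evalAt_dividedDifference₀ {t : Parameters} (hr : t.r ≠ 0) (f : ℂ[T;T⁻¹]) {x : ℂ}
    (hx : x ≠ 0) : (1 - (t.r * x⁻¹) ^ 2) * evalAt (dividedDifference t simpleRoot₀ f) x =
      evalAt f x - evalAt f (t.q / x) := by
  have h := congrArg (fun g => evalAt g x) (one_sub_monomial_mul_dividedDifference hr simpleRoot₀ f)
  simp only [evalAt_mul hx, evalAt_sub hx, evalAt_one hx, evalAt_monomial,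
    evalAt_reflection₀] at h
  rw [← h]
  simp only [simpleRoot₀, monomialAt, zpow_neg, mul_pow, inv_pow]
  norm_cast

theorem evalAt_opT₁ (t : Parameters) (f : ℂ[T;T⁻¹]) {x : ℂ} (hx : x ≠ 0) :
    evalAt (opT₁ t f) x = t.k₁ * evalAt f x - t.k₁⁻¹ *
      ((1 - t.k₁ * t.u₁ * x) * (1 + t.k₁ * t.u₁⁻¹ * x)) *
        evalAt (dividedDifference t simpleRoot₁ f) x := by
  have e1 : t.mult simpleRoot₁ = t.k₁ := by simp [Parameters.mult, simpleRoot₁]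
  have e2 : t.mult (half simpleRoot₁) = t.u₁ := by simp [Parameters.mult, simpleRoot₁, half]
  have e3 : monomialAt t x (half simpleRoot₁) = x := by simp [monomialAt, simpleRoot₁, half]
  simp only [opT₁, diffReflection, e1, e2, LinearMap.sub_apply, LinearMap.smul_apply,
    LinearMap.id_apply, LinearMap.comp_apply, LinearMap.mulLeft_apply, evalAt_sub hx, evalAt_smul,
    evalAt_mul hx, evalAt_add, evalAt_one hx, evalAt_monomial, e3]
  ring

theorem evalAt_opT₀ (t : Parameters) (f : ℂ[T;T⁻¹]) {x : ℂ} (hx : x ≠ 0) :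
    evalAt (opT₀ t f) x = t.k₀ * evalAt f x - t.k₀⁻¹ *
      ((1 - t.k₀ * t.u₀ * (t.r * x⁻¹)) * (1 + t.k₀ * t.u₀⁻¹ * (t.r * x⁻¹))) *
        evalAt (dividedDifference t simpleRoot₀ f) x := by
  have e1 : t.mult simpleRoot₀ = t.k₀ := by simp [Parameters.mult, simpleRoot₀]
  have e2 : t.mult (half simpleRoot₀) = t.u₀ := by simp [Parameters.mult, simpleRoot₀, half]
  have e3 : monomialAt t x (half simpleRoot₀) = t.r * x⁻¹ := by
    simp [monomialAt, simpleRoot₀, half]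
  simp only [opT₀, diffReflection, e1, e2, LinearMap.sub_apply, LinearMap.smul_apply,
    LinearMap.id_apply, LinearMap.comp_apply, LinearMap.mulLeft_apply, evalAt_sub hx, evalAt_smul,
    evalAt_mul hx, evalAt_add, evalAt_one hx, evalAt_monomial, e3]
  ring

/-- The divided difference D satisfies D' = y² D at the reflected point, and the even and odd parts
of the numerator combine to D(Tf) = -k⁻¹ Df. Substituting k⁻¹ φ Df = k f - T f into T(Tf) = k Tf -
k⁻¹ φ D(Tf), with φ the numerator, gives the relation. -/
theorem quadratic_relation_aux {k u y F F' D D' G G' E E' : ℂ} (hk : k ≠ 0) (hu : u ≠ 0)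
    (hy : y ≠ 0) (hy2 : 1 - y ^ 2 ≠ 0) (h1 : (1 - y ^ 2) * D = F - F')
    (h2 : (1 - y⁻¹ ^ 2) * D' = F' - F)
    (h3 : G = k * F - k⁻¹ * ((1 - k * u * y) * (1 + k * u⁻¹ * y)) * D)
    (h4 : G' = k * F' - k⁻¹ * ((1 - k * u * y⁻¹) * (1 + k * u⁻¹ * y⁻¹)) * D')
    (h5 : (1 - y ^ 2) * E = G - G')
    (h6 : E' = k * G - k⁻¹ * ((1 - k * u * y) * (1 + k * u⁻¹ * y)) * E) :
    E' = (k - k⁻¹) * G + F := by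
  have e0 : D' = y ^ 2 * D := by
    have : (1 - y ^ 2) * (D' - y ^ 2 * D) = 0 := by
      have h2' : (y ^ 2 - 1) * D' = y ^ 2 * (F' - F) := by
        rw [← h2]; field_simp
      linear_combination -h2' - y ^ 2 * h1
    exact sub_eq_zero.1 ((mul_eq_zero.1 this).resolve_left hy2)
  have e1 : E = (k - k⁻¹ * (1 + k ^ 2)) * D := by
    refine mul_left_cancel₀ hy2 ?_
    have hF : F' = F - (1 - y ^ 2) * D := by rw [h1]; ring
    rw [h5, h3, h4, e0, hF]
    field_simp
    ring
  rw [h6, e1, h3]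
  field_simp
  ring

/-- The quadratic relation `(T₁ - k₁) (T₁ + k₁⁻¹) = 0`. -/
theorem opT₁_opT₁ {t : Parameters} (hk : t.k₁ ≠ 0) (hu : t.u₁ ≠ 0) (hr : t.r ≠ 0)
    (f : ℂ[T;T⁻¹]) : opT₁ t (opT₁ t f) = (t.k₁ - t.k₁⁻¹) • opT₁ t f + f := by
  -- At the fixed points of the reflection 1 - x² vanishes and cannot be cancelled; an identity of
  -- Laurent polynomials may ignore finitely many points.
  refine eq_of_evalAt_eq {1, -1} fun x hx hxs => ?_
  simp only [Finset.mem_insert, Finset.mem_singleton, not_or] at hxs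
  have hx' : x⁻¹ ≠ 0 := inv_ne_zero hx
  have hx2 : 1 - x ^ 2 ≠ 0 := fun h => by
    have : (x - 1) * (x + 1) = 0 := by linear_combination -h
    rcases mul_eq_zero.1 this with h | h
    · exact hxs.1 (sub_eq_zero.1 h)
    · exact hxs.2 (eq_neg_of_add_eq_zero_left h)
  have h2 := evalAt_dividedDifference₁ hr f hx'
  rw [inv_inv] at h2
  rw [evalAt_add, evalAt_smul]
  exact quadratic_relation_aux hk hu hx hx2 (evalAt_dividedDifference₁ hr f hx) h2
    (evalAt_opT₁ t f hx) (evalAt_opT₁ t f hx') (evalAt_dividedDifference₁ hr _ hx)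
    (evalAt_opT₁ t _ hx)

/-- The quadratic relation `(T₀ - k₀) (T₀ + k₀⁻¹) = 0`. -/
theorem opT₀_opT₀ {t : Parameters} (hk : t.k₀ ≠ 0) (hu : t.u₀ ≠ 0) (hr : t.r ≠ 0)
    (f : ℂ[T;T⁻¹]) : opT₀ t (opT₀ t f) = (t.k₀ - t.k₀⁻¹) • opT₀ t f + f := by
  refine eq_of_evalAt_eq {t.r, -t.r} fun x hx hxs => ?_
  simp only [Finset.mem_insert, Finset.mem_singleton, not_or] at hxs
  have hq : t.q ≠ 0 := pow_ne_zero 2 hr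
  have hx' : t.q / x ≠ 0 := div_ne_zero hq hx
  have hy : t.r * x⁻¹ ≠ 0 := mul_ne_zero hr (inv_ne_zero hx)
  have hy2 : 1 - (t.r * x⁻¹) ^ 2 ≠ 0 := fun h => by
    have : (x - t.r) * (x + t.r) = 0 := by
      field_simp at h
      linear_combination h
    rcases mul_eq_zero.1 this with h | h
    · exact hxs.1 (sub_eq_zero.1 h)
    · exact hxs.2 (eq_neg_of_add_eq_zero_left h)
  have e : t.r * (t.q / x)⁻¹ = (t.r * x⁻¹)⁻¹ := by
    rw [Parameters.q]; field_simp
  have h2 := evalAt_dividedDifference₀ hr f hx'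
  have h4 := evalAt_opT₀ t f hx'
  rw [div_div_cancel₀ hq, e] at h2
  rw [e] at h4
  rw [evalAt_add, evalAt_smul]
  exact quadratic_relation_aux hk hu hy hy2 (evalAt_dividedDifference₀ hr f hx) h2
    (evalAt_opT₀ t f hx) h4 (evalAt_dividedDifference₀ hr _ hx)
    (evalAt_opT₀ t _ hx)

/-! ### Adjoints of the difference-reflection operators -/

/-- Let φ(y) be the numerator for (k, u). The numerator for the inverse parameters at y⁻¹ is -φ(y)
k⁻² y⁻², and φ W = (1 - y²) V cancels the denominator of the weight. What is left of the adjointness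
defect is the antisymmetric expression F G' - F' G times V. For T_1 one takes y = x, for T_0 one
takes y = q^{1/2}/x. -/
theorem adjoint_aux {k u y F F' G G' D E W V : ℂ} (hk : k ≠ 0) (hu : u ≠ 0) (hy : y ≠ 0)
    (hden : (1 - k * u * y) * (1 + k * u⁻¹ * y) ≠ 0)
    (h1 : (1 - y ^ 2) * D = F - F') (h2 : (1 - y⁻¹ ^ 2) * E = G - G')
    (h3 : W = (1 - y ^ 2) / ((1 - k * u * y) * (1 + k * u⁻¹ * y)) * V) :
    (k * F - k⁻¹ * ((1 - k * u * y) * (1 + k * u⁻¹ * y)) * D) * G * W =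
      F * (k⁻¹ * G - k⁻¹⁻¹ * ((1 - k⁻¹ * u⁻¹ * y⁻¹) * (1 + k⁻¹ * u⁻¹⁻¹ * y⁻¹)) * E +
        (k - k⁻¹) * G) * W - k⁻¹ * (F * G' - F' * G) * V := by
  have e1 : (1 - k⁻¹ * u⁻¹ * y⁻¹) * (1 + k⁻¹ * u⁻¹⁻¹ * y⁻¹) =
      -((1 - k * u * y) * (1 + k * u⁻¹ * y)) * (k⁻¹ ^ 2 * y⁻¹ ^ 2) := by
    field_simp
    ring
  have e2 : ((1 - k * u * y) * (1 + k * u⁻¹ * y)) * W = (1 - y ^ 2) * V := by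
    rw [h3, ← mul_assoc, mul_div_cancel₀ _ hden]
  rw [e1, inv_inv]
  generalize (1 - k * u * y) * (1 + k * u⁻¹ * y) = φ at *
  have e3 : k * (-φ * (k⁻¹ ^ 2 * y⁻¹ ^ 2)) * E * W = k⁻¹ * ((1 - y⁻¹ ^ 2) * E) * V := by
    calc _ = -k * (k⁻¹ ^ 2 * y⁻¹ ^ 2) * E * (φ * W) := by ring
      _ = _ := by rw [e2]; field_simp; ring
  rw [h2] at e3
  linear_combination (-k⁻¹ * D * G) * e2 - k⁻¹ * G * V * h1 + F * e3

variable {t : Parameters} {c : ℝ → ℂ}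

/-- The second product is the first one, l(x) = f(x) g(q^{-j} x), evaluated at q^j/x, so the two
cancel by reflection invariance. The argument q^{-j} x arises because the reflection for q⁻¹ is
applied to `g` at x⁻¹. -/
theorem IsContour.contourIntegral_antisymm (ht : t.Admissible) (hc : IsContour t c) (n j : ℕ)
    (f g : ℂ[T;T⁻¹]) (k : ℂ) :
    contourIntegral c (fun x => k * (evalAt f x * evalAt g ((t.q ^ j)⁻¹ * x) -
      evalAt f (t.q ^ j / x) * evalAt g x⁻¹) *
        (halfProd t n x * halfProd t n (t.q ^ j / x)) / x) = 0 ∧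
    ContinuousOn (fun x => k * (evalAt f x * evalAt g ((t.q ^ j)⁻¹ * x) -
      evalAt f (t.q ^ j / x) * evalAt g x⁻¹) *
        (halfProd t n x * halfProd t n (t.q ^ j / x)) / x) (trace c) := by
  obtain ⟨K, hK⟩ := hc.jordan.lipschitz
  have hq := pow_ne_zero j ht.q_ne
  have hsub := hc.trace_subset j
  have hx0 : ∀ x ∈ trace c, x ≠ 0 := fun x hx => (hsub hx).1
  have hdiv : ContinuousOn (fun x => t.q ^ j / x) (trace c) :=
    continuousOn_const.div continuousOn_id hx0
  have hl := (PartialFraction.evalAt (poles t j) f).mul (zero_notMem_poles ht j)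
    (PartialFraction.evalAt_const_mul (poles t j) g (t.q ^ j)⁻¹)
  have hV := (continuousOn_halfProd ht n j (isCompact_trace hK) hsub).mul
    (hc.continuousOn_halfProd_div ht n j)
  have h1 : ContinuousOn (fun x => evalAt f x * evalAt g ((t.q ^ j)⁻¹ * x) *
      (halfProd t n x * halfProd t n (t.q ^ j / x)) / x) (trace c) :=
    ((hl.continuousOn.mono hsub).mul hV).div continuousOn_id hx0
  have h2 : ContinuousOn (fun x => evalAt f (t.q ^ j / x) * evalAt g ((t.q ^ j)⁻¹ * (t.q ^ j / x)) *
      (halfProd t n x * halfProd t n (t.q ^ j / x)) / x) (trace c) :=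
    ((hl.continuousOn.comp hdiv (hc.mapsTo_div ht j)).mul hV).div continuousOn_id hx0
  have e : EqOn (fun x => k * (evalAt f x * evalAt g ((t.q ^ j)⁻¹ * x) -
      evalAt f (t.q ^ j / x) * evalAt g x⁻¹) *
        (halfProd t n x * halfProd t n (t.q ^ j / x)) / x)
      (fun x => k * (evalAt f x * evalAt g ((t.q ^ j)⁻¹ * x) *
        (halfProd t n x * halfProd t n (t.q ^ j / x)) / x -
        evalAt f (t.q ^ j / x) * evalAt g ((t.q ^ j)⁻¹ * (t.q ^ j / x)) *
        (halfProd t n x * halfProd t n (t.q ^ j / x)) / x)) (trace c) := fun x hx => by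
    have e1 : (t.q ^ j)⁻¹ * (t.q ^ j / x) = x⁻¹ := by
      have := hx0 x hx
      field_simp
    simp only [e1]
    ring
  refine ⟨?_, ((h1.sub h2).const_mul k).congr e⟩
  rw [contourIntegral_congr e, contourIntegral_const_mul, contourIntegral_sub
    (contourIntegrable_of_continuousOn hK h1) (contourIntegrable_of_continuousOn hK h2),
    hc.contourIntegral_symmetricProd ht n j hl, sub_self, mul_zero]

theorem IsContour.bilin_eq_of_integrand_eq (ht : t.Admissible) (hc : IsContour t c) (n j : ℕ)
    (f g : ℂ[T;T⁻¹]) (k : ℂ) {f₁ g₁ f₂ g₂ : ℂ[T;T⁻¹]}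
    (h : ∀ x ∈ trace c, evalAt f₁ x * evalAt g₁ x⁻¹ * weight t x =
      evalAt f₂ x * evalAt g₂ x⁻¹ * weight t x - k * (evalAt f x * evalAt g ((t.q ^ j)⁻¹ * x) -
      evalAt f (t.q ^ j / x) * evalAt g x⁻¹) *
        (halfProd t n x * halfProd t n (t.q ^ j / x))) :
    hc.bilin ht f₁ g₁ = hc.bilin ht f₂ g₂ := by
  obtain ⟨K, hK⟩ := hc.jordan.lipschitz
  obtain ⟨h1, h2⟩ := hc.contourIntegral_antisymm ht n j f g k
  rw [hc.bilin_apply, hc.bilin_apply, form, form]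
  congr 1
  rw [← sub_zero (contourIntegral c (integrand t f₂ g₂)), ← h1, ← contourIntegral_sub
    (hc.contourIntegrable_integrand ht _ _) (contourIntegrable_of_continuousOn hK h2)]
  refine contourIntegral_congr fun x hx => ?_
  simp only [integrand]
  rw [h x hx, sub_div]

/-- By the quadratic relation for inverse parameters, the operator on the right is (T_1')⁻¹. The
weight is split as in `weight_eq_mul₁`, with invariant part under x ↦ 1/x. -/
theorem IsContour.bilin_opT₁ (ht : t.Admissible) (hc : IsContour t c) (f g : ℂ[T;T⁻¹]) :
    hc.bilin ht (opT₁ t f) g = hc.bilin ht f (opT₁ t.inv g + (t.k₁ - t.k₁⁻¹) • g) := by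
  refine hc.bilin_eq_of_integrand_eq ht 1 0 f g t.k₁⁻¹ fun x hx => ?_
  have hreg := hc.trace_subset 0 hx
  have hx0 := hreg.1
  have hx' : x⁻¹ ≠ 0 := inv_ne_zero hx0
  have hd : halfDen t 0 x = (1 - t.k₁ * t.u₁ * x) * (1 + t.k₁ * t.u₁⁻¹ * x) := by
    simp [halfDen, coeffA, coeffB]
  have hr' : t.inv.r ≠ 0 := inv_ne_zero ht.r_ne
  have h2 := evalAt_dividedDifference₁ hr' g hx'
  rw [inv_inv] at h2
  have h3 := weight_eq_mul₁ ht.r_lt_one x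
  rw [halfFactor, hd, pow_zero, one_mul] at h3
  rw [evalAt_opT₁ t f hx0, evalAt_add, evalAt_smul, evalAt_opT₁ t.inv g hx']
  simp only [pow_zero, inv_one, one_mul]
  rw [one_div] at h3 ⊢
  exact adjoint_aux ht.k₁_ne ht.u₁_ne hx0 (hd ▸ halfDen_ne_zero hreg)
    (evalAt_dividedDifference₁ ht.r_ne f hx0) h2 h3

/-- As for T_1, with y = q^{1/2}/x and the splitting `weight_eq_mul₀`, whose invariant part is
symmetric under x ↦ q/x. -/
theorem IsContour.bilin_opT₀ (ht : t.Admissible) (hc : IsContour t c) (f g : ℂ[T;T⁻¹]) :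
    hc.bilin ht (opT₀ t f) g = hc.bilin ht f (opT₀ t.inv g + (t.k₀ - t.k₀⁻¹) • g) := by
  refine hc.bilin_eq_of_integrand_eq ht 0 1 f g t.k₀⁻¹ fun x hx => ?_
  have hreg := hc.trace_subset 1 hx
  have hx0 := hreg.1
  have hx' : x⁻¹ ≠ 0 := inv_ne_zero hx0
  have hr := ht.r_ne
  have hd : halfDen t 1 x⁻¹ = (1 - t.k₀ * t.u₀ * (t.r * x⁻¹)) *
      (1 + t.k₀ * t.u₀⁻¹ * (t.r * x⁻¹)) := by
    simp [halfDen, coeffA, coeffB]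
    ring
  have hd0 : halfDen t 1 x⁻¹ ≠ 0 := by
    have := hc.mapsTo_div ht 0 hx
    simp only [pow_zero, one_div] at this
    exact halfDen_ne_zero this
  have hr' : t.inv.r ≠ 0 := inv_ne_zero ht.r_ne
  have h2 := evalAt_dividedDifference₀ hr' g hx'
  have e1 : t.inv.r * x⁻¹⁻¹ = (t.r * x⁻¹)⁻¹ := by
    simp only [Parameters.inv]
    field_simp
  have e2 : t.inv.q / x⁻¹ = (t.q ^ 1)⁻¹ * x := by
    simp only [Parameters.inv, Parameters.q]
    field_simp
  have h3 := weight_eq_mul₀ ht.r_lt_one x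
  rw [halfFactor, hd, pow_one] at h3
  rw [e1, e2] at h2
  rw [evalAt_opT₀ t f hx0, evalAt_add, evalAt_smul, evalAt_opT₀ t.inv g hx', e1]
  have h1 := evalAt_dividedDifference₀ ht.r_ne f hx0
  rw [pow_one] at h2 ⊢
  exact adjoint_aux ht.k₀_ne ht.u₀_ne (mul_ne_zero hr hx') (hd ▸ hd0) h1 h2 h3

/-! ### Triangularity of the Cherednik-Dunkl operator -/

/-- The Laurent polynomials with coefficients supported in `s`. -/
def supportedIn (s : Set ℤ) : Submodule ℂ ℂ[T;T⁻¹] where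
  carrier := {f | ∀ n, n ∉ s → f.coeff n = 0}
  zero_mem' := fun n _ => by simp
  add_mem' := fun {f g} hf hg n hn => by simp [hf n hn, hg n hn]
  smul_mem' := fun z f hf n hn => by simp [hf n hn]

theorem T_mem_supportedIn {s : Set ℤ} {n : ℤ} (hn : n ∈ s) :
    (LaurentPolynomial.T n : ℂ[T;T⁻¹]) ∈ supportedIn s := fun m hm => by
  rw [LaurentPolynomial.T_apply, if_neg]
  rintro rfl
  exact hm hn

theorem supportedIn_mono {s s' : Set ℤ} (h : s ⊆ s') : supportedIn s ≤ supportedIn s' :=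
  fun _ hf n hn => hf n fun h' => hn (h h')

theorem eq_sum_T (f : ℂ[T;T⁻¹]) :
    f = ∑ n ∈ f.coeff.support, f.coeff n • LaurentPolynomial.T n := by
  refine LaurentPolynomial.ext fun m => ?_
  rw [AddMonoidAlgebra.coeff_sum, Finsupp.finsetSum_apply]
  simp only [AddMonoidAlgebra.coeff_smul, Finsupp.smul_apply, LaurentPolynomial.T_apply, smul_eq_mul, mul_ite,
    mul_one, mul_zero, Finset.sum_ite_eq', Finsupp.mem_support_iff]
  split_ifs with h
  · rfl
  · exact not_not.1 h

theorem map_mem_of_supportedIn {s : Set ℤ} {W : Submodule ℂ ℂ[T;T⁻¹]}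
    {L : ℂ[T;T⁻¹] →ₗ[ℂ] ℂ[T;T⁻¹]} (h : ∀ n ∈ s, L (LaurentPolynomial.T n) ∈ W) {f : ℂ[T;T⁻¹]}
    (hf : f ∈ supportedIn s) : L f ∈ W := by
  rw [eq_sum_T f, map_sum]
  refine W.sum_mem fun n hn => ?_
  rw [map_smul]
  refine W.smul_mem _ (h n ?_)
  by_contra hns
  exact Finsupp.mem_support_iff.1 hn (hf n hns)

/-- The Laurent polynomials all of whose exponents have absolute value less than `l`. -/
def lowDegree (l : ℕ) : Submodule ℂ ℂ[T;T⁻¹] := supportedIn {n | |n| < l}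

theorem sum_monomial_mem_lowDegree (t : Parameters) {l : ℕ} {ι : Type*} (s : Finset ι) (g : ι → Aff)
    (h : ∀ i ∈ s, |(g i).1| < l) : ∑ i ∈ s, monomial t (g i) ∈ lowDegree l := by
  refine Submodule.sum_mem _ fun i hi => ?_
  rw [monomial, ← LaurentPolynomial.smul_eq_C_mul]
  exact Submodule.smul_mem _ _ (T_mem_supportedIn (h i hi))

theorem monomial_mul_sum (t : Parameters) (hr : t.r ≠ 0) (f : Aff) {ι : Type*} (s : Finset ι)
    (g : ι → Aff) : monomial t f * ∑ i ∈ s, monomial t (g i) = ∑ i ∈ s, monomial t (f + g i) := by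
  simp only [Finset.mul_sum, monomial_add hr]

theorem monomial_eq (t : Parameters) (m n : ℤ) :
    monomial t (m, n) = t.r ^ n • LaurentPolynomial.T m := by
  rw [monomial, LaurentPolynomial.smul_eq_C_mul]

section DividedDifference

variable {t : Parameters}

theorem dividedDifference₁_pos (l : ℕ) : dividedDifference t simpleRoot₁ (LaurentPolynomial.T l) =
    -∑ j ∈ Finset.range l, monomial t ((l : ℤ) - 2 * (j + 1), 0) := by
  have e : pairing ((l : ℤ), 0) simpleRoot₁ = l := by simp [pairing, simpleRoot₁]
  rw [dividedDifference, onMonomials_T, e]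
  simp [simpleRoot₁, mul_comm]

theorem dividedDifference₁_neg (l : ℕ) :
    dividedDifference t simpleRoot₁ (LaurentPolynomial.T (-l)) =
      ∑ j ∈ Finset.range l, monomial t (-(l : ℤ) + 2 * j, 0) := by
  have e : pairing (-(l : ℤ), 0) simpleRoot₁ = -l := by
    simp only [pairing, simpleRoot₁]; omega
  rw [dividedDifference, onMonomials_T, e]
  simp [simpleRoot₁, mul_comm]

theorem dividedDifference₀_pos (l : ℕ) : dividedDifference t simpleRoot₀ (LaurentPolynomial.T l) =
    ∑ j ∈ Finset.range l, monomial t ((l : ℤ) - 2 * j, 2 * j) := by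
  have e : pairing ((l : ℤ), 0) simpleRoot₀ = -l := by simp [pairing, simpleRoot₀]
  rw [dividedDifference, onMonomials_T, e]
  simp [simpleRoot₀, mul_comm, sub_eq_add_neg]

theorem dividedDifference₀_neg (l : ℕ) :
    dividedDifference t simpleRoot₀ (LaurentPolynomial.T (-l)) =
      -∑ j ∈ Finset.range l, monomial t (-(l : ℤ) + 2 * (j + 1), -(2 * (j + 1))) := by
  have e : pairing (-(l : ℤ), 0) simpleRoot₀ = l := by
    simp only [pairing, simpleRoot₀]; omega
  rw [dividedDifference, onMonomials_T, e]
  simp [simpleRoot₀, mul_comm]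

/-- Dividing the numerator by k leaves k⁻¹ - (u - u⁻¹) y - k y². The form with the reflection in
front is free of y² D, so that leading terms can be read off; y D has only smaller exponents. -/
theorem opT₁_eq (hk : t.k₁ ≠ 0) (hu : t.u₁ ≠ 0) (hr : t.r ≠ 0) (f : ℂ[T;T⁻¹]) :
    opT₁ t f = t.k₁ • reflection t simpleRoot₁ f +
      ((t.k₁ - t.k₁⁻¹) • dividedDifference t simpleRoot₁ f +
        (t.u₁ - t.u₁⁻¹) • (monomial t (1, 0) * dividedDifference t simpleRoot₁ f)) := by
  refine eq_of_evalAt_eq ∅ fun x hx _ => ?_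
  have h := evalAt_dividedDifference₁ hr f hx
  simp only [evalAt_opT₁ t f hx, evalAt_add, evalAt_smul, evalAt_mul hx, evalAt_reflection₁,
    evalAt_monomial]
  have e : monomialAt t x (1, 0) = x := by simp [monomialAt]
  have hF : evalAt f x⁻¹ = evalAt f x -
      (1 - x ^ 2) * evalAt (dividedDifference t simpleRoot₁ f) x := by rw [h]; ring
  rw [e, hF]
  field_simp
  ring

theorem opT₀_eq (hk : t.k₀ ≠ 0) (hu : t.u₀ ≠ 0) (hr : t.r ≠ 0) (f : ℂ[T;T⁻¹]) :
    opT₀ t f = t.k₀ • reflection t simpleRoot₀ f +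
      ((t.k₀ - t.k₀⁻¹) • dividedDifference t simpleRoot₀ f +
        (t.u₀ - t.u₀⁻¹) • (monomial t (-1, 1) * dividedDifference t simpleRoot₀ f)) := by
  refine eq_of_evalAt_eq ∅ fun x hx _ => ?_
  have h := evalAt_dividedDifference₀ hr f hx
  simp only [evalAt_opT₀ t f hx, evalAt_add, evalAt_smul, evalAt_mul hx, evalAt_reflection₀,
    evalAt_monomial]
  have e : monomialAt t x (-1, 1) = t.r * x⁻¹ := by simp [monomialAt]
  have hF : evalAt f (t.q / x) = evalAt f x -
      (1 - (t.r * x⁻¹) ^ 2) * evalAt (dividedDifference t simpleRoot₀ f) x := by rw [h]; ring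
  rw [e, hF]
  field_simp
  ring

theorem reflection₁_T (n : ℤ) :
    reflection t simpleRoot₁ (LaurentPolynomial.T n) = LaurentPolynomial.T (-n) := by
  refine eq_of_evalAt_eq ∅ fun x hx _ => ?_
  rw [evalAt_reflection₁, evalAt_T, evalAt_T, inv_zpow']

theorem reflection₀_T (n : ℤ) :
    reflection t simpleRoot₀ (LaurentPolynomial.T n) = t.q ^ n • LaurentPolynomial.T (-n) := by
  refine eq_of_evalAt_eq ∅ fun x hx _ => ?_
  rw [evalAt_reflection₀, evalAt_T, evalAt_smul, evalAt_T, div_zpow, zpow_neg, div_eq_mul_inv]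

variable (hk₁ : t.k₁ ≠ 0) (hu₁ : t.u₁ ≠ 0) (hk₀ : t.k₀ ≠ 0) (hu₀ : t.u₀ ≠ 0) (hr : t.r ≠ 0)

include hk₁ hu₁ hr in
-- The reflection contributes k₁ x^{-l}, and the last term of the divided difference contributes
-- -(k₁ - k₁⁻¹) x^{-l}, where l = n + 1. The case l = 0 is excluded: there the divided difference
-- vanishes and the coefficient is k₁.
theorem opT₁_T_pos (n : ℕ) : opT₁ t (LaurentPolynomial.T (n + 1 : ℕ)) -
    t.k₁⁻¹ • LaurentPolynomial.T (-(n + 1 : ℕ)) ∈ lowDegree (n + 1) := by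
  have h1 := sum_monomial_mem_lowDegree t (l := n + 1) (Finset.range n)
    (fun j => (((n + 1 : ℕ) : ℤ) - 2 * (j + 1), 0)) (fun j hj => by
      rw [Finset.mem_range] at hj; simp only [abs_lt]; omega)
  have h2 := sum_monomial_mem_lowDegree t (l := n + 1) (Finset.range (n + 1))
    (fun j => (1, 0) + (((n + 1 : ℕ) : ℤ) - 2 * (j + 1), 0)) (fun j hj => by
      rw [Finset.mem_range] at hj; simp only [abs_lt, Prod.fst_add]; omega)
  have e : monomial t (((n + 1 : ℕ) : ℤ) - 2 * (n + 1), 0) = LaurentPolynomial.T (-(n + 1 : ℕ)) := by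
    rw [monomial_int]; congr 1; push_cast; ring
  rw [opT₁_eq hk₁ hu₁ hr, reflection₁_T, dividedDifference₁_pos, mul_neg, monomial_mul_sum t hr,
    Finset.sum_range_succ, e]
  convert (lowDegree (n + 1)).add_mem ((lowDegree (n + 1)).smul_mem (-(t.k₁ - t.k₁⁻¹)) h1)
    ((lowDegree (n + 1)).smul_mem (-(t.u₁ - t.u₁⁻¹)) h2) using 1
  module

include hk₁ hu₁ hr in
theorem opT₁_T_neg (n : ℕ) : opT₁ t (LaurentPolynomial.T (-(n + 1 : ℕ))) -
    ((t.k₁ - t.k₁⁻¹) • LaurentPolynomial.T (-(n + 1 : ℕ)) +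
      t.k₁ • LaurentPolynomial.T (n + 1 : ℕ)) ∈ lowDegree (n + 1) := by
  have h1 := sum_monomial_mem_lowDegree t (l := n + 1) (Finset.range n)
    (fun j => (-((n + 1 : ℕ) : ℤ) + 2 * (j + 1 : ℕ), 0)) (fun j hj => by
      rw [Finset.mem_range] at hj; simp only [abs_lt]; omega)
  have h2 := sum_monomial_mem_lowDegree t (l := n + 1) (Finset.range (n + 1))
    (fun j => (1, 0) + (-((n + 1 : ℕ) : ℤ) + 2 * j, 0)) (fun j hj => by
      rw [Finset.mem_range] at hj; simp only [abs_lt, Prod.fst_add]; omega)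
  have e : monomial t (-((n + 1 : ℕ) : ℤ) + 2 * (0 : ℕ), 0) =
      LaurentPolynomial.T (-(n + 1 : ℕ)) := by
    rw [monomial_int]; simp
  rw [opT₁_eq hk₁ hu₁ hr, reflection₁_T, dividedDifference₁_neg, monomial_mul_sum t hr,
    Finset.sum_range_succ', e, neg_neg]
  convert (lowDegree (n + 1)).add_mem ((lowDegree (n + 1)).smul_mem (t.k₁ - t.k₁⁻¹) h1)
    ((lowDegree (n + 1)).smul_mem (t.u₁ - t.u₁⁻¹) h2) using 1
  module

include hk₀ hu₀ hr in
theorem opT₀_T_pos (n : ℕ) : opT₀ t (LaurentPolynomial.T (n + 1 : ℕ)) -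
    ((t.k₀ - t.k₀⁻¹) • LaurentPolynomial.T (n + 1 : ℕ) +
      (t.k₀ * t.q ^ (n + 1)) • LaurentPolynomial.T (-(n + 1 : ℕ))) ∈ lowDegree (n + 1) := by
  have h1 := sum_monomial_mem_lowDegree t (l := n + 1) (Finset.range n)
    (fun j => (((n + 1 : ℕ) : ℤ) - 2 * (j + 1 : ℕ), 2 * (j + 1 : ℕ))) (fun j hj => by
      rw [Finset.mem_range] at hj; simp only [abs_lt]; omega)
  have h2 := sum_monomial_mem_lowDegree t (l := n + 1) (Finset.range (n + 1))
    (fun j => ((-1, 1) : Aff) + (((n + 1 : ℕ) : ℤ) - 2 * j, 2 * (j : ℤ))) (fun j hj => by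
      rw [Finset.mem_range] at hj; simp only [abs_lt, Prod.fst_add]; omega)
  have e : monomial t (((n + 1 : ℕ) : ℤ) - 2 * (0 : ℕ), 2 * (0 : ℕ)) =
      LaurentPolynomial.T (n + 1 : ℕ) := by
    rw [monomial_eq]; simp
  rw [opT₀_eq hk₀ hu₀ hr, reflection₀_T, dividedDifference₀_pos, monomial_mul_sum t hr,
    Finset.sum_range_succ', e, zpow_natCast]
  convert (lowDegree (n + 1)).add_mem ((lowDegree (n + 1)).smul_mem (t.k₀ - t.k₀⁻¹) h1)
    ((lowDegree (n + 1)).smul_mem (t.u₀ - t.u₀⁻¹) h2) using 1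
  module

include hk₀ hu₀ hr in
-- With l = n + 1, the reflection gives k₀ q^{-l} x^l and the last term of the divided difference
-- gives -(k₀ - k₀⁻¹) q^{-l} x^l.
theorem opT₀_T_neg (n : ℕ) : opT₀ t (LaurentPolynomial.T (-(n + 1 : ℕ))) -
    (t.k₀⁻¹ * (t.q ^ (n + 1))⁻¹) • LaurentPolynomial.T (n + 1 : ℕ) ∈ lowDegree (n + 1) := by
  have h1 := sum_monomial_mem_lowDegree t (l := n + 1) (Finset.range n)
    (fun j => (-((n + 1 : ℕ) : ℤ) + 2 * (j + 1), -(2 * ((j : ℤ) + 1)))) (fun j hj => by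
      rw [Finset.mem_range] at hj; simp only [abs_lt]; omega)
  have h2 := sum_monomial_mem_lowDegree t (l := n + 1) (Finset.range (n + 1))
    (fun j => (-1, 1) + (-((n + 1 : ℕ) : ℤ) + 2 * (j + 1), -(2 * ((j : ℤ) + 1)))) (fun j hj => by
      rw [Finset.mem_range] at hj; simp only [abs_lt, Prod.fst_add]; omega)
  have e : monomial t (-((n + 1 : ℕ) : ℤ) + 2 * (n + 1), -(2 * ((n : ℤ) + 1))) =
      (t.q ^ (n + 1))⁻¹ • LaurentPolynomial.T (n + 1 : ℕ) := by
    rw [monomial_eq, Parameters.q, zpow_neg, ← pow_mul]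
    have e1 : -((n + 1 : ℕ) : ℤ) + 2 * (n + 1) = (n + 1 : ℕ) := by push_cast; ring
    rw [e1, ← zpow_natCast]
    push_cast
    rfl
  rw [opT₀_eq hk₀ hu₀ hr, reflection₀_T, dividedDifference₀_neg, mul_neg, monomial_mul_sum t hr,
    Finset.sum_range_succ, e, neg_neg, zpow_neg, zpow_natCast]
  convert (lowDegree (n + 1)).add_mem ((lowDegree (n + 1)).smul_mem (-(t.k₀ - t.k₀⁻¹)) h1)
    ((lowDegree (n + 1)).smul_mem (-(t.u₀ - t.u₀⁻¹)) h2) using 1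
  module

include hk₁ hu₁ hr in
theorem opT₁_one : opT₁ t (LaurentPolynomial.T 0) = t.k₁ • LaurentPolynomial.T 0 := by
  have := dividedDifference₁_pos (t := t) 0
  simp only [Nat.cast_zero, Finset.range_zero, Finset.sum_empty, neg_zero] at this
  rw [opT₁_eq hk₁ hu₁ hr, this, reflection₁_T]
  simp

include hk₀ hu₀ hr in
theorem opT₀_one : opT₀ t (LaurentPolynomial.T 0) = t.k₀ • LaurentPolynomial.T 0 := by
  have := dividedDifference₀_pos (t := t) 0
  simp only [Nat.cast_zero, Finset.range_zero, Finset.sum_empty] at this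
  rw [opT₀_eq hk₀ hu₀ hr, this, reflection₀_T]
  simp

theorem lowDegree_mono {l l' : ℕ} (h : l ≤ l') : lowDegree l ≤ lowDegree l' :=
  supportedIn_mono fun n (hn : |n| < l) => by
    change |n| < l'
    omega

include hk₁ hu₁ hr in
theorem opT₁_mem_lowDegree {l : ℕ} {f : ℂ[T;T⁻¹]} (hf : f ∈ lowDegree l) :
    opT₁ t f ∈ lowDegree l := by
  refine map_mem_of_supportedIn (fun n hn => ?_) hf
  change |n| < (l : ℤ) at hn
  have hT : ∀ m : ℤ, |m| < l → LaurentPolynomial.T m ∈ lowDegree l := fun m hm =>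
    T_mem_supportedIn hm
  rw [abs_lt] at hn
  obtain ⟨m, rfl | rfl⟩ := n.eq_nat_or_neg <;> cases m with
  | zero =>
    simp only [Nat.cast_zero, neg_zero]
    rw [opT₁_one hk₁ hu₁ hr]
    exact Submodule.smul_mem _ _ (hT 0 (by rw [abs_lt]; omega))
  | succ m =>
    have hl : m + 1 ≤ l := by omega
    have h1 := hT (m + 1 : ℕ) (by rw [abs_lt]; omega)
    have h2 := hT (-(m + 1 : ℕ)) (by rw [abs_lt]; omega)
    first
    | have h3 := (lowDegree l).add_mem (lowDegree_mono hl (opT₁_T_pos hk₁ hu₁ hr m))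
        ((lowDegree l).smul_mem t.k₁⁻¹ h2)
      rwa [sub_add_cancel] at h3
    | have h3 := (lowDegree l).add_mem (lowDegree_mono hl (opT₁_T_neg hk₁ hu₁ hr m))
        ((lowDegree l).add_mem ((lowDegree l).smul_mem (t.k₁ - t.k₁⁻¹) h2)
          ((lowDegree l).smul_mem t.k₁ h1))
      rwa [sub_add_cancel] at h3

end DividedDifference

/-! ### The order on monomials and its initial spans -/

/-- The position of an exponent in the order `0 ≺ -1 ≺ 1 ≺ -2 ≺ 2 ≺ ⋯`. -/
def precIndex (m : ℤ) : ℕ := Equiv.intEquivNat m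

theorem precIndex_injective : Function.Injective precIndex := Equiv.intEquivNat.injective

theorem precIndex_surjective : Function.Surjective precIndex := Equiv.intEquivNat.surjective

theorem precIndex_eq (m : ℤ) : (precIndex m : ℤ) = if 0 ≤ m then 2 * m else -2 * m - 1 := by
  cases m with
  | ofNat n =>
    have : precIndex (Int.ofNat n) = 2 * n := rfl
    rw [this, if_pos (by simp)]
    simp
  | negSucc n =>
    have : precIndex (Int.negSucc n) = 2 * n + 1 := rfl
    rw [this, if_neg (by simp)]
    push_cast
    omega

theorem prec_iff {m n : ℤ} : Prec m n ↔ precIndex m < precIndex n := by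
  have h1 := precIndex_eq m
  have h2 := precIndex_eq n
  unfold Prec
  rcases abs_cases m with ⟨e1, _⟩ | ⟨e1, _⟩ <;> rcases abs_cases n with ⟨e2, _⟩ | ⟨e2, _⟩ <;>
    rw [e1, e2] <;> split_ifs at h1 h2 <;> omega

/-- The span of the first `N` monomials in the order `1 ≺ x⁻¹ ≺ x ≺ x⁻² ≺ x² ≺ ⋯`. -/
def initialSpan (N : ℕ) : Submodule ℂ ℂ[T;T⁻¹] := supportedIn {n | precIndex n < N}

theorem initialSpan_mono {N N' : ℕ} (h : N ≤ N') : initialSpan N ≤ initialSpan N' :=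
  supportedIn_mono fun _ hn => lt_of_lt_of_le hn h

theorem T_mem_initialSpan {N : ℕ} {n : ℤ} (h : precIndex n < N) :
    (LaurentPolynomial.T n : ℂ[T;T⁻¹]) ∈ initialSpan N := T_mem_supportedIn h

/-- The exponents of absolute value less than l are exactly the first 2l - 1 in the order. The bound
is sharp for N = 2l - 1, the position of -l, the case used for x^{-l}. -/
theorem lowDegree_le_initialSpan {l N : ℕ} (h : 2 * l ≤ N + 1) : lowDegree l ≤ initialSpan N := by
  refine supportedIn_mono fun n (hn : |n| < (l : ℤ)) => ?_
  change precIndex n < N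
  have := precIndex_eq n
  rw [abs_lt] at hn
  split_ifs at this <;> omega

theorem exists_mem_initialSpan (f : ℂ[T;T⁻¹]) : ∃ N, f ∈ initialSpan N := by
  refine ⟨f.coeff.support.sup precIndex + 1, fun n hn => ?_⟩
  by_contra h
  exact hn (Nat.lt_succ_of_le (Finset.le_sup (f := precIndex) (Finsupp.mem_support_iff.2 h)))

theorem mem_initialSpan_succ {N : ℕ} {n : ℤ} (hn : precIndex n = N) {f : ℂ[T;T⁻¹]}
    (hf : f ∈ initialSpan (N + 1)) :
    f - f.coeff n • LaurentPolynomial.T n ∈ initialSpan N := by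
  intro m hm
  rw [AddMonoidAlgebra.coeff_sub, AddMonoidAlgebra.coeff_smul, Finsupp.sub_apply,
    Finsupp.smul_apply, LaurentPolynomial.T_apply]
  by_cases h : n = m
  · simp [h]
  · have : m ∉ {m | precIndex m < N + 1} := fun (h' : precIndex m < N + 1) => by
      have h1 : ¬ precIndex m < N := hm
      exact h (precIndex_injective (by omega))
    rw [hf m this, if_neg h, smul_zero, sub_zero]

theorem coeff_eq_zero_of_mem_initialSpan {N : ℕ} {n : ℤ} (hn : N ≤ precIndex n) {f : ℂ[T;T⁻¹]}
    (hf : f ∈ initialSpan N) : f.coeff n = 0 := hf n (not_lt.2 hn)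

/-! ### Eigenvectors of triangular operators -/

section Triangular

variable {L : ℂ[T;T⁻¹] →ₗ[ℂ] ℂ[T;T⁻¹]} {γ : ℤ → ℂ}
  (hL : ∀ m, L (LaurentPolynomial.T m) - γ m • LaurentPolynomial.T m ∈ initialSpan (precIndex m))

include hL

theorem triangular_mem {N : ℕ} {f : ℂ[T;T⁻¹]} (hf : f ∈ initialSpan N) : L f ∈ initialSpan N := by
  refine map_mem_of_supportedIn (fun n hn => ?_) hf
  have h := (initialSpan N).add_mem (initialSpan_mono (le_of_lt hn) (hL n))
    ((initialSpan N).smul_mem (γ n) (T_mem_initialSpan hn))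
  rwa [sub_add_cancel] at h

/-- Triangular elimination from the top: dividing the leading coefficient of `w` by γ_n - z removes
the leading term and leaves a problem in the smaller span. -/
theorem triangular_exists_solution {z : ℂ} (N : ℕ) (hz : ∀ n, precIndex n < N → γ n ≠ z) :
    ∀ w ∈ initialSpan N, ∃ h ∈ initialSpan N, L h - z • h = w := by
  induction N with
  | zero =>
    intro w hw
    refine ⟨0, Submodule.zero_mem _, ?_⟩
    rw [map_zero, smul_zero, sub_zero]
    exact LaurentPolynomial.ext fun n =>
      (coeff_eq_zero_of_mem_initialSpan (Nat.zero_le _) hw).symm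
  | succ N ih =>
    intro w hw
    obtain ⟨n, hn⟩ := precIndex_surjective N
    have hγ : γ n - z ≠ 0 := sub_ne_zero.2 (hz n (by omega))
    set a := w.coeff n / (γ n - z) with ha
    have hT : (LaurentPolynomial.T n : ℂ[T;T⁻¹]) ∈ initialSpan (N + 1) :=
      T_mem_initialSpan (by omega)
    have h1 : w - (L (a • LaurentPolynomial.T n) - z • a • LaurentPolynomial.T n) ∈
        initialSpan N := by
      have h2 := mem_initialSpan_succ hn hw
      have h3 := (initialSpan N).smul_mem a (hn ▸ hL n)
      have h4 := (initialSpan N).sub_mem h2 h3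
      convert h4 using 1
      have e : w.coeff n = a * (γ n - z) := by rw [ha, div_mul_cancel₀ _ hγ]
      rw [e, map_smul]
      module
    obtain ⟨h, hh, hh'⟩ := ih (fun n hn => hz n (by omega)) _ h1
    refine ⟨h + a • LaurentPolynomial.T n, Submodule.add_mem _ (initialSpan_mono N.le_succ hh)
      (Submodule.smul_mem _ _ hT), ?_⟩
    rw [map_add, smul_add, add_sub_add_comm, hh', sub_add_cancel]

theorem triangular_eq_zero {z : ℂ} (N : ℕ) (hz : ∀ n, precIndex n < N → γ n ≠ z) :
    ∀ f ∈ initialSpan N, L f = z • f → f = 0 := by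
  induction N with
  | zero =>
    intro f hf _
    exact LaurentPolynomial.ext fun n => coeff_eq_zero_of_mem_initialSpan (Nat.zero_le _) hf
  | succ N ih =>
    intro f hf hfz
    obtain ⟨n, hn⟩ := precIndex_surjective N
    have h1 := mem_initialSpan_succ hn hf
    have h2 := triangular_mem hL h1
    have h3 := (initialSpan N).smul_mem (f.coeff n) (hn ▸ hL n)
    have h4 := (initialSpan N).sub_mem ((initialSpan N).add_mem h2 h3)
      ((initialSpan N).smul_mem z h1)
    have e : L (f - f.coeff n • LaurentPolynomial.T n) +
        f.coeff n • (L (LaurentPolynomial.T n) - γ n • LaurentPolynomial.T n) -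
        z • (f - f.coeff n • LaurentPolynomial.T n) =
        ((z - γ n) * f.coeff n) • LaurentPolynomial.T n := by
      rw [map_sub, map_smul, hfz]
      module
    rw [e] at h4
    have h5 := coeff_eq_zero_of_mem_initialSpan hn.ge h4
    rw [AddMonoidAlgebra.coeff_smul, Finsupp.smul_apply, LaurentPolynomial.T_apply, if_pos rfl,
      smul_eq_mul, mul_one] at h5
    have h6 := (mul_eq_zero.1 h5).resolve_left (sub_ne_zero.2 (hz n (by omega)).symm)
    rw [h6, zero_smul, sub_zero] at h1
    exact ih (fun n hn => hz n (by omega)) f h1 hfz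

theorem triangular_exists_basis (hγ : Function.Injective γ) :
    ∃ P : Module.Basis ℤ ℂ ℂ[T;T⁻¹],
      ∀ m, P m - LaurentPolynomial.T m ∈ initialSpan (precIndex m) ∧ L (P m) = γ m • P m := by
  have hex : ∀ m, ∃ p : ℂ[T;T⁻¹], p - LaurentPolynomial.T m ∈ initialSpan (precIndex m) ∧
      L p = γ m • p := by
    intro m
    -- The eigenvector is sought as x^m + h, so h has to solve (L - γ_m) h = -(L x^m - γ_m x^m)
    -- among the lower monomials, whose diagonal entries differ from γ_m.
    obtain ⟨h, hh, hh'⟩ := triangular_exists_solution hL (z := γ m) (precIndex m)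
      (fun n hn => hγ.ne fun h => by rw [h] at hn; exact lt_irrefl _ hn) _
      ((initialSpan _).neg_mem (hL m))
    refine ⟨LaurentPolynomial.T m + h, by simpa using hh, ?_⟩
    rw [map_add, smul_add, ← sub_eq_zero]
    calc _ = (L h - γ m • h) + (L (LaurentPolynomial.T m) - γ m • LaurentPolynomial.T m) := by
          module
      _ = 0 := by rw [hh', neg_add_cancel]
  choose p hp hpL using hex
  have hcoeff : ∀ m, (p m).coeff m = 1 := fun m => by
    have := coeff_eq_zero_of_mem_initialSpan le_rfl (hp m)
    rw [AddMonoidAlgebra.coeff_sub, Finsupp.sub_apply, LaurentPolynomial.T_apply, if_pos rfl] at this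
    exact sub_eq_zero.1 this
  have hli : LinearIndependent ℂ p := Module.End.eigenvectors_linearIndependent' L γ hγ p fun m =>
    Module.End.hasEigenvector_iff.2 ⟨Module.End.mem_eigenspace_iff.2 (hpL m), fun h => by
      have := hcoeff m
      rw [h] at this
      simp at this⟩
  have hspan : ∀ N, initialSpan N ≤ Submodule.span ℂ (range p) := by
    intro N
    induction N with
    | zero =>
      intro f hf
      have : f = 0 := LaurentPolynomial.ext fun n =>
        coeff_eq_zero_of_mem_initialSpan (Nat.zero_le _) hf
      rw [this]
      exact Submodule.zero_mem _
    | succ N ih =>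
      intro f hf
      obtain ⟨n, hn⟩ := precIndex_surjective N
      have h1 := (initialSpan N).sub_mem (mem_initialSpan_succ hn hf)
        ((initialSpan N).smul_mem (f.coeff n) (hn ▸ hp n))
      have h2 := Submodule.add_mem _ (ih h1)
        (Submodule.smul_mem _ (f.coeff n) (Submodule.subset_span (mem_range_self n)))
      convert h2 using 1
      module
  refine ⟨Module.Basis.mk hli fun f _ => ?_, fun m => ?_⟩
  · obtain ⟨N, hN⟩ := exists_mem_initialSpan f
    exact hspan N hN
  · rw [Module.Basis.mk_apply]
    exact ⟨hp m, hpL m⟩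

end Triangular

/-! ### Existence and uniqueness of the non-symmetric Askey-Wilson polynomials -/

section Existence

variable {t : Parameters} (hk₁ : t.k₁ ≠ 0) (hu₁ : t.u₁ ≠ 0) (hk₀ : t.k₀ ≠ 0) (hu₀ : t.u₀ ≠ 0)
  (hr : t.r ≠ 0)

include hk₁ hu₁ hk₀ hu₀ hr

/-- Modulo smaller absolute exponents T_0 sends x^{-l} to a multiple of x^l, which T_1 sends to a
multiple of x^{-l}; the coefficients multiply to γ_{-l}. From x^l there also arises a multiple of
x^{-l}, which precedes x^l in the order. -/
theorem opY_T (m : ℤ) : opY t (LaurentPolynomial.T m) - t.gamma m • LaurentPolynomial.T m ∈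
    initialSpan (precIndex m) := by
  simp only [opY, LinearMap.comp_apply]
  obtain ⟨n, rfl | rfl⟩ := m.eq_nat_or_neg
  · cases n with
    | zero =>
      simp only [Nat.cast_zero]
      rw [opT₀_one hk₀ hu₀ hr, map_smul, opT₁_one hk₁ hu₁ hr, smul_smul]
      simp [Parameters.gamma]
    | succ n =>
      have hi := precIndex_eq (n + 1 : ℕ)
      rw [if_pos (by omega)] at hi
      have hi' := precIndex_eq (-(n + 1 : ℕ))
      rw [if_neg (by omega)] at hi'
      have hle : lowDegree (n + 1) ≤ initialSpan (precIndex (n + 1 : ℕ)) :=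
        lowDegree_le_initialSpan (by omega)
      have h1 := hle (opT₁_mem_lowDegree hk₁ hu₁ hr (opT₀_T_pos hk₀ hu₀ hr n))
      have h2 := Submodule.smul_mem _ (t.k₀ - t.k₀⁻¹) (hle (opT₁_T_pos hk₁ hu₁ hr n))
      have h3 := Submodule.smul_mem _ (t.k₀ * t.q ^ (n + 1)) (hle (opT₁_T_neg hk₁ hu₁ hr n))
      have h4 := Submodule.smul_mem _ ((t.k₀ - t.k₀⁻¹) * t.k₁⁻¹ +
        t.k₀ * t.q ^ (n + 1) * (t.k₁ - t.k₁⁻¹))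
        (T_mem_initialSpan (N := precIndex (n + 1 : ℕ)) (n := -(n + 1 : ℕ)) (by omega))
      convert Submodule.add_mem _ (Submodule.add_mem _ (Submodule.add_mem _ h1 h2) h3) h4 using 1
      have e : t.gamma (n + 1 : ℕ) = t.k₀ * t.k₁ * t.q ^ (n + 1) := by
        rw [Parameters.gamma, if_pos (by omega), zpow_one, zpow_natCast]
      rw [e]
      simp only [map_sub, map_add, map_smul]
      module
  · cases n with
    | zero =>
      simp only [Nat.cast_zero, neg_zero]
      rw [opT₀_one hk₀ hu₀ hr, map_smul, opT₁_one hk₁ hu₁ hr, smul_smul]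
      simp [Parameters.gamma]
    | succ n =>
      have hi := precIndex_eq (-(n + 1 : ℕ))
      rw [if_neg (by omega)] at hi
      have hle : lowDegree (n + 1) ≤ initialSpan (precIndex (-(n + 1 : ℕ))) :=
        lowDegree_le_initialSpan (by omega)
      have h1 := hle (opT₁_mem_lowDegree hk₁ hu₁ hr (opT₀_T_neg hk₀ hu₀ hr n))
      have h2 := Submodule.smul_mem _ (t.k₀⁻¹ * (t.q ^ (n + 1))⁻¹)
        (hle (opT₁_T_pos hk₁ hu₁ hr n))
      convert Submodule.add_mem _ h1 h2 using 1
      have e : t.gamma (-(n + 1 : ℕ)) = t.k₀⁻¹ * (t.q ^ (n + 1))⁻¹ * t.k₁⁻¹ := by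
        rw [Parameters.gamma, if_neg (by omega), zpow_neg_one, zpow_neg, zpow_natCast, mul_inv]
        ring
      rw [e]
      simp only [map_sub, map_smul]
      module

theorem exists_nonsymmetricAskeyWilson (hγ : Function.Injective t.gamma) :
    ∃ P : Module.Basis ℤ ℂ ℂ[T;T⁻¹], IsNonsymmetricAskeyWilson t P ∧
      ∀ Q : ℤ → ℂ[T;T⁻¹], IsNonsymmetricAskeyWilson t Q → Q = P := by
  have hL := opY_T hk₁ hu₁ hk₀ hu₀ hr
  obtain ⟨P, hP⟩ := triangular_exists_basis hL hγ
  refine ⟨P, fun m => ⟨?_, fun n hnm hn => ?_, (hP m).2⟩, fun Q hQ => funext fun m => ?_⟩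
  · have := coeff_eq_zero_of_mem_initialSpan le_rfl (hP m).1
    rw [AddMonoidAlgebra.coeff_sub, Finsupp.sub_apply, LaurentPolynomial.T_apply, if_pos rfl] at this
    exact sub_eq_zero.1 this
  · rw [prec_iff]
    by_contra h
    have := coeff_eq_zero_of_mem_initialSpan (not_lt.1 h) (hP m).1
    rw [AddMonoidAlgebra.coeff_sub, Finsupp.sub_apply, LaurentPolynomial.T_apply,
      if_neg (Ne.symm hnm), sub_zero] at this
    exact hn this
  · obtain ⟨h1, h2, h3⟩ := hQ m
    have hQm : Q m - LaurentPolynomial.T m ∈ initialSpan (precIndex m) := by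
      intro n hn
      rw [AddMonoidAlgebra.coeff_sub, Finsupp.sub_apply, LaurentPolynomial.T_apply]
      by_cases hnm : m = n
      · rw [← hnm, h1, if_pos rfl, sub_self]
      · rw [if_neg hnm, sub_zero]
        by_contra h
        exact hn (prec_iff.1 (h2 n (Ne.symm hnm) h))
    have hd : Q m - P m ∈ initialSpan (precIndex m) := by
      have := (initialSpan (precIndex m)).sub_mem hQm (hP m).1
      rwa [sub_sub_sub_cancel_right] at this
    -- The difference has eigenvalue γ_m but lies in the span of earlier monomials, where γ_m is not
    -- a diagonal entry.
    refine sub_eq_zero.1 (triangular_eq_zero hL (z := t.gamma m) (precIndex m)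
      (fun n hn => hγ.ne fun h => ?_) _ hd ?_)
    · rw [h] at hn
      exact lt_irrefl _ hn
    · rw [map_sub, h3, (hP m).2, smul_sub]

end Existence

/-! ### Distinctness of the eigenvalues -/

theorem gamma_inv (t : Parameters) (m : ℤ) : t.inv.gamma m = (t.gamma m)⁻¹ := by
  simp only [Parameters.gamma, Parameters.inv, Parameters.q, mul_inv, ← inv_zpow]
  rw [← mul_inv, inv_pow]

theorem gamma_injective {t : Parameters} (ht : t.Admissible)
    (hkk : ∀ n : ℕ, 1 ≤ n → t.k₀ ^ 2 * t.k₁ ^ 2 * t.q ^ n ≠ 1) : Function.Injective t.gamma := by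
  have hq := ht.q_ne
  have hk : t.k₀ * t.k₁ ≠ 0 := mul_ne_zero ht.k₀_ne ht.k₁_ne
  have hqinj : Function.Injective fun n : ℤ => t.q ^ n := fun m n h =>
    (zpow_right_strictAnti₀ ht.q_pos ht.q_lt_one).injective (by
      simpa only [norm_zpow] using congrArg norm h)
  -- For indices of opposite type, equality would mean k₀² k₁² q^{m-n} = 1 with m - n ≥ 1; otherwise
  -- |q| < 1 separates the powers.
  have key : ∀ m n : ℤ, 0 ≤ m → n < 0 → t.gamma m ≠ t.gamma n := by
    intro m n hm hn h
    rw [Parameters.gamma, Parameters.gamma, if_pos hm, if_neg (not_le.2 hn), zpow_one,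
      zpow_neg_one] at h
    refine hkk (m - n).toNat (by omega) ?_
    rw [← zpow_natCast t.q, Int.toNat_of_nonneg (by omega), zpow_sub₀ hq]
    have hqn : t.q ^ n ≠ 0 := zpow_ne_zero _ hq
    rw [← mul_div_assoc, div_eq_one_iff_eq hqn]
    calc _ = t.k₀ * t.k₁ * (t.k₀ * t.k₁ * t.q ^ m) := by ring
      _ = _ := by rw [h, mul_inv_cancel_left₀ hk]
  intro m n h
  by_cases hm : 0 ≤ m <;> by_cases hn : 0 ≤ n
  · rw [Parameters.gamma, Parameters.gamma, if_pos hm, if_pos hn] at h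
    exact hqinj (mul_left_cancel₀ (zpow_ne_zero _ hk) h)
  · exact absurd h (key m n hm (not_le.1 hn))
  · exact absurd h.symm (key n m hn (not_le.1 hm))
  · rw [Parameters.gamma, Parameters.gamma, if_neg hm, if_neg hn] at h
    exact hqinj (mul_left_cancel₀ (zpow_ne_zero _ hk) h)

/-! ### The constant term of a truncated theta function -/

section Theta

variable {q : ℂ}

/-- The `q`-binomial theorem. -/
theorem coeff_prod_one_sub (hq : q ≠ 0) (n j : ℕ) :
    (∏ i ∈ Finset.range n, (1 - Polynomial.C (q ^ i) * Polynomial.X)).coeff j *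
      ∏ i ∈ Finset.range j, (1 - q ^ (i + 1)) =
    (∏ i ∈ Finset.range j, -q ^ i) * ∏ i ∈ Finset.range j, (1 - q ^ ((n : ℤ) - i)) := by
  -- The exponents n - i are integers so that the formula also covers j > n, where the factor with i
  -- = n vanishes.
  induction n generalizing j with
  | zero =>
    cases j with
    | zero => simp
    | succ j =>
      rw [Finset.prod_range_succ' (fun i : ℕ => 1 - q ^ (((0 : ℕ) : ℤ) - i))]
      simp [Polynomial.coeff_one]
  | succ n ih =>
    rw [Finset.prod_range_succ, mul_sub, mul_one, Polynomial.coeff_sub]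
    cases j with
    | zero =>
      have := ih 0
      simpa [Polynomial.mul_coeff_zero] using this
    | succ j =>
      have h1 := ih (j + 1)
      have h2 := ih j
      have e1 : ((n + 1 : ℕ) : ℤ) - ((0 : ℕ) : ℤ) = n + 1 := by push_cast; ring
      have e2 : ∀ i : ℕ, ((n + 1 : ℕ) : ℤ) - ((i + 1 : ℕ) : ℤ) = n - i := fun i => by
        push_cast; ring
      rw [Finset.prod_range_succ' (fun i : ℕ => 1 - q ^ (((n + 1 : ℕ) : ℤ) - i)), e1]
      simp only [e2]
      rw [mul_left_comm, Polynomial.coeff_C_mul, Polynomial.coeff_mul_X, sub_mul, h1,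
        Finset.prod_range_succ _ j, Finset.prod_range_succ _ j, Finset.prod_range_succ _ j]
      have e3 : q ^ ((n : ℤ) - j) * q ^ j = q ^ n := by
        rw [zpow_sub₀ hq, zpow_natCast, zpow_natCast, div_mul_cancel₀ _ (pow_ne_zero _ hq)]
      have e4 : q ^ ((n : ℤ) + 1) = q ^ (n + 1) := by norm_cast
      rw [e4]
      linear_combination (-(q ^ n) * (1 - q ^ (j + 1))) * h2 +
        (∏ i ∈ Finset.range j, -q ^ i) * (∏ i ∈ Finset.range j, (1 - q ^ ((n : ℤ) - i))) * e3

/-- A truncated theta function in terms of a `q`-shifted factorial. -/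
theorem truncatedTheta_eq (hq : q ≠ 0) (M : ℕ) {y : ℂ} (hy : y ≠ 0) :
    (∏ i ∈ Finset.range (M + 1), (1 - q ^ i * y)) *
        ∏ i ∈ Finset.range M, (1 - q ^ (i + 1) * y⁻¹) =
      (∏ i ∈ Finset.range M, -q ^ (i + 1)) * (y⁻¹ ^ M *
        (∏ i ∈ Finset.range (2 * M + 1), (1 - Polynomial.C (q ^ i) * Polynomial.X)).eval
          ((q ^ M)⁻¹ * y)) := by
  have e : 2 * M + 1 = M + (M + 1) := by ring
  have h1 : ∏ i ∈ Finset.range M, (1 - q ^ i * ((q ^ M)⁻¹ * y)) =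
      ∏ i ∈ Finset.range M, (1 - (q ^ (i + 1))⁻¹ * y) := by
    rw [← Finset.prod_range_reflect]
    refine Finset.prod_congr rfl fun i hi => ?_
    rw [Finset.mem_range] at hi
    have hM : M = (M - 1 - i) + (i + 1) := by omega
    congr 1
    rw [← mul_assoc]
    congr 1
    nth_rewrite 2 [hM]
    rw [pow_add]
    field_simp
  have h2 : ∀ i, 1 - q ^ (M + i) * ((q ^ M)⁻¹ * y) = 1 - q ^ i * y := fun i => by
    rw [pow_add]; field_simp
  -- Inverting each factor in y⁻¹ supplies the exponents -M, …, -1 missing from the first product,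
  -- so that both merge into one q-shifted factorial of length 2M + 1.
  have h3 : ∀ i, 1 - q ^ (i + 1) * y⁻¹ = -q ^ (i + 1) * (y⁻¹ * (1 - (q ^ (i + 1))⁻¹ * y)) :=
    fun i => by
      have := pow_ne_zero (i + 1) hq
      field_simp
      ring
  rw [Polynomial.eval_prod, e]
  simp only [Polynomial.eval_sub, Polynomial.eval_one, Polynomial.eval_mul, Polynomial.eval_C,
    Polynomial.eval_X]
  rw [Finset.prod_range_add _ M (M + 1), h1]
  simp only [h2, h3]
  rw [Finset.prod_mul_distrib, Finset.prod_mul_distrib, Finset.prod_const, Finset.card_range]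
  ring

variable {c : ℝ → ℂ} {K : NNReal}

theorem one_sub_pow_ne_zero (hq1 : ‖q‖ < 1) {n : ℕ} (hn : n ≠ 0) : 1 - q ^ n ≠ 0 := fun h => by
  have h1 : ‖q ^ n‖ < 1 := by
    rw [norm_pow]
    exact pow_lt_one₀ (norm_nonneg _) hq1 hn
  rw [← sub_eq_zero.1 h, norm_one] at h1
  exact lt_irrefl _ h1

theorem contourIntegral_truncatedTheta (hc : LipschitzOnWith K c (Icc 0 1)) (hcl : c 0 = c 1)
    (h0 : (0 : ℂ) ∉ trace c) (hq : q ≠ 0) (hq1 : ‖q‖ < 1) (M : ℕ) :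
    contourIntegral c (fun x => (∏ i ∈ Finset.range (M + 1), (1 - q ^ i * x ^ 2)) *
        (∏ i ∈ Finset.range M, (1 - q ^ (i + 1) * (x ^ 2)⁻¹)) / x) =
      (∏ i ∈ Finset.range M, (1 - q ^ (2 * M + 1 - i)) / (1 - q ^ (i + 1))) *
        contourIntegral c (fun x => (x - 0)⁻¹) := by
  have hx0 : ∀ x ∈ trace c, x ≠ 0 := fun x hx h => h0 (h ▸ hx)
  set p : Polynomial ℂ :=
    ∏ i ∈ Finset.range (2 * M + 1), (1 - Polynomial.C (q ^ i) * Polynomial.X) with hp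
  set s := (∏ i ∈ Finset.range M, -q ^ (i + 1)) with hs
  set W := contourIntegral c (fun x => (x - 0)⁻¹) with hW
  have hsum : ∀ (D : ℕ) (g : ℕ → ℂ), contourIntegral c
      (fun x => ∑ j ∈ Finset.range D, g j * (x ^ (2 * (j : ℤ) - 2 * M) / x)) =
      if M < D then g M * W else 0 := by
    intro D g
    have hcont : ∀ j : ℕ, ContinuousOn (fun x => g j * (x ^ (2 * (j : ℤ) - 2 * M) / x))
        (trace c) := fun j => continuousOn_const.mul (ContinuousOn.div (fun x hx =>
          (continuousAt_zpow₀ x _ (Or.inl (hx0 x hx))).continuousWithinAt) continuousOn_id hx0)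
    induction D with
    | zero => simp [contourIntegral]
    | succ D ih =>
      simp only [Finset.sum_range_succ]
      rw [contourIntegral_add (contourIntegrable_of_continuousOn hc
        (continuousOn_finsetSum _ fun j _ => hcont j))
        (contourIntegrable_of_continuousOn hc (hcont D)), ih, contourIntegral_const_mul,
        contourIntegral_zpow hc hcl h0, ← hW]
      rcases lt_trichotomy M D with h | h | h
      · rw [if_pos h, if_pos (h.trans D.lt_succ_self), if_neg (by omega), mul_zero, add_zero]
      · subst h
        rw [if_neg (lt_irrefl M), if_pos (sub_self _), if_pos M.lt_succ_self, zero_add]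
      · rw [if_neg h.not_gt, if_neg (by omega : ¬ 2 * (D : ℤ) - 2 * M = 0),
          if_neg (by omega : ¬ M < D + 1), mul_zero, add_zero]
  -- Only the term j = M, the constant term in x, survives integration. The maximum in the range
  -- guarantees that it is listed without computing the degree.
  have h1 : contourIntegral c (fun x => (∏ i ∈ Finset.range (M + 1), (1 - q ^ i * x ^ 2)) *
        (∏ i ∈ Finset.range M, (1 - q ^ (i + 1) * (x ^ 2)⁻¹)) / x) =
      contourIntegral c (fun x => ∑ j ∈ Finset.range (max p.natDegree M + 1),
        (s * (p.coeff j * (q ^ M)⁻¹ ^ j)) * (x ^ (2 * (j : ℤ) - 2 * M) / x)) := by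
    refine contourIntegral_congr fun x hx => ?_
    have hx' := hx0 x hx
    rw [truncatedTheta_eq hq M (pow_ne_zero 2 hx'), ← hp, ← hs, Polynomial.eval_eq_sum_range'
      (Nat.lt_succ_of_le (le_max_left p.natDegree M)), Finset.mul_sum, Finset.mul_sum,
      Finset.sum_div]
    refine Finset.sum_congr rfl fun j _ => ?_
    rw [mul_pow, zpow_sub₀ hx', zpow_mul, zpow_mul, zpow_natCast, zpow_natCast, inv_pow (x ^ 2)]
    norm_cast
    field_simp
  have h2 := coeff_prod_one_sub hq (2 * M + 1) M
  rw [h1, hsum, if_pos (by omega)]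
  congr 1
  have h3 : ∏ i ∈ Finset.range M, (1 - q ^ (i + 1)) ≠ 0 :=
    Finset.prod_ne_zero_iff.2 fun i _ => one_sub_pow_ne_zero hq1 i.succ_ne_zero
  have h4 : ∏ i ∈ Finset.range M, (1 - q ^ (((2 * M + 1 : ℕ) : ℤ) - i)) =
      ∏ i ∈ Finset.range M, (1 - q ^ (2 * M + 1 - i)) := by
    refine Finset.prod_congr rfl fun i hi => ?_
    rw [Finset.mem_range] at hi
    rw [← Nat.cast_sub (by omega), zpow_natCast]
  -- The signs cancel in pairs and the powers of q add up to q^{N²}, which offsets the rescaling of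
  -- the variable by q^{-M}.
  have h5 : ∀ N : ℕ, (∏ i ∈ Finset.range N, -q ^ (i + 1)) * ∏ i ∈ Finset.range N, -q ^ i =
      (q ^ N) ^ N := by
    intro N
    induction N with
    | zero => simp
    | succ N ih =>
      rw [Finset.prod_range_succ, Finset.prod_range_succ]
      calc _ = ((∏ i ∈ Finset.range N, -q ^ (i + 1)) * ∏ i ∈ Finset.range N, -q ^ i) *
            (q ^ (N + 1) * q ^ N) := by ring
        _ = _ := by rw [ih]; ring
  have h6 : (q ^ M) ^ M ≠ 0 := pow_ne_zero _ (pow_ne_zero _ hq)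
  rw [← hp, h4] at h2
  rw [Finset.prod_div_distrib, eq_div_iff h3, inv_pow]
  calc _ = s * (p.coeff M * ∏ i ∈ Finset.range M, (1 - q ^ (i + 1))) * ((q ^ M) ^ M)⁻¹ := by ring
    _ = (s * ∏ i ∈ Finset.range M, -q ^ i) * ((q ^ M) ^ M)⁻¹ *
          ∏ i ∈ Finset.range M, (1 - q ^ (2 * M + 1 - i)) := by rw [h2]; ring
    _ = _ := by rw [hs, h5, mul_inv_cancel₀ h6, one_mul]

theorem prod_one_add_le_exp {ρ : ℝ} (h0 : 0 ≤ ρ) (h1 : ρ < 1) {C : ℝ} (hC : 0 ≤ C) (M : ℕ) :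
    ∏ i ∈ Finset.range M, (1 + C * ρ ^ i) ≤ Real.exp (C / (1 - ρ)) := by
  have hs := summable_geometric_of_lt_one h0 h1
  calc _ ≤ ∏ i ∈ Finset.range M, Real.exp (C * ρ ^ i) := by
        refine Finset.prod_le_prod (fun i _ => by positivity) fun i _ => ?_
        rw [add_comm]
        exact Real.add_one_le_exp _
    _ = Real.exp (∑ i ∈ Finset.range M, C * ρ ^ i) := (Real.exp_sum _ _).symm
    _ ≤ _ := by
        rw [← Finset.mul_sum, div_eq_mul_inv, ← tsum_geometric_of_lt_one h0 h1]
        gcongr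
        exact hs.sum_le_tsum _ fun i _ => pow_nonneg h0 i

/-- The constant terms of the truncated theta functions are bounded away from zero. -/
theorem eventually_le_norm_thetaCoeff (hq1 : ‖q‖ < 1) :
    ∃ δ > 0, ∀ᶠ M : ℕ in atTop,
      δ ≤ ‖∏ i ∈ Finset.range M, (1 - q ^ (2 * M + 1 - i)) / (1 - q ^ (i + 1))‖ := by
  have hρ := norm_nonneg q
  refine ⟨1 / 2 / Real.exp (1 / (1 - ‖q‖)), by positivity, ?_⟩
  have hlim := tendsto_self_mul_const_pow_of_lt_one hρ hq1
  filter_upwards [hlim.eventually (gt_mem_nhds (show (0 : ℝ) < 1 / 2 by norm_num))] with M hM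
  rw [Finset.prod_div_distrib, norm_div, norm_prod, norm_prod]
  have hden : ∏ i ∈ Finset.range M, ‖1 - q ^ (i + 1)‖ ≤ Real.exp (1 / (1 - ‖q‖)) := by
    refine le_trans (Finset.prod_le_prod (fun _ _ => norm_nonneg _) fun i _ => ?_)
      (prod_one_add_le_exp hρ hq1 zero_le_one M)
    calc _ ≤ ‖(1 : ℂ)‖ + ‖q ^ (i + 1)‖ := norm_sub_le _ _
      _ ≤ _ := by
        rw [norm_one, norm_pow, one_mul]
        gcongr 1 + ?_
        exact pow_le_pow_of_le_one hρ hq1.le i.le_succ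
  have hden0 : 0 < ∏ i ∈ Finset.range M, ‖1 - q ^ (i + 1)‖ :=
    Finset.prod_pos fun i _ => norm_pos_iff.2 (one_sub_pow_ne_zero hq1 i.succ_ne_zero)
  have hpow1 : ‖q‖ ^ M ≤ 1 := pow_le_one₀ hρ hq1.le
  -- Every exponent is at least M, so Bernoulli's inequality gives the lower bound 1 - M|q|^M, and
  -- M|q|^M tends to 0.
  have hnum : 1 / 2 ≤ ∏ i ∈ Finset.range M, ‖1 - q ^ (2 * M + 1 - i)‖ := by
    calc (1 : ℝ) / 2 ≤ 1 + M * (-‖q‖ ^ M) := by linarith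
      _ ≤ (1 + -‖q‖ ^ M) ^ M := one_add_mul_le_pow (by linarith) M
      _ = ∏ i ∈ Finset.range M, (1 + -‖q‖ ^ M) := by simp
      _ ≤ _ := by
        refine Finset.prod_le_prod (fun _ _ => by linarith) fun i hi => ?_
        rw [Finset.mem_range] at hi
        have h1 := norm_sub_norm_le 1 (q ^ (2 * M + 1 - i))
        rw [norm_one, norm_pow] at h1
        have h2 : ‖q‖ ^ (2 * M + 1 - i) ≤ ‖q‖ ^ M :=
          pow_le_pow_of_le_one hρ hq1.le (by omega)
        linarith
  exact div_le_div₀ (by linarith) hnum hden0 hden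

end Theta

/-! ### The form does not vanish -/

section Nonvanishing

variable {t : Parameters} {c : ℝ → ℂ}

/-- The denominators of the weight function as Laurent polynomials. -/
def halfDenominator (t : Parameters) (m : ℕ) : ℂ[T;T⁻¹] :=
  (1 - (coeffA t m * t.r ^ m) • LaurentPolynomial.T 1) *
    (1 - (coeffB t m * t.r ^ m) • LaurentPolynomial.T 1)

theorem evalAt_halfDenominator (t : Parameters) (m : ℕ) {x : ℂ} (hx : x ≠ 0) :
    evalAt (halfDenominator t m) x = halfDen t m x := by
  simp only [halfDenominator, halfDen, evalAt_mul hx, evalAt_sub hx, evalAt_one hx, evalAt_smul,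
    evalAt_T, zpow_one]

/-- The denominator of a truncation of the weight function. -/
def truncatedDenominator (t : Parameters) (M : ℕ) : ℂ[T;T⁻¹] :=
  halfDenominator t 0 * ((∏ m ∈ Finset.range M, halfDenominator t (m + 1)) *
    ∏ m ∈ Finset.range M, LaurentPolynomial.invert (halfDenominator t (m + 1)))

theorem evalAt_truncatedDenominator (t : Parameters) (M : ℕ) {x : ℂ} (hx : x ≠ 0) :
    evalAt (truncatedDenominator t M) x =
      halfDen t 0 x * ((∏ m ∈ Finset.range M, halfDen t (m + 1) x) *
        ∏ m ∈ Finset.range M, halfDen t (m + 1) (1 / x)) := by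
  simp only [truncatedDenominator, evalAt_mul hx, evalAt_prod hx, ← evalAt_inv,
    evalAt_halfDenominator t _ hx, evalAt_halfDenominator t _ (inv_ne_zero hx), one_div]

theorem truncatedDenominator_mul_halfFactor (t : Parameters) (M : ℕ) {x : ℂ} (hx : x ≠ 0)
    (h : x ∈ regularSet (poles t 0)) (h' : 1 / x ∈ regularSet (poles t 0)) :
    evalAt (truncatedDenominator t M) x * (halfFactor t 0 x *
        ((∏ m ∈ Finset.range M, halfFactor t (m + 1) x) *
          ∏ m ∈ Finset.range M, halfFactor t (m + 1) (1 / x))) =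
      (∏ i ∈ Finset.range (M + 1), (1 - t.q ^ i * x ^ 2)) *
        ∏ i ∈ Finset.range M, (1 - t.q ^ (i + 1) * (x ^ 2)⁻¹) := by
  have e : ∀ m y, y ∈ regularSet (poles t 0) →
      halfDen t m y * halfFactor t m y = 1 - t.q ^ m * y ^ 2 := fun m y hy => by
    rw [halfFactor, mul_div_cancel₀ _ (halfDen_ne_zero hy), Parameters.q, ← pow_mul, mul_comm 2 m,
      mul_pow, pow_mul]
  rw [evalAt_truncatedDenominator t M hx, Finset.prod_range_succ' _ M, mul_mul_mul_comm, e 0 x h,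
    mul_mul_mul_comm, ← Finset.prod_mul_distrib, ← Finset.prod_mul_distrib]
  simp only [e _ x h, e _ _ h']
  simp only [one_div, inv_pow]
  ring

theorem exists_norm_truncatedDenominator_le (hr : ‖t.r‖ < 1) {K : Set ℂ} (hK : IsCompact K)
    (h0 : (0 : ℂ) ∉ K) :
    ∃ B, 0 ≤ B ∧ ∀ M, ∀ x ∈ K, ‖evalAt (truncatedDenominator t M) x‖ ≤ B := by
  obtain ⟨A, hA, hA'⟩ := exists_coeff_bound t
  have hx0 : ∀ x ∈ K, x ≠ 0 := fun x hx h => h0 (h ▸ hx)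
  obtain ⟨R, hR⟩ := hK.exists_bound_of_continuousOn continuousOn_id
  obtain ⟨R', hR'⟩ := hK.exists_bound_of_continuousOn (continuousOn_inv₀.mono hx0)
  set C := A * (|R| + |R'|) with hC
  have hC0 : 0 ≤ C := by positivity
  have hρ := norm_nonneg t.r
  have hfac : ∀ m y, ‖y‖ ≤ |R| + |R'| → ‖halfDen t m y‖ ≤ (1 + C * ‖t.r‖ ^ m) ^ 2 := by
    intro m y hy
    have h : ∀ a : ℂ, ‖a‖ ≤ A → ‖1 - a * t.r ^ m * y‖ ≤ 1 + C * ‖t.r‖ ^ m := fun a ha => by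
      refine (norm_sub_le _ _).trans ?_
      rw [norm_one, norm_mul, norm_mul, norm_pow, hC]
      calc 1 + ‖a‖ * ‖t.r‖ ^ m * ‖y‖ ≤ 1 + A * ‖t.r‖ ^ m * (|R| + |R'|) := by gcongr
        _ = _ := by ring
    rw [halfDen, norm_mul, sq]
    exact mul_le_mul (h _ (hA' m).1) (h _ (hA' m).2) (norm_nonneg _) (by positivity)
  set E := Real.exp (C / (1 - ‖t.r‖)) with hE
  have hprod : ∀ M y, ‖y‖ ≤ |R| + |R'| →
      ‖∏ m ∈ Finset.range M, halfDen t (m + 1) y‖ ≤ E ^ 2 := fun M y hy => by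
    rw [norm_prod]
    calc _ ≤ ∏ m ∈ Finset.range M, (1 + C * ‖t.r‖ ^ m) ^ 2 := by
          refine Finset.prod_le_prod (fun _ _ => norm_nonneg _) fun m _ => (hfac _ y hy).trans ?_
          have := pow_le_pow_of_le_one hρ hr.le m.le_succ
          gcongr
      _ ≤ _ := by
        rw [Finset.prod_pow]
        have := prod_one_add_le_exp hρ hr hC0 M
        have h0 : 0 ≤ ∏ i ∈ Finset.range M, (1 + C * ‖t.r‖ ^ i) :=
          Finset.prod_nonneg fun _ _ => by positivity
        gcongr
  refine ⟨(1 + C * ‖t.r‖ ^ 0) ^ 2 * (E ^ 2 * E ^ 2), by positivity, fun M x hx => ?_⟩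
  have h1 : ‖x‖ ≤ |R| + |R'| :=
    ((hR x hx).trans (le_abs_self R)).trans (le_add_of_nonneg_right (abs_nonneg _))
  have h2 : ‖1 / x‖ ≤ |R| + |R'| := by
    rw [one_div]
    exact ((hR' x hx).trans (le_abs_self R')).trans (le_add_of_nonneg_left (abs_nonneg _))
  rw [evalAt_truncatedDenominator t M (hx0 x hx), norm_mul, norm_mul]
  have := hfac 0 x h1
  have := hprod M x h1
  have := hprod M _ h2
  gcongr

/-- Some moment of the weight function is non-zero. -/
theorem IsContour.exists_form_one_ne_zero (ht : t.Admissible) (hc : IsContour t c) :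
    ∃ f, form t c f 1 ≠ 0 := by
  by_contra! hall
  obtain ⟨K, hK⟩ := hc.jordan.lipschitz
  have h2πi : (2 * Real.pi * Complex.I : ℂ) ≠ 0 := by
    simp [Real.pi_ne_zero]
  have hx0 : ∀ x ∈ trace c, x ≠ 0 := fun x hx h => hc.zero_notMem (h ▸ hx)
  have hsub := hc.trace_subset 0
  have hmaps : ∀ x ∈ trace c, 1 / x ∈ regularSet (poles t 0) := fun x hx => by
    simpa using hc.mapsTo_div ht 0 hx
  have hzero : ∀ f, contourIntegral c (fun x => evalAt f x * (weight t x / x)) = 0 := fun f => by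
    have h := hall f
    rw [form, mul_eq_zero_iff_left (inv_ne_zero h2πi)] at h
    rw [← h]
    refine contourIntegral_congr fun x hx => ?_
    simp only [integrand]
    rw [evalAt_one (inv_ne_zero (hx0 x hx)), mul_one, mul_div_assoc]
  set f : ℕ → ℂ → ℂ := fun M x => (∏ m ∈ Finset.range M, halfFactor t (m + 1) x) *
    ∏ m ∈ Finset.range M, halfFactor t (m + 1) (1 / x) with hf
  set g : ℂ → ℂ := fun x => halfFactor t 0 x / x with hg
  have hgc : ContinuousOn g (trace c) :=
    (continuousOn_halfFactor t 0 fun x hx => halfDen_ne_zero (hsub hx)).div continuousOn_id hx0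
  have hfc : ∀ M, ContinuousOn (f M) (trace c) := fun M => by
    refine (continuousOn_finsetProd _ fun m _ => ?_).mul
      (continuousOn_finsetProd _ fun m _ => ?_)
    · exact continuousOn_halfFactor t _ fun x hx => halfDen_ne_zero (hsub hx)
    · exact (continuousOn_halfFactor t (m + 1) (K := (fun x => 1 / x) '' trace c) (by
        rintro _ ⟨x, hx, rfl⟩
        exact halfDen_ne_zero (hmaps x hx))).comp
        (continuousOn_const.div continuousOn_id hx0) (mapsTo_image _ _)
  have hlim : TendstoUniformlyOn f (fun x => halfProd t 1 x * halfProd t 1 (1 / x)) atTop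
      (trace c) := by
    simpa [hf] using hc.tendstoUniformlyOn_symmetricProd ht 1 0
  have hlim' := TendstoUniformlyOn.mul_left_of_continuousOn (isCompact_trace hK) hlim hfc hgc
  have hw : ∀ x, g x * (halfProd t 1 x * halfProd t 1 (1 / x)) = weight t x / x := fun x => by
    rw [weight_eq_mul₁ ht.r_lt_one, hg]
    ring
  simp only [hw] at hlim'
  obtain ⟨B, hB, hB'⟩ :=
    exists_norm_truncatedDenominator_le ht.r_lt_one (isCompact_trace hK) hc.zero_notMem
  have hwc : ContinuousOn (fun x => weight t x / x) (trace c) :=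
    (hc.continuousOn_weight ht).div continuousOn_id hx0
  have hDc : ∀ M, ContinuousOn (evalAt (truncatedDenominator t M)) (trace c) := fun M =>
    continuousOn_evalAt _ hc.zero_notMem
  -- The multiplier varies with M, so uniform convergence of the truncated weights is not enough;
  -- the bound `B` on all denominators at once is essential.
  have hunif : TendstoUniformlyOn
      (fun M x => evalAt (truncatedDenominator t M) x * (g x * f M x - weight t x / x))
      (fun _ => 0) atTop (trace c) := by
    rw [Metric.tendstoUniformlyOn_iff] at hlim' ⊢
    intro ε hε
    filter_upwards [hlim' (ε / (B + 1)) (by positivity)] with M hM x hx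
    rw [dist_comm, dist_zero_right, norm_mul, ← dist_eq_norm, dist_comm]
    calc _ ≤ B * (ε / (B + 1)) := mul_le_mul (hB' M x hx) (hM x hx).le dist_nonneg hB
      _ < ε := by
        rw [mul_div_assoc', div_lt_iff₀ (by positivity)]
        linarith
  have hI : Tendsto (fun M => contourIntegral c fun x =>
      evalAt (truncatedDenominator t M) x * (g x * f M x - weight t x / x)) atTop
      (𝓝 (contourIntegral c fun _ => 0)) :=
    tendsto_contourIntegral hK (fun M => (hDc M).mul ((hgc.mul (hfc M)).sub hwc)) hunif
  have hI0 : contourIntegral c (fun _ => 0) = 0 := by simp [contourIntegral]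
  -- The part with the full weight is a moment and vanishes by assumption. In the other part the
  -- denominators cancel and a truncated theta function remains.
  have hval : ∀ M, contourIntegral c (fun x =>
      evalAt (truncatedDenominator t M) x * (g x * f M x - weight t x / x)) =
      (∏ i ∈ Finset.range M, (1 - t.q ^ (2 * M + 1 - i)) / (1 - t.q ^ (i + 1))) *
        (2 * Real.pi * Complex.I) := fun M => by
    rw [← hc.counterclockwise 0 (zero_mem_inside ht hc), ← contourIntegral_truncatedTheta hK
      hc.jordan.closed hc.zero_notMem ht.q_ne ht.q_lt_one M]
    have h : ∀ x ∈ trace c, (∏ i ∈ Finset.range (M + 1), (1 - t.q ^ i * x ^ 2)) *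
        (∏ i ∈ Finset.range M, (1 - t.q ^ (i + 1) * (x ^ 2)⁻¹)) / x =
        evalAt (truncatedDenominator t M) x * (g x * f M x) := fun x hx => by
      rw [← truncatedDenominator_mul_halfFactor t M (hx0 x hx) (hsub hx) (hmaps x hx)]
      ring
    have h1 : ContinuousOn (fun x => (∏ i ∈ Finset.range (M + 1), (1 - t.q ^ i * x ^ 2)) *
        (∏ i ∈ Finset.range M, (1 - t.q ^ (i + 1) * (x ^ 2)⁻¹)) / x) (trace c) := by
      exact ((hDc M).mul (hgc.mul (hfc M))).congr h
    have h2 : ContinuousOn (fun x => evalAt (truncatedDenominator t M) x * (weight t x / x))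
        (trace c) := (hDc M).mul hwc
    rw [← sub_zero (contourIntegral c fun x => _ / x), ← hzero (truncatedDenominator t M),
      ← contourIntegral_sub (contourIntegrable_of_continuousOn hK h1)
        (contourIntegrable_of_continuousOn hK h2)]
    refine contourIntegral_congr fun x hx => ?_
    simp only [h x hx]
    ring
  rw [hI0] at hI
  simp only [hval] at hI
  obtain ⟨δ, hδ, hδ'⟩ := eventually_le_norm_thetaCoeff ht.q_lt_one
  have hI' := hI.norm
  rw [norm_zero] at hI'
  have h2 : (0 : ℝ) < δ * ‖(2 * Real.pi * Complex.I : ℂ)‖ := mul_pos hδ (norm_pos_iff.2 h2πi)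
  obtain ⟨M, hM1, hM2⟩ := (hδ'.and (hI'.eventually (gt_mem_nhds h2))).exists
  rw [norm_mul] at hM2
  exact absurd hM2 (not_lt.2 (by gcongr))

end Nonvanishing

/-! ### The radical of the form -/

section Radical

/-- A weak Nullstellensatz. -/
theorem exists_common_zero {I : Ideal ℂ[T;T⁻¹]} (hI : I ≠ ⊤) :
    ∃ z : ℂ, z ≠ 0 ∧ ∀ f ∈ I, evalAt f z = 0 := by
  obtain ⟨m, hm, hIm⟩ := I.exists_le_maximal hI
  let _ : Field (ℂ[T;T⁻¹] ⧸ m) := Ideal.Quotient.field m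
  have hft : Algebra.FiniteType ℂ (ℂ[T;T⁻¹] ⧸ m) :=
    Algebra.FiniteType.of_surjective (Ideal.Quotient.mkₐ ℂ m) (Ideal.Quotient.mkₐ_surjective ℂ m)
  -- A field that is finitely generated as a ℂ-algebra is finite over ℂ, hence equal to ℂ; the
  -- common zero is the image of x.
  have hfin : Module.Finite ℂ (ℂ[T;T⁻¹] ⧸ m) := finite_of_finite_type_of_isJacobsonRing _ _
  set e := AlgEquiv.ofBijective (Algebra.ofId ℂ (ℂ[T;T⁻¹] ⧸ m))
    (IsAlgClosed.algebraMap_bijective_of_isIntegral (k := ℂ) (K := ℂ[T;T⁻¹] ⧸ m))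
  set φ : ℂ[T;T⁻¹] →ₐ[ℂ] ℂ := e.symm.toAlgHom.comp (Ideal.Quotient.mkₐ ℂ m)
  have hφ : ∀ f ∈ I, φ f = 0 := fun f hf => by
    have h : Ideal.Quotient.mkₐ ℂ m f = 0 := Ideal.Quotient.eq_zero_iff_mem.2 (hIm hf)
    simp only [φ, AlgHom.comp_apply, h, map_zero]
  have hz : φ (LaurentPolynomial.T 1) ≠ 0 :=
    ((LaurentPolynomial.isUnit_T (R := ℂ) 1).map φ).ne_zero
  have hT : ∀ n : ℤ, φ (LaurentPolynomial.T n) = φ (LaurentPolynomial.T 1) ^ n := fun n => by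
    have h : ∀ n : ℕ, φ (LaurentPolynomial.T n) = φ (LaurentPolynomial.T 1) ^ n := fun n => by
      rw [← map_pow, LaurentPolynomial.T_pow, mul_one]
    obtain ⟨n, rfl | rfl⟩ := n.eq_nat_or_neg
    · rw [h, zpow_natCast]
    · rw [zpow_neg, zpow_natCast, ← h]
      refine eq_inv_of_mul_eq_one_left ?_
      rw [← map_mul, ← LaurentPolynomial.T_add, neg_add_cancel, LaurentPolynomial.T_zero, map_one]
  refine ⟨φ (LaurentPolynomial.T 1), hz, fun f hf => ?_⟩
  rw [← hφ f hf]
  clear hf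
  induction f using LaurentPolynomial.induction_on' with
  | add f g hf hg => rw [evalAt_add, map_add, hf, hg]
  | C_mul_T n w =>
    rw [← LaurentPolynomial.smul_eq_C_mul, evalAt_smul, evalAt_T, map_smul, hT n,
      smul_eq_mul]

/-- A chain of common zeros `z, w z, w² z, …` has to stop. -/
theorem exists_pow_mul_of_step {f : ℂ[T;T⁻¹]} (hf : f ≠ 0) {Z : Set ℂ}
    (hZ : ∀ z ∈ Z, z ≠ 0 ∧ evalAt f z = 0) {p : ℂ → Prop} {w : ℂ} (hw0 : w ≠ 0) (hw1 : ‖w‖ ≠ 1)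
    (hstep : ∀ z ∈ Z, p z ∨ w * z ∈ Z) {z : ℂ} (hz : z ∈ Z) : ∃ n : ℕ, p (w ^ n * z) := by
  by_contra! hp
  have hmem : ∀ n : ℕ, w ^ n * z ∈ Z := fun n => by
    induction n with
    | zero => simpa using hz
    | succ n ih =>
      rw [pow_succ', mul_assoc]
      exact (hstep _ ih).resolve_left (hp n)
  refine hf (eq_zero_of_infinite_zeros (S := range fun n : ℕ => w ^ n * z)
    (infinite_range_of_injective fun m n hmn => ?_) ?_)
  · have h := mul_right_cancel₀ (hZ z hz).1 hmn
    have h' := congrArg norm h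
    simp only [norm_pow] at h'
    exact pow_right_injective₀ (norm_pos_iff.2 hw0) hw1 h'
  · rintro _ ⟨n, rfl⟩
    exact hZ _ (hmem n)

variable {t : Parameters}

/-- For generic parameters, the Laurent polynomials form an irreducible module. -/
theorem eq_bot_or_eq_top_of_stable (ht : t.Admissible)
    (habcd : ∀ (i j : Fin 4) (n : ℤ), t.abcd i * t.abcd j ≠ t.q ^ n) {I : Ideal ℂ[T;T⁻¹]}
    (h₁ : ∀ f ∈ I, opT₁ t f ∈ I) (h₀ : ∀ f ∈ I, opT₀ t f ∈ I) : I = ⊥ ∨ I = ⊤ := by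
  rw [or_iff_not_imp_left, ← ne_eq, Submodule.ne_bot_iff]
  rintro ⟨f₀, hf₀, hf₀'⟩
  by_contra hI
  obtain ⟨z, hz, hzI⟩ := exists_common_zero hI
  have hr := ht.r_ne
  have hq := ht.q_ne
  set Z : Set ℂ := {z | z ≠ 0 ∧ ∀ f ∈ I, evalAt f z = 0} with hZ
  -- Both f and T_1 f vanish at z, so the numerator times the divided difference does too. Either
  -- the numerator vanishes, or the divided difference does and then f(z⁻¹) = 0.
  have step₁ : ∀ z ∈ Z, (∃ i, t.abcd i * z = 1) ∨ z⁻¹ ∈ Z := by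
    rintro z ⟨hz, hzI⟩
    by_cases h : (1 - t.k₁ * t.u₁ * z) * (1 + t.k₁ * t.u₁⁻¹ * z) = 0
    · left
      rcases mul_eq_zero.1 h with h | h
      · exact ⟨0, by simp only [Parameters.abcd, Matrix.cons_val]; linear_combination -h⟩
      · exact ⟨1, by simp only [Parameters.abcd, Matrix.cons_val]; linear_combination -h⟩
    · refine Or.inr ⟨inv_ne_zero hz, fun f hf => ?_⟩
      have h1 := evalAt_opT₁ t f hz
      rw [hzI _ (h₁ f hf), hzI f hf, mul_zero, zero_sub, eq_comm, neg_eq_zero] at h1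
      have h2 := evalAt_dividedDifference₁ hr f hz
      rw [(mul_eq_zero.1 h1).resolve_left (mul_ne_zero (inv_ne_zero ht.k₁_ne) h), hzI f hf,
        mul_zero, zero_sub, eq_comm, neg_eq_zero] at h2
      exact h2
  have step₀ : ∀ z ∈ Z, (∃ i, t.abcd i = z) ∨ t.q / z ∈ Z := by
    rintro z ⟨hz, hzI⟩
    by_cases h : (1 - t.k₀ * t.u₀ * (t.r * z⁻¹)) * (1 + t.k₀ * t.u₀⁻¹ * (t.r * z⁻¹)) = 0
    · left
      have hzz : z * z⁻¹ = 1 := mul_inv_cancel₀ hz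
      rcases mul_eq_zero.1 h with h | h
      · exact ⟨2, by
          simp only [Parameters.abcd, Matrix.cons_val]
          linear_combination (-t.k₀ * t.u₀ * t.r) * hzz - z * h⟩
      · exact ⟨3, by
          simp only [Parameters.abcd, Matrix.cons_val]
          linear_combination (t.k₀ * t.u₀⁻¹ * t.r) * hzz - z * h⟩
    · refine Or.inr ⟨div_ne_zero hq hz, fun f hf => ?_⟩
      have h1 := evalAt_opT₀ t f hz
      rw [hzI _ (h₀ f hf), hzI f hf, mul_zero, zero_sub, eq_comm, neg_eq_zero] at h1
      have h2 := evalAt_dividedDifference₀ hr f hz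
      rw [(mul_eq_zero.1 h1).resolve_left (mul_ne_zero (inv_ne_zero ht.k₀_ne) h), hzI f hf,
        mul_zero, zero_sub, eq_comm, neg_eq_zero] at h2
      exact h2
  -- The composites of the two reflections are the dilations by q and, in the other order, by q⁻¹;
  -- each can be blocked at either of its two steps.
  have hup : ∀ z ∈ Z, (∃ i, t.abcd i * z = 1) ∨ t.q * z ∈ Z := fun z hz => by
    rcases step₁ z hz with h | h
    · exact Or.inl h
    · rcases step₀ _ h with ⟨i, hi⟩ | h
      · exact Or.inl ⟨i, by rw [hi, inv_mul_cancel₀ hz.1]⟩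
      · rw [div_inv_eq_mul] at h
        exact Or.inr h
  have hdown : ∀ z ∈ Z, (∃ i, t.abcd i = z ∨ t.abcd i * t.q = z) ∨ t.q⁻¹ * z ∈ Z :=
    fun z hz => by
    rcases step₀ z hz with ⟨i, hi⟩ | h
    · exact Or.inl ⟨i, Or.inl hi⟩
    · rcases step₁ _ h with ⟨i, hi⟩ | h
      · rw [mul_div_assoc', div_eq_one_iff_eq hz.1] at hi
        exact Or.inl ⟨i, Or.inr hi⟩
      · rw [inv_div, div_eq_inv_mul] at h
        exact Or.inr h
  have hZf : ∀ z ∈ Z, z ≠ 0 ∧ evalAt f₀ z = 0 := fun z hz => ⟨hz.1, hz.2 f₀ hf₀⟩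
  have hq1 := ht.q_lt_one.ne
  obtain ⟨m, i, hi⟩ := exists_pow_mul_of_step hf₀' hZf hq hq1 hup ⟨hz, hzI⟩
  obtain ⟨n, j, hj⟩ := exists_pow_mul_of_step hf₀' hZf (inv_ne_zero hq)
    (by rw [norm_inv]; exact inv_ne_one.2 hq1) hdown ⟨hz, hzI⟩
  rw [inv_pow] at hj
  have hm := pow_ne_zero m hq
  have hn := pow_ne_zero n hq
  have hz' : z = t.abcd j * t.q ^ n ∨ z = t.abcd j * t.q * t.q ^ n := by
    rcases hj with hj | hj
    · exact Or.inl (by rw [hj]; field_simp)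
    · exact Or.inr (by rw [hj]; field_simp)
  -- The two blocked ends combine to e f q^N = 1 for two of the parameters e, f, contrary to
  -- genericity.
  rcases hz' with rfl | rfl
  · refine habcd i j (-((m + n : ℕ) : ℤ)) ?_
    rw [zpow_neg, zpow_natCast]
    exact eq_inv_of_mul_eq_one_left (by rw [← hi]; ring)
  · refine habcd i j (-((m + n + 1 : ℕ) : ℤ)) ?_
    rw [zpow_neg, zpow_natCast]
    exact eq_inv_of_mul_eq_one_left (by rw [← hi]; ring)

/-! ### Vanishing of the left radical -/

variable {c : ℝ → ℂ}

/-- The second argument is evaluated at x⁻¹, so a factor moves across with its variable inverted.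
This is what makes the left radical an ideal. -/
theorem form_mul_left (hc : IsContour t c) (a f g : ℂ[T;T⁻¹]) :
    form t c (a * f) g = form t c f (LaurentPolynomial.invert a * g) := by
  rw [form, form]
  congr 1
  refine contourIntegral_congr fun x hx => ?_
  have hx0 : x ≠ 0 := fun h => hc.zero_notMem (h ▸ hx)
  simp only [integrand]
  rw [evalAt_mul hx0, evalAt_mul (inv_ne_zero hx0), ← evalAt_inv, inv_inv]
  ring

/-- The left radical of the form, which is an ideal. -/
def IsContour.radical (ht : t.Admissible) (hc : IsContour t c) : Ideal ℂ[T;T⁻¹] where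
  carrier := {f | ∀ g, hc.bilin ht f g = 0}
  zero_mem' g := by rw [map_zero, LinearMap.zero_apply]
  add_mem' hf hf' g := by rw [map_add, LinearMap.add_apply, hf g, hf' g, add_zero]
  smul_mem' a f hf g := by
    rw [smul_eq_mul, hc.bilin_apply, form_mul_left hc, ← hc.bilin_apply ht]
    exact hf _

theorem IsContour.separatingLeft (ht : t.Admissible) (hc : IsContour t c)
    (habcd : ∀ (i j : Fin 4) (n : ℤ), t.abcd i * t.abcd j ≠ t.q ^ n) :
    (hc.bilin ht).SeparatingLeft := by
  have h : hc.radical ht = ⊥ := by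
    have h₁ : ∀ f ∈ hc.radical ht, opT₁ t f ∈ hc.radical ht := fun f hf g => by
      rw [hc.bilin_opT₁ ht]
      exact hf _
    have h₀ : ∀ f ∈ hc.radical ht, opT₀ t f ∈ hc.radical ht := fun f hf g => by
      rw [hc.bilin_opT₀ ht]
      exact hf _
    refine (eq_bot_or_eq_top_of_stable ht habcd h₁ h₀).resolve_right fun htop => ?_
    obtain ⟨f, hf⟩ := hc.exists_form_one_ne_zero ht
    have hmem : f ∈ hc.radical ht := htop ▸ Submodule.mem_top
    exact hf (hmem 1)
  intro f hf
  have hmem : f ∈ hc.radical ht := hf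
  rwa [h] at hmem

/-! ### Bi-orthogonality and non-degeneracy -/

/-- The Cherednik-Dunkl operators for `t` and `t⁻¹` are inverse to the adjoints of each other. -/
theorem IsContour.bilin_opY_opY (ht : t.Admissible) (hc : IsContour t c) (f g : ℂ[T;T⁻¹]) :
    hc.bilin ht (opY t f) (opY t.inv g) = hc.bilin ht f g := by
  have e : ∀ k : ℂ, k⁻¹ - k⁻¹⁻¹ = -(k - k⁻¹) := fun k => by rw [inv_inv]; ring
  have h₁ : ∀ f g, hc.bilin ht (opT₁ t f) (opT₁ t.inv g) = hc.bilin ht f g := fun f g => by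
    rw [hc.bilin_opT₁ ht, opT₁_opT₁ (inv_ne_zero ht.k₁_ne) (inv_ne_zero ht.u₁_ne)
      (inv_ne_zero ht.r_ne)]
    have h : (t.inv.k₁ - t.inv.k₁⁻¹) = -(t.k₁ - t.k₁⁻¹) := e _
    rw [h, neg_smul]
    congr 1
    abel
  have h₀ : ∀ f g, hc.bilin ht (opT₀ t f) (opT₀ t.inv g) = hc.bilin ht f g := fun f g => by
    rw [hc.bilin_opT₀ ht, opT₀_opT₀ (inv_ne_zero ht.k₀_ne) (inv_ne_zero ht.u₀_ne)
      (inv_ne_zero ht.r_ne)]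
    have h : (t.inv.k₀ - t.inv.k₀⁻¹) = -(t.k₀ - t.k₀⁻¹) := e _
    rw [h, neg_smul]
    congr 1
    abel
  rw [opY, opY, LinearMap.comp_apply, LinearMap.comp_apply, h₁, h₀]

theorem bilin_eq_zero_of_gamma_ne (ht : t.Admissible) (hc : IsContour t c) {f g : ℂ[T;T⁻¹]}
    {m n : ℤ} (hf : opY t f = t.gamma m • f) (hg : opY t.inv g = t.inv.gamma n • g)
    (hn : t.gamma n ≠ 0) (hmn : t.gamma m ≠ t.gamma n) : hc.bilin ht f g = 0 := by
  have h := hc.bilin_opY_opY ht f g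
  rw [hf, hg, map_smul, LinearMap.map_smul₂, smul_eq_mul, smul_eq_mul, gamma_inv, mul_comm,
    mul_right_comm] at h
  by_contra h0
  rw [mul_eq_right₀ h0, mul_inv_eq_one₀ hn] at h
  exact hmn h

end Radical

/-- Each functional B(P_m, ·) is a multiple of the m-th coordinate of the second basis, and the
multiple is non-zero since otherwise P_m would lie in the left radical. An element killed by all of
them thus has only zero coordinates. -/
theorem nondegenerate_of_biorthogonal {V W ι : Type*} [AddCommGroup V] [Module ℂ V]
    [AddCommGroup W] [Module ℂ W] {B : V →ₗ[ℂ] W →ₗ[ℂ] ℂ} (hB : B.SeparatingLeft)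
    (P : Module.Basis ι ℂ V) (P' : Module.Basis ι ℂ W) (h : ∀ m n, m ≠ n → B (P m) (P' n) = 0) :
    B.Nondegenerate := by
  have hcoord : ∀ m, B (P m) = B (P m) (P' m) • P'.coord m := fun m => P'.ext fun n => by
    rcases eq_or_ne m n with rfl | hmn
    · simp
    · rw [h m n hmn]
      simp [hmn.symm]
  refine ⟨hB, fun g hg => P'.ext_elem fun m => ?_⟩
  have h1 := hg (P m)
  rw [hcoord m, LinearMap.smul_apply, smul_eq_mul] at h1
  rw [map_zero]
  refine (mul_eq_zero.1 h1).resolve_left fun h0 => P.ne_zero m (hB _ fun g => ?_)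
  rw [hcoord m, h0, zero_smul, LinearMap.zero_apply]

end AskeyWilson

end

theorem proposition6p7 (t : AskeyWilson.Parameters)
    (hk₀ : t.k₀ ≠ 0) (hu₀ : t.u₀ ≠ 0) (hk₁ : t.k₁ ≠ 0) (hu₁ : t.u₁ ≠ 0)
    (hq₀ : 0 < ‖t.q‖) (hq₁ : ‖t.q‖ < 1)
    (hk₀q : ∀ n : ℤ, t.k₀ ^ 2 ≠ t.q ^ n ∧ t.k₀ ^ 2 ≠ -t.q ^ n)
    (hk₁q : ∀ n : ℤ, t.k₁ ^ 2 ≠ t.q ^ n ∧ t.k₁ ^ 2 ≠ -t.q ^ n)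
    (hu₁q : ∀ n : ℤ, t.u₁ ^ 2 ≠ t.q ^ n ∧ t.u₁ ^ 2 ≠ -t.q ^ n)
    -- the eigenvalues `γ_m` are pairwise different
    (hkk : ∀ n : ℕ, 1 ≤ n → t.k₀ ^ 2 * t.k₁ ^ 2 * t.q ^ n ≠ 1)
    (habcd : ∀ (i j : Fin 4) (n : ℤ), t.abcd i * t.abcd j ≠ t.q ^ n) :
    ∃ P P' : Module.Basis ℤ ℂ (LaurentPolynomial ℂ),
      -- `P` and `P'` are the non-symmetric Askey-Wilson polynomials for the parameters
      -- `(t, q)` and `(t⁻¹, q⁻¹)`, which are unique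
      AskeyWilson.IsNonsymmetricAskeyWilson t P ∧
      (∀ Q : ℤ → LaurentPolynomial ℂ, AskeyWilson.IsNonsymmetricAskeyWilson t Q → Q = P) ∧
      AskeyWilson.IsNonsymmetricAskeyWilson t.inv P' ∧
      (∀ Q : ℤ → LaurentPolynomial ℂ, AskeyWilson.IsNonsymmetricAskeyWilson t.inv Q → Q = P') ∧
      ∀ c : ℝ → ℂ, AskeyWilson.IsContour t c →
        ∃ B : LaurentPolynomial ℂ →ₗ[ℂ] LaurentPolynomial ℂ →ₗ[ℂ] ℂ,
          (∀ f g : LaurentPolynomial ℂ,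
            AskeyWilson.ContourIntegrable c (AskeyWilson.integrand t f g) ∧
            B f g = AskeyWilson.form t c f g) ∧
          B.Nondegenerate ∧
          ∀ m n : ℤ, m ≠ n → B (P m) (P' n) = 0 := by
  have ht : t.Admissible := ⟨hk₀, hu₀, hk₁, hu₁, hq₀, hq₁⟩
  have hγ := AskeyWilson.gamma_injective ht hkk
  have hγ' : Function.Injective t.inv.gamma := fun m n h => hγ (inv_injective (by
    rwa [AskeyWilson.gamma_inv, AskeyWilson.gamma_inv] at h))
  obtain ⟨P, hP, hPu⟩ :=
    AskeyWilson.exists_nonsymmetricAskeyWilson hk₁ hu₁ hk₀ hu₀ ht.r_ne hγ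
  obtain ⟨P', hP', hPu'⟩ := AskeyWilson.exists_nonsymmetricAskeyWilson (t := t.inv)
    (inv_ne_zero hk₁) (inv_ne_zero hu₁) (inv_ne_zero hk₀) (inv_ne_zero hu₀)
    (inv_ne_zero ht.r_ne) hγ'
  refine ⟨P, P', hP, hPu, hP', hPu', fun c hc => ?_⟩
  have hortho : ∀ m n : ℤ, m ≠ n → hc.bilin ht (P m) (P' n) = 0 := fun m n hmn =>
    AskeyWilson.bilin_eq_zero_of_gamma_ne ht hc (hP m).2.2 (hP' n).2.2
      (mul_ne_zero (zpow_ne_zero _ (mul_ne_zero hk₀ hk₁)) (zpow_ne_zero _ ht.q_ne))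
      fun h => hmn (hγ h)
  exact ⟨hc.bilin ht, fun f g => ⟨hc.contourIntegrable_integrand ht f g, hc.bilin_apply ht f g⟩,
    AskeyWilson.nondegenerate_of_biorthogonal (hc.separatingLeft ht habcd) P P' hortho, hortho⟩
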